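/- Let $\mathbb{R}^{4,2}$ be $\mathbb{R}^6$ with a symmetric bilinear form $(\cdot,\cdot)$ of signature $(4,2)$, and let $\Sigma$ be a connected smooth surface. Write $d_X$ for the derivative of $\mathbb{R}^{4,2}$-valued maps. A *Legendre map* on $\Sigma$ is a smooth rank $2$ null subbundle $f$ of $\Sigma\times\mathbb{R}^{4,2}$ such that $d_X\sigma\perp f$ for every section $\sigma$ of $f$ and every $X$, and such that at each point only $X=0$ satisfies $d_X\sigma\in f$ for all sections $\sigma$ of $f$. A line $s\le f(x)$ is a *curvature sphere* at $x$ if its curvature space $T_s=\{X\in T_x\Sigma: d_X\sigma\in f(x)\text{ for all sections }\sigma\text{ of }f\text{ with }\sigma(x)\in s\}$ is non-zero. $f$ is *umbilic-free* if there are two smooth line bundles $s_1,s_2\le f$ of curvature spheres with $s_1\cap s_2=0$; put $T_i=T_{s_i}$. It is *regular* if moreover $s_1$ and $s_2$ immerse (as maps into projective space), and a *Dupin cyclide* if, for $i=1,2$, $s_i$ is constant along the leaves of $T_i$. Two umbilic-free Legendre maps $f,\hat f$ are *Ribaucour transforms* of each other if $f\cap\hat f$ is a rank $1$ bundle and their curvature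 line distributions agree, $\hat T_1=T_1$ and $\hat T_2=T_2$. For a regular $f$ let $X\in\Gamma T_1$, $Y\in\Gamma T_2$ be nowhere zero local fields and $\sigma_i$ nowhere zero local sections of $s_i$, and put $S_1=\langle\sigma_1,d_Y\sigma_1,d_Yd_Y\sigma_1\rangle$, $S_2=\langle\sigma_2,d_X\sigma_2,d_Xd_X\sigma_2\rangle$. Then $\mathbb{R}^{4,2}=S_1\oplus_\perp S_2$; let $\mathcal N$ be the off-diagonal part of $d$ for this splitting. The osculating complexes are the line bundles $L_i=\ker\mathcal N(T_i)\cap S_i\cap f^\perp$, and the osculating bundles are $\mathcal H_1=\langle l_1,d_Yl_1,d_Yd_Yl_1\rangle$, $\mathcal H_2=\langle l_2,d_Xl_2,d_Xd_Xl_2\rangle$ for nowhere zero local sections $l_i$ of $L_i$. A Euclidean space form is given by $\mathfrak p,\mathfrak q$ with $(\mathfrak p,\mathfrak p)=-1$, $\mathfrak q\neq0$, $(\mathfrak q,\mathfrak q)=0=(\mathfrak p,\mathfrak q)$: it is $\mathfrak Q^3=\{y:(y,y)=0,(y,\mathfrak q)=-1,(y,\mathfrak p)=0\}$. The point sphere map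 of $f$ is $\mathfrak f=f\cap\mathfrak Q^3$. A spacelike line $\langle s\rangle\le\mathfrak p^\perp$ represents the sphere $\{y\in\mathfrak Q^3:(y,s)=0\}$, which is a plane if $s\perp\mathfrak q$. We say that $f$ *projects to a Joachimsthal surface* in $\mathfrak Q^3$, with planar curvature lines along $T_1$ and orthogonally intersected spherical curvature lines along $T_2$, if $\mathfrak f$ is defined and immersed on a dense subset of $\Sigma$ and there is a straight line $\ell$ in $\mathfrak Q^3$ such that: (i) there is a smooth family of planes containing $\ell$, parametrised by $\Sigma$, constant along the leaves of $T_1$, nowhere tangent to the surface, with $\mathfrak f(x)$ in the plane at $x$; (ii) there is a smooth family of spheres with centre on $\ell$ (planes orthogonal to $\ell$ being admitted as spheres), parametrised by $\Sigma$, constant along the leaves of $T_2$, with $\mathfrak f(x)$ on the sphere at $x$, nowhere tangent to the surface and meeting it orthogonally. **Proposition.** Let $f$ be a Dupin cyclide on $\Sigma$ and let $\hat f$ be a regular (umbilic-free) Legendre map which is a Ribaucour transform of $f$. Then the osculating bundles $\hat{\mathcal H}_1$ and $\hat{\mathcal H}_2$ of $\hat f$ are constant subspaces of $\mathbb{R}^{4,2}$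 of signature $(2,1)$, and there are $\mathfrak p\in\hat{\mathcal H}_1$ and $\mathfrak q\in\hat{\mathcal H}_2$ defining a Euclidean space form in which $\hat f$ projects to a Joachimsthal surface, with planar curvature lines along $T_1$ and orthogonally intersected spherical curvature lines along $T_2$. -/

import Mathlib

open scoped Manifold ContDiff Topology

noncomputable section

namespace LieSphere

/-- The underlying vector space of `ℝ^{4,2}`. -/
abbrev R42 : Type := Fin 6 → ℝ

/-- The symmetric bilinear form of signature `(4,2)` on `ℝ^{4,2}`. -/
def lieForm : LinearMap.BilinForm ℝ R42 :=
  Matrix.toBilin' (Matrix.diagonal ![1, 1, 1, 1, -1, -1])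

/-- `W` is a subspace on which the form has signature `(2,1)`: it has an orthogonal basis with
squared lengths `1, 1, -1`. -/
def IsTwoOneSpace (W : Submodule ℝ R42) : Prop :=
  ∃ e : Fin 3 → R42, Submodule.span ℝ (Set.range e) = W ∧
    ∀ i j, lieForm (e i) (e j) = if i = j then ![1, 1, -1] i else 0

section Bundles

variable {M : Type*} [TopologicalSpace M] [ChartedSpace (EuclideanSpace ℝ (Fin 2)) M]
  [IsManifold (𝓡 2) ∞ M]

/-- The derivative `d_X σ` at `x` of an `ℝ^{4,2}`-valued map. -/
def dAlong (σ : M → R42) (x : M) (X : TangentSpace (𝓡 2) x) : R42 :=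
  mfderiv (𝓡 2) 𝓘(ℝ, R42) σ x X

/-- `E` is a smooth rank `k` subbundle of the trivial bundle `M × ℝ^{4,2}`. -/
def IsSubbundle (k : ℕ) (E : M → Submodule ℝ R42) : Prop :=
  ∀ x : M, ∃ U : Set M, IsOpen U ∧ x ∈ U ∧ ∃ e : Fin k → M → R42,
    (∀ i, ContMDiffOn (𝓡 2) 𝓘(ℝ, R42) ∞ (e i) U) ∧
    ∀ y ∈ U, LinearIndependent ℝ (fun i => e i y) ∧
      Submodule.span ℝ (Set.range fun i => e i y) = E y

/-- `U` is an open neighbourhood of `x` and `σ` is a smooth section of `E` over `U`. -/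
structure IsSectionNear (E : M → Submodule ℝ R42) (x : M) (U : Set M) (σ : M → R42) : Prop where
  isOpen : IsOpen U
  mem : x ∈ U
  smooth : ContMDiffOn (𝓡 2) 𝓘(ℝ, R42) ∞ σ U
  mem_fiber : ∀ y ∈ U, σ y ∈ E y

/-- `Y` is a smooth vector field over `U` with values in the distribution `T`. -/
structure IsFieldOn (T : (x : M) → Submodule ℝ (TangentSpace (𝓡 2) x)) (U : Set M)
    (Y : (x : M) → TangentSpace (𝓡 2) x) : Prop where
  smooth : ContMDiffOn (𝓡 2) (𝓡 2).tangent ∞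
    (fun y => (⟨y, Y y⟩ : TangentBundle (𝓡 2) M)) U
  mem_fiber : ∀ y ∈ U, Y y ∈ T y

/-- `E` immerses at `x`, as a map into the Grassmannian: only `X = 0` differentiates all sections
of `E` at `x` into `E x`. -/
def ImmersesAt (E : M → Submodule ℝ R42) (x : M) : Prop :=
  ∀ X : TangentSpace (𝓡 2) x,
    (∀ U σ, IsSectionNear E x U σ → dAlong σ x X ∈ E x) → X = 0

/-- `E` is constant along the leaves of `T`. -/
def ConstantAlong (E : M → Submodule ℝ R42)
    (T : (x : M) → Submodule ℝ (TangentSpace (𝓡 2) x)) : Prop :=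
  ∀ x U σ, IsSectionNear E x U σ → ∀ X ∈ T x, dAlong σ x X ∈ E x

/-- `f` is a Legendre map: a rank `2` null subbundle with `f^{(1)} ≤ f^⊥` that immerses. -/
structure IsLegendre (f : M → Submodule ℝ R42) : Prop where
  subbundle : IsSubbundle 2 f
  null : ∀ x, ∀ v ∈ f x, ∀ w ∈ f x, lieForm v w = 0
  contact : ∀ x U σ, IsSectionNear f x U σ →
    ∀ X : TangentSpace (𝓡 2) x, ∀ w ∈ f x, lieForm (dAlong σ x X) w = 0
  immerses : ∀ x, ImmersesAt f x

/-- The curvature space of `s ≤ f x`: all `X ∈ T_x M` such that `d_X σ ∈ f x` for every section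
`σ` of `f` with `σ x ∈ s`. -/
def curvatureSpace (f : M → Submodule ℝ R42) (x : M) (s : Submodule ℝ R42) :
    Submodule ℝ (TangentSpace (𝓡 2) x) where
  carrier := {X | ∀ U σ, IsSectionNear f x U σ → σ x ∈ s → dAlong σ x X ∈ f x}
  add_mem' := by
    intro X Y hX hY U σ h hs
    have e : dAlong σ x (X + Y) = dAlong σ x X + dAlong σ x Y :=
      map_add (mfderiv (𝓡 2) 𝓘(ℝ, R42) σ x) X Y
    rw [e]
    exact (f x).add_mem (hX U σ h hs) (hY U σ h hs)
  zero_mem' := by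
    intro U σ _ _
    have e : dAlong σ x 0 = 0 := map_zero (mfderiv (𝓡 2) 𝓘(ℝ, R42) σ x)
    rw [e]
    exact (f x).zero_mem
  smul_mem' := by
    intro c X hX U σ h hs
    have e : dAlong σ x (c • X) = c • dAlong σ x X :=
      map_smul (mfderiv (𝓡 2) 𝓘(ℝ, R42) σ x) c X
    rw [e]
    exact (f x).smul_mem c (hX U σ h hs)

/-- The `1`-dimensional subspace `s ≤ f x` is a curvature sphere of `f` at `x`. -/
def IsCurvatureSphere (f : M → Submodule ℝ R42) (x : M) (s : Submodule ℝ R42) : Prop :=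
  s ≤ f x ∧ Module.finrank ℝ s = 1 ∧ curvatureSpace f x s ≠ ⊥

/-- The curvature subbundle `T_s ≤ TM` of a curvature sphere congruence `s` of `f`. -/
def curvatureDist (f s : M → Submodule ℝ R42) (x : M) : Submodule ℝ (TangentSpace (𝓡 2) x) :=
  curvatureSpace f x (s x)

/-- `f` is an umbilic-free Legendre map with curvature sphere congruences `s₁`, `s₂`. -/
structure IsUmbilicFree (f s₁ s₂ : M → Submodule ℝ R42) : Prop where
  legendre : IsLegendre f
  subbundle₁ : IsSubbundle 1 s₁
  subbundle₂ : IsSubbundle 1 s₂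
  curvature₁ : ∀ x, IsCurvatureSphere f x (s₁ x)
  curvature₂ : ∀ x, IsCurvatureSphere f x (s₂ x)
  disjoint : ∀ x, Disjoint (s₁ x) (s₂ x)

/-- An umbilic-free Legendre map is regular if both curvature sphere congruences immerse. -/
structure IsRegular (f s₁ s₂ : M → Submodule ℝ R42) : Prop extends IsUmbilicFree f s₁ s₂ where
  immerses₁ : ∀ x, ImmersesAt s₁ x
  immerses₂ : ∀ x, ImmersesAt s₂ x

/-- A Dupin cyclide: an umbilic-free Legendre map for which each curvature sphere congruence is
constant along its own curvature lines (both families of curvature lines are circular). -/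
structure IsDupinCyclide (f s₁ s₂ : M → Submodule ℝ R42) : Prop
    extends IsUmbilicFree f s₁ s₂ where
  circular₁ : ConstantAlong s₁ (curvatureDist f s₁)
  circular₂ : ConstantAlong s₂ (curvatureDist f s₂)

/-- Two umbilic-free Legendre maps `f` (with curvature sphere congruences `s₁, s₂`) and `g` (with
`r₁, r₂`) are Ribaucour transforms of each other: they envelop a common sphere congruence
`f ∩ g`, and their curvature lines correspond. -/
structure IsRibaucourPair (f s₁ s₂ g r₁ r₂ : M → Submodule ℝ R42) : Prop where
  umbilicFree_left : IsUmbilicFree f s₁ s₂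
  umbilicFree_right : IsUmbilicFree g r₁ r₂
  envelope : IsSubbundle 1 (fun x => f x ⊓ g x)
  curvatureLines₁ : ∀ x, curvatureDist f s₁ x = curvatureDist g r₁ x
  curvatureLines₂ : ∀ x, curvatureDist f s₂ x = curvatureDist g r₂ x

/-- The span at `x` of `σ`, `d_Y σ`, `d_Y d_Y σ`, for `σ ∈ Γ E` and `Y ∈ Γ T`. -/
def secondJet (E : M → Submodule ℝ R42) (T : (x : M) → Submodule ℝ (TangentSpace (𝓡 2) x))
    (x : M) : Submodule ℝ R42 :=
  Submodule.span ℝ {v | ∃ U σ Y, IsSectionNear E x U σ ∧ IsFieldOn T U Y ∧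
    (v = σ x ∨ v = dAlong σ x (Y x) ∨ v = dAlong (fun y => dAlong σ y (Y y)) x (Y x))}

/-- The Lie cyclides `S₁ = ⟨σ₁, d_Y σ₁, d_Y d_Y σ₁⟩` of an umbilic-free Legendre map, where
`σ₁ ∈ Γ s₁` and `Y ∈ Γ T₂`. Exchanging `s₁` and `s₂` gives `S₂`. -/
def lieCyclide (f s₁ s₂ : M → Submodule ℝ R42) : M → Submodule ℝ R42 :=
  secondJet s₁ (curvatureDist f s₂)

/-- The osculating sphere complex `L₁ = ker 𝒩(T₁) ∩ S₁ ∩ f^⊥`. Here `𝒩(X) ξ`, for `ξ ∈ S₁ x`, is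
the `S₂`-component of `d_X τ` for a section `τ` of `S₁` through `ξ`, so that `𝒩(X) ξ = 0` says
`d_X τ ∈ S₁ x`. Exchanging `s₁` and `s₂` gives `L₂`. -/
def osculatingComplex (f s₁ s₂ : M → Submodule ℝ R42) (x : M) : Submodule ℝ R42 :=
  Submodule.span ℝ {ξ | (∀ w ∈ f x, lieForm ξ w = 0) ∧
    ∃ U τ, IsSectionNear (lieCyclide f s₁ s₂) x U τ ∧ τ x = ξ ∧
      ∀ X ∈ curvatureDist f s₁ x, dAlong τ x X ∈ lieCyclide f s₁ s₂ x}

/-- The osculating bundle `H₁ = ⟨l₁, d_Y l₁, d_Y d_Y l₁⟩`, where `l₁ ∈ Γ L₁` and `Y ∈ Γ T₂`.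
Exchanging `s₁` and `s₂` gives `H₂`. -/
def osculatingBundle (f s₁ s₂ : M → Submodule ℝ R42) : M → Submodule ℝ R42 :=
  secondJet (osculatingComplex f s₁ s₂) (curvatureDist f s₂)

/-- `p` is a (timelike, unit) point sphere complex and `q` a (nonzero, lightlike) space form
vector of a Euclidean space form. -/
structure IsEuclideanPair (p q : R42) : Prop where
  timelike : lieForm p p = -1
  ne_zero : q ≠ 0
  lightlike : lieForm q q = 0
  orthogonal : lieForm p q = 0

/-- The space form `𝔔³` defined by `p, q`, with the metric induced by `lieForm`. -/
def spaceForm (p q : R42) : Set R42 :=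
  {y | lieForm y y = 0 ∧ lieForm y q = -1 ∧ lieForm y p = 0}

/-- The oriented planes `𝔓³` of the space form defined by `p, q`. -/
def planeSpace (p q : R42) : Set R42 :=
  {y | lieForm y y = 0 ∧ lieForm y p = -1 ∧ lieForm y q = 0}

/-- The curvature lines of the point sphere map `f ∩ 𝔔³` along `T` lie on the spheres (or planes)
`{y ∈ 𝔔³ | y ⊥ S x}`. Here `S` is a bundle of spacelike lines in `⟨p⟩^⊥`, is constant along the
leaves of `T`, and is nowhere tangent to the surface (the tangent spheres at `x` being the
projections to `⟨p⟩^⊥` of the elements of `f x`). -/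
structure IsSphericalAlong (f : M → Submodule ℝ R42) (p q : R42)
    (T : (x : M) → Submodule ℝ (TangentSpace (𝓡 2) x)) (S : M → Submodule ℝ R42) : Prop where
  subbundle : IsSubbundle 1 S
  spacelike : ∀ x, ∀ s ∈ S x, s ≠ 0 → 0 < lieForm s s
  conformal : ∀ x, ∀ s ∈ S x, lieForm s p = 0
  constant : ConstantAlong S T
  incident : ∀ x, ∀ s ∈ S x, ∀ y ∈ f x, y ∈ spaceForm p q → lieForm y s = 0
  transversal : ∀ x, Disjoint (S x) (f x ⊔ Submodule.span ℝ {p})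

/-- The curvature lines along `T` are planar: the spheres are planes of the space form. -/
structure IsPlanarAlong (f : M → Submodule ℝ R42) (p q : R42)
    (T : (x : M) → Submodule ℝ (TangentSpace (𝓡 2) x)) (S : M → Submodule ℝ R42) : Prop
    extends IsSphericalAlong f p q T S where
  planar : ∀ x, ∀ s ∈ S x, lieForm s q = 0

/-- The spheres meet the surface orthogonally: `S x` is orthogonal to the tangent plane
`f x ∩ 𝔓³` at each point `y` of the surface. -/
structure IsOrthogonallySphericalAlong (f : M → Submodule ℝ R42) (p q : R42)
    (T : (x : M) → Submodule ℝ (TangentSpace (𝓡 2) x)) (S : M → Submodule ℝ R42) : Prop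
    extends IsSphericalAlong f p q T S where
  orthogonal : ∀ x, ∀ s ∈ S x, ∀ y ∈ f x, y ∈ spaceForm p q →
    ∀ t ∈ f x, t ∈ planeSpace p q → lieForm t s = 0

/-- `f`, with curvature subbundles `T₁, T₂`, projects to a Joachimsthal surface in the Euclidean
space form defined by `p, q`: the point sphere map is defined and immersed on a dense set, its
curvature lines along `T₁` lie in planes through a fixed line (the intersection of the two
orthogonal planes given by `n₁, n₂`), and those along `T₂` lie on spheres that meet the surface
orthogonally and have their centre on that line (or are planes orthogonal to it), that is,
spheres orthogonal to the planes given by `n₁, n₂`. -/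
def ProjectsToJoachimsthal (f : M → Submodule ℝ R42)
    (T₁ T₂ : (x : M) → Submodule ℝ (TangentSpace (𝓡 2) x)) (p q : R42) : Prop :=
  Dense {x : M | (∃ y ∈ f x, y ∈ spaceForm p q) ∧
    ImmersesAt (fun z => f z ⊓ lieForm.orthogonal (Submodule.span ℝ {p})) x} ∧
  ∃ n₁ n₂ : R42,
    (lieForm n₁ n₁ = 1 ∧ lieForm n₂ n₂ = 1 ∧ lieForm n₁ n₂ = 0) ∧
    (lieForm n₁ p = 0 ∧ lieForm n₁ q = 0 ∧ lieForm n₂ p = 0 ∧ lieForm n₂ q = 0) ∧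
    (∃ S : M → Submodule ℝ R42, IsPlanarAlong f p q T₁ S ∧
      ∀ x, ∀ s ∈ S x, ∀ y ∈ spaceForm p q,
        lieForm y n₁ = 0 → lieForm y n₂ = 0 → lieForm y s = 0) ∧
    (∃ S : M → Submodule ℝ R42, IsOrthogonallySphericalAlong f p q T₂ S ∧
      ∀ x, ∀ s ∈ S x, lieForm s n₁ = 0 ∧ lieForm s n₂ = 0)

end Bundles

end LieSphere

end

set_option linter.unusedSectionVars false

/-! Write `g` for the Ribaucour transform. The Lie cyclides of the Dupin cyclide `f` form a constant
orthogonal splitting of `ℝ^{4,2}`, and they turn out to be the osculating bundles of `g`.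

Neither curvature sphere of `f` lies in `g` (`sphere_notMem`). Hence the curvature spheres can be
scaled so that `σ₁ + σ₂` spans `f ∩ g`, with `d_X σ₁ = a σ₁`, `d_Y σ₂ = b σ₂`, and with `d_Y σ₁`,
`d_X σ₂` of unit length. Put `ν₁ = d_Y σ₁ - b σ₁`. Since `d_Y σ₂ = b σ₂`, this is also `d_Y (σ₁ +
σ₂) - b (σ₁ + σ₂)`, so `ν₁` is orthogonal to both `f` and `g`. Conjugacy of the curvature directions
of `g`, together with `σ₁ ∉ g`, then forces `d_X ν₁ = 0` (`deriv_normal_X`), and this is the heart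
of the argument.

Splitting `d_Y ν₁ = τ₁ + κ₁ σ₁` with `τ₁` null completes a triple `σ₁, ν₁, τ₁` whose span is closed
under differentiation. The same holds with the indices exchanged, and the two triples are mutually
orthogonal (`isNullFrame`). In this frame `g = ⟨σ₁ + σ₂, τ₁ - τ₂⟩`, and its curvature spheres are
found explicitly (`span₁_eq`). Regularity says that certain covariant derivatives of `κ₁` and `κ₂`
never vanish, and separation of the two curvature spheres says that `κ₁ + κ₂ ≠ 0`. These conditions
identify the first osculating complex as `⟨ν₁⟩` and the first osculating bundle as `⟨σ₁, ν₁, τ₁⟩`. A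
span closed under `d` is locally constant, hence constant by connectedness.

For the geometric conclusion take any unit timelike `p` in the first bundle and any nonzero null `q`
in the second. Completing `p` to an orthonormal basis `n₁, n₂, p` of the first bundle gives two
orthogonal planes and hence the line. The projection of `ν₁` to `p^⊥` lies in `⟨n₁, n₂⟩` and is
constant along `T₁`: these are the planes. The vector `ν₂` is orthogonal to `n₁, n₂` and to `g` and
is constant along `T₂`: these are the spheres. The point sphere map is defined and immersed on a
dense set because each possible failure on an open set, differentiated, contradicts regularity or `q
≠ 0` (`exists_good`). -/

namespace LieSphere

/-! ### Derivatives of vector-valued maps along fields on a surface -/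

section Calculus

variable {M : Type*} [TopologicalSpace M] [ChartedSpace (EuclideanSpace ℝ (Fin 2)) M]
  {F : Type*} [NormedAddCommGroup F] [NormedSpace ℝ F]

/-- `φ` is smooth on `U`. -/
abbrev SmoothOn (φ : M → F) (U : Set M) : Prop := ContMDiffOn (𝓡 2) 𝓘(ℝ, F) ∞ φ U

/-- The vector field `X` is smooth on `U`. -/
abbrev SmoothFieldOn [IsManifold (𝓡 2) ∞ M] (X : (x : M) → TangentSpace (𝓡 2) x) (U : Set M) : Prop :=
  ContMDiffOn (𝓡 2) (𝓡 2).tangent ∞ (fun y => (⟨y, X y⟩ : TangentBundle (𝓡 2) M)) U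

/-- The derivative of `φ` at `x` in the direction `Z`. -/
noncomputable def vecDeriv (φ : M → F) (x : M) (Z : TangentSpace (𝓡 2) x) : F :=
  mfderiv (𝓡 2) 𝓘(ℝ, F) φ x Z

theorem dAlong_eq_vecDeriv [IsManifold (𝓡 2) ∞ M] (φ : M → R42) (x : M) (Z : TangentSpace (𝓡 2) x) :
    dAlong φ x Z = vecDeriv φ x Z := rfl

theorem SmoothOn.mdifferentiableAt {φ : M → F} {U : Set M} (h : SmoothOn φ U) (hU : IsOpen U)
    {x : M} (hx : x ∈ U) : MDifferentiableAt (𝓡 2) 𝓘(ℝ, F) φ x :=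
  (h.contMDiffAt (hU.mem_nhds hx)).mdifferentiableAt (by simp)

theorem vecDeriv_congr {φ ψ : M → F} {U : Set M} (hU : IsOpen U) {x : M} (hx : x ∈ U)
    (h : ∀ y ∈ U, φ y = ψ y) (Z : TangentSpace (𝓡 2) x) : vecDeriv φ x Z = vecDeriv ψ x Z := by
  have e : φ =ᶠ[𝓝 x] ψ := Filter.eventuallyEq_of_mem (hU.mem_nhds hx) h
  exact congrArg (fun L : TangentSpace (𝓡 2) x →L[ℝ] F => L Z) (e.mfderiv_eq (I := 𝓡 2) (I' := 𝓘(ℝ, F)))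

theorem vecDeriv_add_vec (φ : M → F) (x : M) (Z W : TangentSpace (𝓡 2) x) :
    vecDeriv φ x (Z + W) = vecDeriv φ x Z + vecDeriv φ x W :=
  map_add (mfderiv (𝓡 2) 𝓘(ℝ, F) φ x) Z W

theorem vecDeriv_smul_vec (φ : M → F) (x : M) (c : ℝ) (Z : TangentSpace (𝓡 2) x) :
    vecDeriv φ x (c • Z) = c • vecDeriv φ x Z :=
  map_smul (mfderiv (𝓡 2) 𝓘(ℝ, F) φ x) c Z

theorem vecDeriv_const (c : F) (x : M) (Z : TangentSpace (𝓡 2) x) :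
    vecDeriv (fun _ : M => c) x Z = 0 := by
  have := mvfderiv_const (I := 𝓡 2) (M := M) c (x := x)
  exact congrArg (fun L : TangentSpace (𝓡 2) x →L[ℝ] F => L Z) this

section At

variable {U : Set M} (hU : IsOpen U) {x : M} (hx : x ∈ U) (Z : TangentSpace (𝓡 2) x)
include hU hx

theorem vecDeriv_add {φ ψ : M → F} (hφ : SmoothOn φ U) (hψ : SmoothOn ψ U) :
    vecDeriv (fun y => φ y + ψ y) x Z = vecDeriv φ x Z + vecDeriv ψ x Z :=
  congrArg (fun L : TangentSpace (𝓡 2) x →L[ℝ] F => L Z)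
    (mvfderiv_add (hφ.mdifferentiableAt hU hx) (hψ.mdifferentiableAt hU hx))

theorem vecDeriv_sub {φ ψ : M → F} (hφ : SmoothOn φ U) (hψ : SmoothOn ψ U) :
    vecDeriv (fun y => φ y - ψ y) x Z = vecDeriv φ x Z - vecDeriv ψ x Z :=
  congrArg (fun L : TangentSpace (𝓡 2) x →L[ℝ] F => L Z)
    (mvfderiv_sub (hφ.mdifferentiableAt hU hx) (hψ.mdifferentiableAt hU hx))

theorem vecDeriv_smul {c : M → ℝ} {φ : M → F} (hc : SmoothOn c U) (hφ : SmoothOn φ U) :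
    vecDeriv (fun y => c y • φ y) x Z = vecDeriv c x Z • φ x + c x • vecDeriv φ x Z := by
  have := congrArg (fun L : TangentSpace (𝓡 2) x →L[ℝ] F => L Z)
    (mvfderiv_smul (hc.mdifferentiableAt hU hx) (hφ.mdifferentiableAt hU hx))
  rw [add_comm]
  exact this

theorem vecDeriv_mul {c d : M → ℝ} (hc : SmoothOn c U) (hd : SmoothOn d U) :
    vecDeriv (fun y => c y * d y) x Z = vecDeriv c x Z * d x + c x * vecDeriv d x Z :=
  vecDeriv_smul hU hx Z hc hd

end At

/-- The bilinear form as a continuous bilinear map. -/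
noncomputable def lieFormL : R42 →L[ℝ] R42 →L[ℝ] ℝ := LinearMap.toContinuousBilinearMap lieForm

theorem SmoothOn.lie {α β : M → R42} {U : Set M} (hα : SmoothOn α U) (hβ : SmoothOn β U) :
    SmoothOn (fun y => lieForm (α y) (β y)) U :=
  ((lieFormL.contMDiff (n := ∞)).comp_contMDiffOn hα).clm_apply hβ

theorem SmoothOn.add {φ ψ : M → F} {U : Set M} (hα : SmoothOn φ U) (hβ : SmoothOn ψ U) :
    SmoothOn (fun y => φ y + ψ y) U := ContMDiffOn.add hα hβ

theorem SmoothOn.sub {φ ψ : M → F} {U : Set M} (hα : SmoothOn φ U) (hβ : SmoothOn ψ U) :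
    SmoothOn (fun y => φ y - ψ y) U := ContMDiffOn.sub hα hβ

theorem SmoothOn.smul {c : M → ℝ} {ψ : M → F} {U : Set M} (hα : SmoothOn c U) (hβ : SmoothOn ψ U) :
    SmoothOn (fun y => c y • ψ y) U := ContMDiffOn.smul hα hβ

theorem SmoothOn.mul {c d : M → ℝ} {U : Set M} (hα : SmoothOn c U) (hβ : SmoothOn d U) :
    SmoothOn (fun y => c y * d y) U := ContMDiffOn.smul hα hβ

theorem SmoothOn.neg {φ : M → F} {U : Set M} (hα : SmoothOn φ U) :
    SmoothOn (fun y => - φ y) U := ContMDiffOn.neg hα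

theorem SmoothOn.inv {c : M → ℝ} {U : Set M} (hc : SmoothOn c U) (h : ∀ y ∈ U, c y ≠ 0) :
    SmoothOn (fun y => (c y)⁻¹) U := fun y hy =>
  (contDiffAt_inv ℝ (h y hy)).comp_contMDiffWithinAt (hc y hy)

theorem SmoothOn.sqrt {c : M → ℝ} {U : Set M} (hc : SmoothOn c U) (h : ∀ y ∈ U, c y ≠ 0) :
    SmoothOn (fun y => Real.sqrt (c y)) U := fun y hy =>
  (Real.contDiffAt_sqrt (h y hy)).comp_contMDiffWithinAt (hc y hy)

theorem SmoothOn.mono {φ : M → F} {U V : Set M} (hφ : SmoothOn φ U) (h : V ⊆ U) :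
    SmoothOn φ V := ContMDiffOn.mono hφ h

theorem smoothOn_const (c : F) (U : Set M) : SmoothOn (fun _ => c) U := contMDiffOn_const

theorem vecDeriv_lie {U : Set M} (hU : IsOpen U) {x : M} (hx : x ∈ U) (Z : TangentSpace (𝓡 2) x)
    {α β : M → R42} (hα : SmoothOn α U) (hβ : SmoothOn β U) :
    vecDeriv (fun y => lieForm (α y) (β y)) x Z
      = lieForm (vecDeriv α x Z) (β x) + lieForm (α x) (vecDeriv β x Z) := by
  have h1 : HasMFDerivAt (𝓡 2) 𝓘(ℝ, R42 × R42) (fun y => (α y, β y)) x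
      ((mfderiv (𝓡 2) 𝓘(ℝ, R42) α x).prod (mfderiv (𝓡 2) 𝓘(ℝ, R42) β x)) := by
    have := (hα.mdifferentiableAt hU hx).hasMFDerivAt.prodMk (hβ.mdifferentiableAt hU hx).hasMFDerivAt
    rw [modelWithCornersSelf_prod, ← chartedSpaceSelf_prod]
    exact this
  have h2 : HasFDerivAt (fun p : R42 × R42 => lieFormL p.1 p.2)
      (lieFormL.isBoundedBilinearMap.deriv (α x, β x)) (α x, β x) :=
    lieFormL.isBoundedBilinearMap.hasFDerivAt _
  have h3 := HasMFDerivAt.comp x (h2.hasMFDerivAt) h1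
  have h4 := congrArg (fun L : TangentSpace (𝓡 2) x →L[ℝ] ℝ => L Z) h3.mfderiv
  rw [add_comm]
  exact h4

theorem vecDeriv_lie_of_const {U : Set M} (hU : IsOpen U) {x : M} (hx : x ∈ U)
    {α β : M → R42} (hα : SmoothOn α U) (hβ : SmoothOn β U) {c : ℝ}
    (h : ∀ y ∈ U, lieForm (α y) (β y) = c) (Z : TangentSpace (𝓡 2) x) :
    lieForm (vecDeriv α x Z) (β x) + lieForm (α x) (vecDeriv β x Z) = 0 := by
  rw [← vecDeriv_lie hU hx Z hα hβ, vecDeriv_congr hU hx h, vecDeriv_const]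

variable [IsManifold (𝓡 2) ∞ M]

theorem SmoothOn.vecDeriv {φ : M → F} {U : Set M} (hφ : SmoothOn φ U) (hU : IsOpen U)
    {X : (x : M) → TangentSpace (𝓡 2) x} (hX : SmoothFieldOn X U) :
    SmoothOn (fun y => vecDeriv φ y (X y)) U := by
  have h1 : ContMDiffOn (𝓡 2).tangent 𝓘(ℝ, F).tangent ∞ (tangentMapWithin (𝓡 2) 𝓘(ℝ, F) φ U)
      (Bundle.TotalSpace.proj ⁻¹' U) :=
    hφ.contMDiffOn_tangentMapWithin (by simp) hU.uniqueMDiffOn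
  have h2 := h1.comp hX (fun y hy => hy)
  have h3 := (contMDiff_snd_tangentBundle_modelSpace F 𝓘(ℝ, F) (n := ∞)).comp_contMDiffOn h2
  refine h3.congr fun y hy => ?_
  simp only [Function.comp, tangentMapWithin, LieSphere.vecDeriv]
  rw [mfderivWithin_of_isOpen hU hy]

theorem exists_local_fields (x : M) : ∃ U : Set M, IsOpen U ∧ x ∈ U ∧
    ∃ A B : (y : M) → TangentSpace (𝓡 2) y, SmoothFieldOn A U ∧ SmoothFieldOn B U ∧
      ∀ y ∈ U, ∀ Z : TangentSpace (𝓡 2) y, ∃! c : ℝ × ℝ, Z = c.1 • A y + c.2 • B y := by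
  let e := trivializationAt (EuclideanSpace ℝ (Fin 2)) (TangentSpace (𝓡 2) : M → Type _) x
  let b := (EuclideanSpace.basisFun (Fin 2) ℝ).toBasis
  refine ⟨e.baseSet, e.open_baseSet, FiberBundle.mem_baseSet_trivializationAt' x,
    e.localFrame b 0, e.localFrame b 1, e.contMDiffOn_localFrame_baseSet ∞ b 0,
    e.contMDiffOn_localFrame_baseSet ∞ b 1, fun y hy Z => ?_⟩
  have r := (e.basisAt b hy).sum_repr Z
  rw [Fin.sum_univ_two] at r
  simp only [e.localFrame_apply_of_mem_baseSet b hy]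
  refine ⟨((e.basisAt b hy).repr Z 0, (e.basisAt b hy).repr Z 1), ?_, ?_⟩
  · exact r.symm
  · rintro ⟨c, d⟩ h
    simp only at h
    have h0 := congrArg (fun v => (e.basisAt b hy).repr v 0) h
    have h1 := congrArg (fun v => (e.basisAt b hy).repr v 1) h
    simp at h0 h1
    simp [h0, h1]

theorem vecDeriv_eq_fderiv_chart {φ : M → F} {U : Set M} (hU : IsOpen U) (hφ : SmoothOn φ U)
    (x : M) {y : M} (hy : y ∈ U) (hy' : y ∈ (extChartAt (𝓡 2) x).source)
    (Z : TangentSpace (𝓡 2) y) :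
    vecDeriv φ y Z = fderiv ℝ (φ ∘ (extChartAt (𝓡 2) x).symm) (extChartAt (𝓡 2) x y)
      (vecDeriv (extChartAt (𝓡 2) x) y Z) := by
  set e := extChartAt (𝓡 2) x
  have he : e.target ∈ 𝓝 (e y) := (isOpen_extChartAt_target x).mem_nhds (e.map_source hy')
  have h2 : MDifferentiableAt 𝓘(ℝ, EuclideanSpace ℝ (Fin 2)) (𝓡 2) e.symm (e y) :=
    ((contMDiffOn_extChartAt_symm (n := ∞) x).contMDiffAt he).mdifferentiableAt (by simp)
  have h1 : MDifferentiableAt (𝓡 2) 𝓘(ℝ, F) φ (e.symm (e y)) := by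
    rw [e.left_inv hy']; exact hφ.mdifferentiableAt hU hy
  have h3 : MDifferentiableAt 𝓘(ℝ, EuclideanSpace ℝ (Fin 2)) 𝓘(ℝ, F) (φ ∘ e.symm) (e y) :=
    h1.comp (e y) h2
  have h4 : MDifferentiableAt (𝓡 2) 𝓘(ℝ, EuclideanSpace ℝ (Fin 2)) e y :=
    mdifferentiableAt_extChartAt (by simpa [e] using hy')
  have h5 := mfderiv_comp y h3 h4
  rw [mfderiv_eq_fderiv] at h5
  have h6 : (φ ∘ e.symm) ∘ e =ᶠ[𝓝 y] φ := by
    filter_upwards [(isOpen_extChartAt_source x).mem_nhds hy'] with z hz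
    simp [Function.comp, e.left_inv hz]
  rw [h6.mfderiv_eq] at h5
  exact congrArg (fun L : TangentSpace (𝓡 2) y →L[ℝ] F => L Z) h5

theorem contDiffOn_comp_chart_symm (x : M) {φ : M → F} {U : Set M} (hφ : SmoothOn φ U) :
    ContDiffOn ℝ ∞ (φ ∘ (extChartAt (𝓡 2) x).symm)
      ((extChartAt (𝓡 2) x).target ∩ (extChartAt (𝓡 2) x).symm ⁻¹' U) := by
  have h := ContMDiffOn.comp hφ ((contMDiffOn_extChartAt_symm (n := ∞) (I := 𝓡 2) x).mono
      Set.inter_subset_left : ContMDiffOn _ _ _ (extChartAt (𝓡 2) x).symm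
        ((extChartAt (𝓡 2) x).target ∩ (extChartAt (𝓡 2) x).symm ⁻¹' U)) (fun z hz => hz.2)
  exact contMDiffOn_iff_contDiffOn.1 h

/-- In a chart, a second derivative along two fields is a Hessian term plus a first-order term. The
Hessian terms cancel by symmetry. What remains is the derivative along one vector, the Lie bracket
at `x`, which does not depend on `φ`. Only its existence is needed later. -/
theorem exists_commutator {U : Set M} (hU : IsOpen U) {x : M} (hx : x ∈ U)
    {X Y : (x : M) → TangentSpace (𝓡 2) x} (hX : SmoothFieldOn X U) (hY : SmoothFieldOn Y U) :
    ∃ Z : TangentSpace (𝓡 2) x, ∀ φ : M → F, SmoothOn φ U →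
      vecDeriv (fun y => vecDeriv φ y (Y y)) x (X x) - vecDeriv (fun y => vecDeriv φ y (X y)) x (Y x)
        = vecDeriv φ x Z := by
  set e := extChartAt (𝓡 2) x with he
  have hxs : x ∈ e.source := mem_extChartAt_source x
  have hso : IsOpen e.source := isOpen_extChartAt_source x
  have hsm : SmoothOn e e.source := by
    have := contMDiffOn_extChartAt (n := ∞) (I := 𝓡 2) (x := x)
    rw [← extChartAt_source (𝓡 2)] at this
    exact this
  have hU' : IsOpen (U ∩ e.source) := hU.inter hso
  set V := e.target ∩ e.symm ⁻¹' (U ∩ e.source)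
  have hVo : IsOpen V :=
    (continuousOn_extChartAt_symm x).isOpen_inter_preimage (isOpen_extChartAt_target x) hU'
  have hxV : e x ∈ V := ⟨e.map_source hxs, by simp [e.left_inv hxs, hx, hxs]⟩
  have key : ∀ {G : Type} [NormedAddCommGroup G] [NormedSpace ℝ G] (φ : M → G),
      SmoothOn φ (U ∩ e.source) → ContDiffOn ℝ ∞ (φ ∘ e.symm) V :=
    fun φ hφ => contDiffOn_comp_chart_symm x hφ
  have field : ∀ W : (x : M) → TangentSpace (𝓡 2) x, SmoothFieldOn W U →
      SmoothOn (fun y => vecDeriv e y (W y)) (U ∩ e.source) := fun W hW =>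
    (SmoothOn.mono hsm Set.inter_subset_right).vecDeriv hU' (ContMDiffOn.mono hW Set.inter_subset_left)
  have second : ∀ W W' : (x : M) → TangentSpace (𝓡 2) x, SmoothFieldOn W U →
      SmoothFieldOn W' U → ∀ φ : M → F, SmoothOn φ U →
      vecDeriv (fun y => vecDeriv φ y (W y)) x (W' x) =
        fderiv ℝ (fderiv ℝ (φ ∘ e.symm)) (e x) (vecDeriv e x (W' x)) (vecDeriv e x (W x)) +
        fderiv ℝ (φ ∘ e.symm) (e x)
          (fderiv ℝ ((fun y => vecDeriv e y (W y)) ∘ e.symm) (e x) (vecDeriv e x (W' x))) := by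
    intro W W' hW hW' φ hφ
    have hφ' : SmoothOn φ (U ∩ e.source) := hφ.mono Set.inter_subset_left
    have hd := hφ'.vecDeriv hU' (ContMDiffOn.mono hW Set.inter_subset_left : SmoothFieldOn W (U ∩ e.source))
    rw [vecDeriv_eq_fderiv_chart hU' hd x ⟨hx, hxs⟩ hxs]
    have heq : ((fun y => vecDeriv φ y (W y)) ∘ e.symm) =ᶠ[𝓝 (e x)]
        fun z => fderiv ℝ (φ ∘ e.symm) z (((fun y => vecDeriv e y (W y)) ∘ e.symm) z) := by
      filter_upwards [hVo.mem_nhds hxV] with z hz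
      have h := vecDeriv_eq_fderiv_chart hU hφ x hz.2.1 hz.2.2 (W (e.symm z))
      simp only [Function.comp]
      rw [h, ← he, e.right_inv hz.1]
    rw [heq.fderiv_eq]
    have c1 : ContDiffAt ℝ ∞ (φ ∘ e.symm) (e x) := (contDiffOn_comp_chart_symm x hφ').contDiffAt (hVo.mem_nhds hxV)
    have c2 : DifferentiableAt ℝ (fderiv ℝ (φ ∘ e.symm)) (e x) :=
      (c1.fderiv_right (m := 1) (by norm_cast)).differentiableAt (by simp)
    have c3 : DifferentiableAt ℝ ((fun y => vecDeriv e y (W y)) ∘ e.symm) (e x) :=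
      ((key _ (field W hW)).contDiffAt (hVo.mem_nhds hxV)).differentiableAt (by simp)
    rw [fderiv_clm_apply c2 c3]
    rw [add_apply, ContinuousLinearMap.comp_apply,
      ContinuousLinearMap.flip_apply, Function.comp_apply, e.left_inv hxs, add_comm]
  obtain ⟨Z, hZ⟩ : ∃ Z : TangentSpace (𝓡 2) x, vecDeriv e x Z =
      fderiv ℝ ((fun y => vecDeriv e y (Y y)) ∘ e.symm) (e x) (vecDeriv e x (X x)) -
      fderiv ℝ ((fun y => vecDeriv e y (X y)) ∘ e.symm) (e x) (vecDeriv e x (Y x)) :=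
    (isInvertible_mfderiv_extChartAt hxs).bijective.surjective _
  refine ⟨Z, fun φ hφ => ?_⟩
  have hφ' : SmoothOn φ (U ∩ e.source) := hφ.mono Set.inter_subset_left
  have c1 : ContDiffAt ℝ ∞ (φ ∘ e.symm) (e x) := (contDiffOn_comp_chart_symm x hφ').contDiffAt (hVo.mem_nhds hxV)
  have sym := c1.isSymmSndFDerivAt (by simpa [minSmoothness] using (by norm_cast : (2 : WithTop ℕ∞) ≤ ∞))
  rw [second Y X hY hX φ hφ, second X Y hX hY φ hφ, sym.eq (vecDeriv e x (X x)),
    vecDeriv_eq_fderiv_chart hU hφ x hx hxs Z, ← he, hZ, map_sub]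
  abel

end Calculus

/-! ### Linear algebra in signature `(4,2)` -/

theorem lieForm_apply (v w : R42) : lieForm v w =
    v 0 * w 0 + v 1 * w 1 + v 2 * w 2 + v 3 * w 3 - v 4 * w 4 - v 5 * w 5 := by
  simp [lieForm, Matrix.toBilin'_apply', Matrix.mulVec_diagonal, dotProduct, Fin.sum_univ_six]
  ring

theorem lieForm_comm (v w : R42) : lieForm v w = lieForm w v := by
  simp only [lieForm_apply]; ring

/-- In signature `(4,2)`, a vector of nonpositive square orthogonal to a null plane lies in it. -/
theorem mem_of_orthogonal_of_nonpos {P : Submodule ℝ R42} (hP : Module.finrank ℝ P = 2)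
    (hn : ∀ v ∈ P, ∀ w ∈ P, lieForm v w = 0) {v : R42} (hv : ∀ w ∈ P, lieForm v w = 0)
    (hvv : lieForm v v ≤ 0) : v ∈ P := by
  by_contra hvP
  let Q : Submodule ℝ R42 := P ⊔ Submodule.span ℝ {v}
  have hlt : P < Q := lt_of_le_of_ne le_sup_left fun h => hvP
    (h ▸ (le_sup_right : _ ≤ Q) (Submodule.mem_span_singleton_self v))
  have hQ : 2 < Module.finrank ℝ Q := hP ▸ Submodule.finrank_lt_finrank_of_lt hlt
  -- The two timelike coordinates vanish simultaneously on some nonzero vector of the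
  -- three-dimensional `Q`. That vector has square at most `0` but only spacelike coordinates, so it
  -- is zero after all.
  let L : Q →ₗ[ℝ] ℝ × ℝ :=
    ((LinearMap.proj 4).prod (LinearMap.proj 5) : R42 →ₗ[ℝ] ℝ × ℝ).comp Q.subtype
  obtain ⟨⟨w, hw⟩, hwL, hw0⟩ := (Submodule.ne_bot_iff _).1
    (L.ker_ne_bot_of_finrank_lt (by simpa using hQ))
  obtain ⟨h4, h5⟩ : w 4 = 0 ∧ w 5 = 0 := by simpa [L] using hwL
  obtain ⟨p, hp, u, hu, rfl⟩ := Submodule.mem_sup.1 hw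
  obtain ⟨c, rfl⟩ := Submodule.mem_span_singleton.1 hu
  have hsq : lieForm (p + c • v) (p + c • v) = c ^ 2 * lieForm v v := by
    simp only [map_add, map_smul, LinearMap.add_apply, LinearMap.smul_apply, smul_eq_mul,
      hn p hp p hp, hv p hp, lieForm_comm p v]
    ring
  have hle : lieForm (p + c • v) (p + c • v) ≤ 0 := by
    rw [hsq]; exact mul_nonpos_of_nonneg_of_nonpos (sq_nonneg c) hvv
  generalize p + c • v = z at *
  rw [lieForm_apply, h4, h5] at hle
  apply hw0
  have e0 : z 0 = 0 := by nlinarith [sq_nonneg (z 0), sq_nonneg (z 1), sq_nonneg (z 2), sq_nonneg (z 3)]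
  have e1 : z 1 = 0 := by nlinarith [sq_nonneg (z 0), sq_nonneg (z 1), sq_nonneg (z 2), sq_nonneg (z 3)]
  have e2 : z 2 = 0 := by nlinarith [sq_nonneg (z 0), sq_nonneg (z 1), sq_nonneg (z 2), sq_nonneg (z 3)]
  have e3 : z 3 = 0 := by nlinarith [sq_nonneg (z 0), sq_nonneg (z 1), sq_nonneg (z 2), sq_nonneg (z 3)]
  ext i
  fin_cases i <;> simp [*]

theorem lieForm_pos_of_notMem {P : Submodule ℝ R42} (hP : Module.finrank ℝ P = 2)
    (hn : ∀ v ∈ P, ∀ w ∈ P, lieForm v w = 0) {v : R42} (hv : ∀ w ∈ P, lieForm v w = 0)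
    (h : v ∉ P) : 0 < lieForm v v := by
  by_contra h'
  exact h (mem_of_orthogonal_of_nonpos hP hn hv (not_lt.1 h'))

/-- The Euclidean scalar product of `ℝ⁶`. -/
noncomputable def dotL : R42 →L[ℝ] R42 →L[ℝ] ℝ :=
  LinearMap.toContinuousBilinearMap (Matrix.toBilin' (1 : Matrix (Fin 6) (Fin 6) ℝ))

theorem dotL_apply (v w : R42) : dotL v w = v ⬝ᵥ w := by
  simp [dotL, Matrix.toBilin'_apply']

theorem dotL_comm (v w : R42) : dotL v w = dotL w v := by
  simp only [dotL_apply, dotProduct_comm]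

theorem dotL_self_pos {v : R42} (h : v ≠ 0) : 0 < dotL v v := by
  rw [dotL_apply]
  exact lt_of_le_of_ne (by simpa [dotProduct] using Finset.sum_nonneg fun i _ => mul_self_nonneg (v i))
    (fun h' => h (dotProduct_self_eq_zero.1 h'.symm))

/-- `v` and `w` are linearly independent. -/
def Indep {V : Type*} [AddCommGroup V] [Module ℝ V] (v w : V) : Prop :=
  ∀ c d : ℝ, c • v + d • w = 0 → c = 0 ∧ d = 0

theorem Indep.symm {V : Type*} [AddCommGroup V] [Module ℝ V] {v w : V} (h : Indep v w) :
    Indep w v := fun c d hcd => (h d c (by rw [add_comm]; exact hcd)).symm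

theorem Indep.linearIndependent {V : Type*} [AddCommGroup V] [Module ℝ V] {v w : V} (h : Indep v w) :
    LinearIndependent ℝ ![v, w] := LinearIndependent.pair_iff.2 h

theorem Indep.left_ne_zero {V : Type*} [AddCommGroup V] [Module ℝ V] {v w : V} (h : Indep v w) :
    v ≠ 0 := fun h0 => one_ne_zero (h 1 0 (by simp [h0])).1

theorem Indep.finrank_span {V : Type*} [AddCommGroup V] [Module ℝ V] {v w : V} (h : Indep v w) :
    Module.finrank ℝ (Submodule.span ℝ {v, w}) = 2 := by
  have := finrank_span_eq_card h.linearIndependent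
  have e : Set.range ![v, w] = {v, w} := by
    ext z; simp [eq_comm, or_comm]
  rwa [e] at this

theorem Indep.eq_span {V : Type*} [AddCommGroup V] [Module ℝ V] {v w : V} (h : Indep v w)
    {P : Submodule ℝ V} (hP : Module.finrank ℝ P = 2) (hv : v ∈ P) (hw : w ∈ P) :
    P = Submodule.span ℝ {v, w} := by
  have : FiniteDimensional ℝ P := Module.finite_of_finrank_pos (by omega)
  refine (Submodule.eq_of_le_of_finrank_eq ?_ (by rw [hP, h.finrank_span])).symm
  rw [Submodule.span_le]
  rintro z (rfl | rfl) <;> assumption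

theorem Indep.exists_eq {V : Type*} [AddCommGroup V] [Module ℝ V] {v w : V} (h : Indep v w)
    (hV : Module.finrank ℝ V = 2) (z : V) : ∃ a b : ℝ, z = a • v + b • w := by
  have := h.eq_span (P := ⊤) (by simpa using hV) trivial trivial
  have hz : z ∈ (⊤ : Submodule ℝ V) := trivial
  rw [this] at hz
  obtain ⟨a, b, hab⟩ := Submodule.mem_span_pair.1 hz
  exact ⟨a, b, hab.symm⟩

theorem dotL_gram_pos {v w : R42} (h : Indep v w) :
    0 < dotL v v * dotL w w - dotL v w * dotL v w := by
  have hv := dotL_self_pos h.left_ne_zero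
  have hz : dotL v v • w - dotL v w • v ≠ 0 := by
    intro h0
    have := (h (-dotL v w) (dotL v v) (by rw [← h0]; module)).2
    exact hv.ne' this
  have := dotL_self_pos hz
  simp only [map_sub, map_smul, sub_apply, smul_apply, smul_eq_mul,
    dotL_comm w v] at this
  have h2 : 0 < dotL v v * (dotL v v * dotL w w - dotL v w * dotL v w) := by nlinarith
  exact pos_of_mul_pos_right h2 hv.le

/-! ### Smooth coefficients and local frames of line bundles and Legendre maps -/

section Bundles

variable {M : Type*} [TopologicalSpace M] [ChartedSpace (EuclideanSpace ℝ (Fin 2)) M]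

theorem SmoothOn.dot {α β : M → R42} {U : Set M} (hα : SmoothOn α U) (hβ : SmoothOn β U) :
    SmoothOn (fun y => dotL (α y) (β y)) U :=
  ((dotL.contMDiff (n := ∞)).comp_contMDiffOn hα).clm_apply hβ

/-- The coefficient is read off with the Euclidean product, since `lieForm` vanishes on the null
bundles to which this is applied. -/
theorem exists_smooth_coeff {σ τ : M → R42} {U : Set M} (hσ : SmoothOn σ U) (hτ : SmoothOn τ U)
    (h0 : ∀ y ∈ U, σ y ≠ 0) (h : ∀ y ∈ U, τ y ∈ Submodule.span ℝ {σ y}) :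
    ∃ c : M → ℝ, SmoothOn c U ∧ ∀ y ∈ U, τ y = c y • σ y := by
  refine ⟨fun y => dotL (τ y) (σ y) * (dotL (σ y) (σ y))⁻¹,
    (hτ.dot hσ).mul ((hσ.dot hσ).inv fun y hy => (dotL_self_pos (h0 y hy)).ne'), fun y hy => ?_⟩
  obtain ⟨c, hc⟩ := Submodule.mem_span_singleton.1 (h y hy)
  have := (dotL_self_pos (h0 y hy)).ne'
  simp only [← hc, map_smul, smul_apply, smul_eq_mul]
  rw [mul_assoc, mul_inv_cancel₀ this, mul_one]

/-- Cramer's rule for the Euclidean Gram matrix, whose determinant is positive on independent pairs.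
-/
theorem exists_smooth_coeff₂ {e₁ e₂ τ : M → R42} {U : Set M} (h₁ : SmoothOn e₁ U)
    (h₂ : SmoothOn e₂ U) (hτ : SmoothOn τ U) (h0 : ∀ y ∈ U, Indep (e₁ y) (e₂ y))
    (h : ∀ y ∈ U, τ y ∈ Submodule.span ℝ {e₁ y, e₂ y}) :
    ∃ c d : M → ℝ, SmoothOn c U ∧ SmoothOn d U ∧ ∀ y ∈ U, τ y = c y • e₁ y + d y • e₂ y := by
  have hG : SmoothOn (fun y => (dotL (e₁ y) (e₁ y) * dotL (e₂ y) (e₂ y)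
      - dotL (e₁ y) (e₂ y) * dotL (e₁ y) (e₂ y))⁻¹) U :=
    (((h₁.dot h₁).mul (h₂.dot h₂)).sub ((h₁.dot h₂).mul (h₁.dot h₂))).inv
      fun y hy => (dotL_gram_pos (h0 y hy)).ne'
  refine ⟨_, _, (((hτ.dot h₁).mul (h₂.dot h₂)).sub ((hτ.dot h₂).mul (h₁.dot h₂))).mul hG,
    (((hτ.dot h₂).mul (h₁.dot h₁)).sub ((hτ.dot h₁).mul (h₁.dot h₂))).mul hG, fun y hy => ?_⟩
  obtain ⟨c, d, hcd⟩ := Submodule.mem_span_pair.1 (h y hy)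
  have hp := (dotL_gram_pos (h0 y hy)).ne'
  simp only [← hcd, map_add, map_smul, add_apply, smul_apply, smul_eq_mul,
    dotL_comm (e₂ y) (e₁ y)]
  congr 2
  · rw [eq_mul_inv_iff_mul_eq₀ hp]; ring
  · rw [eq_mul_inv_iff_mul_eq₀ hp]; ring

variable [IsManifold (𝓡 2) ∞ M]

theorem IsSubbundle.exists_section {E : M → Submodule ℝ R42} (hE : IsSubbundle 1 E) (x : M) :
    ∃ U : Set M, IsOpen U ∧ x ∈ U ∧ ∃ σ : M → R42, SmoothOn σ U ∧
      ∀ y ∈ U, σ y ≠ 0 ∧ E y = Submodule.span ℝ {σ y} := by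
  obtain ⟨U, hU, hx, e, he, h⟩ := hE x
  refine ⟨U, hU, hx, e 0, he 0, fun y hy => ⟨(h y hy).1.ne_zero 0, ?_⟩⟩
  rw [← (h y hy).2]
  congr 1
  ext v
  simp [eq_comm]

theorem IsSubbundle.finrank_eq {k : ℕ} {E : M → Submodule ℝ R42} (hE : IsSubbundle k E) (x : M) :
    Module.finrank ℝ (E x) = k := by
  obtain ⟨U, hU, hx, e, he, h⟩ := hE x
  rw [← (h x hx).2, finrank_span_eq_card (h x hx).1, Fintype.card_fin]

theorem isSubbundle_one_of_local {E : M → Submodule ℝ R42}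
    (h : ∀ x, ∃ U : Set M, IsOpen U ∧ x ∈ U ∧ ∃ σ : M → R42, SmoothOn σ U ∧
      ∀ y ∈ U, σ y ≠ 0 ∧ E y = Submodule.span ℝ {σ y}) : IsSubbundle 1 E := by
  intro x
  obtain ⟨U, hU, hx, σ, hσ, h⟩ := h x
  refine ⟨U, hU, hx, fun _ => σ, fun _ => hσ, fun y hy => ⟨?_, ?_⟩⟩
  · exact LinearIndependent.of_subsingleton 0 (h y hy).1
  · rw [(h y hy).2, Set.range_const]

/-- The derivative along `Z` of every section of a line bundle lies in it if this holds for one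
frame. -/
theorem dAlong_mem_of_frame {E : M → Submodule ℝ R42} {σ : M → R42} {U : Set M} (hU : IsOpen U)
    {x : M} (hx : x ∈ U) (hσ : SmoothOn σ U) (h : ∀ y ∈ U, σ y ≠ 0 ∧ E y = Submodule.span ℝ {σ y})
    {Z : TangentSpace (𝓡 2) x} (hZ : vecDeriv σ x Z ∈ E x) {V : Set M} {τ : M → R42}
    (hτ : IsSectionNear E x V τ) : dAlong τ x Z ∈ E x := by
  have hO := hU.inter hτ.isOpen
  obtain ⟨c, hc, hcτ⟩ := exists_smooth_coeff (hσ.mono Set.inter_subset_left)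
    (SmoothOn.mono hτ.smooth (Set.inter_subset_right (s := U))) (fun y hy => (h y hy.1).1)
    (fun y hy => (h y hy.1).2 ▸ hτ.mem_fiber y hy.2)
  have hx' : x ∈ U ∩ V := ⟨hx, hτ.mem⟩
  rw [dAlong_eq_vecDeriv, vecDeriv_congr hO hx' hcτ,
    vecDeriv_smul hO hx' Z hc (hσ.mono Set.inter_subset_left)]
  have hσx : σ x ∈ E x := (h x hx).2 ▸ Submodule.mem_span_singleton_self _
  exact (E x).add_mem ((E x).smul_mem _ hσx) ((E x).smul_mem _ hZ)

/-- A local frame of an umbilic-free Legendre map by sections of its curvature sphere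
congruences. -/
structure IsSphereFrame (f s₁ s₂ : M → Submodule ℝ R42) (U : Set M) (σ₁ σ₂ : M → R42) : Prop where
  isOpen : IsOpen U
  smooth₁ : SmoothOn σ₁ U
  smooth₂ : SmoothOn σ₂ U
  indep : ∀ y ∈ U, Indep (σ₁ y) (σ₂ y)
  span₁ : ∀ y ∈ U, s₁ y = Submodule.span ℝ {σ₁ y}
  span₂ : ∀ y ∈ U, s₂ y = Submodule.span ℝ {σ₂ y}
  span : ∀ y ∈ U, f y = Submodule.span ℝ {σ₁ y, σ₂ y}

theorem IsSphereFrame.symm {f s₁ s₂ : M → Submodule ℝ R42} {U : Set M} {σ₁ σ₂ : M → R42}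
    (h : IsSphereFrame f s₁ s₂ U σ₁ σ₂) : IsSphereFrame f s₂ s₁ U σ₂ σ₁ :=
  ⟨h.isOpen, h.smooth₂, h.smooth₁, fun y hy => (h.indep y hy).symm, h.span₂, h.span₁,
    fun y hy => by rw [h.span y hy, Set.pair_comm]⟩

theorem IsSphereFrame.mono {f s₁ s₂ : M → Submodule ℝ R42} {U V : Set M} {σ₁ σ₂ : M → R42}
    (h : IsSphereFrame f s₁ s₂ U σ₁ σ₂) (hV : IsOpen V) (hVU : V ⊆ U) :
    IsSphereFrame f s₁ s₂ V σ₁ σ₂ :=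
  ⟨hV, h.smooth₁.mono hVU, h.smooth₂.mono hVU, fun y hy => h.indep y (hVU hy),
    fun y hy => h.span₁ y (hVU hy), fun y hy => h.span₂ y (hVU hy), fun y hy => h.span y (hVU hy)⟩

theorem IsUmbilicFree.symm {f s₁ s₂ : M → Submodule ℝ R42} (h : IsUmbilicFree f s₁ s₂) :
    IsUmbilicFree f s₂ s₁ :=
  ⟨h.legendre, h.subbundle₂, h.subbundle₁, h.curvature₂, h.curvature₁, fun x => (h.disjoint x).symm⟩

theorem IsUmbilicFree.exists_frame {f s₁ s₂ : M → Submodule ℝ R42} (h : IsUmbilicFree f s₁ s₂)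
    (x : M) : ∃ U σ₁ σ₂, x ∈ U ∧ IsSphereFrame f s₁ s₂ U σ₁ σ₂ := by
  obtain ⟨U, hU, hx, σ₁, h₁, e₁⟩ := h.subbundle₁.exists_section x
  obtain ⟨V, hV, hx', σ₂, h₂, e₂⟩ := h.subbundle₂.exists_section x
  have ind : ∀ y ∈ U ∩ V, Indep (σ₁ y) (σ₂ y) := by
    intro y hy c d hcd
    have hm : c • σ₁ y ∈ s₁ y := by
      rw [(e₁ y hy.1).2]; exact Submodule.smul_mem _ _ (Submodule.mem_span_singleton_self _)
    have hm' : c • σ₁ y ∈ s₂ y := by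
      rw [eq_neg_of_add_eq_zero_left hcd, (e₂ y hy.2).2]
      exact Submodule.neg_mem _ (Submodule.smul_mem _ _ (Submodule.mem_span_singleton_self _))
    have hz := Submodule.disjoint_def.1 (h.disjoint y) _ hm hm'
    have hc : c = 0 := (smul_eq_zero.1 hz).resolve_right (e₁ y hy.1).1
    refine ⟨hc, ?_⟩
    rw [hc, zero_smul, zero_add] at hcd
    exact (smul_eq_zero.1 hcd).resolve_right (e₂ y hy.2).1
  refine ⟨U ∩ V, σ₁, σ₂, ⟨hx, hx'⟩, hU.inter hV, h₁.mono Set.inter_subset_left,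
    h₂.mono Set.inter_subset_right, ind, fun y hy => (e₁ y hy.1).2, fun y hy => (e₂ y hy.2).2,
    fun y hy => (ind y hy).eq_span (h.legendre.subbundle.finrank_eq y) ?_ ?_⟩
  · exact (h.curvature₁ y).1 ((e₁ y hy.1).2 ▸ Submodule.mem_span_singleton_self _)
  · exact (h.curvature₂ y).1 ((e₂ y hy.2).2 ▸ Submodule.mem_span_singleton_self _)

end Bundles

/-! ### Curvature directions and smooth frame fields -/

section Fields

variable {M : Type*} [TopologicalSpace M] [ChartedSpace (EuclideanSpace ℝ (Fin 2)) M]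
  [IsManifold (𝓡 2) ∞ M] {f s₁ s₂ : M → Submodule ℝ R42} {U : Set M} {σ₁ σ₂ : M → R42}

theorem lieForm_zero_of_span {v w z : R42} {P : Submodule ℝ R42} (hP : P = Submodule.span ℝ {v, w})
    (hv : lieForm z v = 0) (hw : lieForm z w = 0) : ∀ u ∈ P, lieForm z u = 0 := by
  intro u hu
  obtain ⟨a, b, rfl⟩ := Submodule.mem_span_pair.1 (hP ▸ hu)
  simp [hv, hw]

namespace IsSphereFrame

variable (e : IsSphereFrame f s₁ s₂ U σ₁ σ₂)
include e

theorem mem₁ {y : M} (hy : y ∈ U) : σ₁ y ∈ f y := by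
  rw [e.span y hy]; exact Submodule.subset_span (by simp)

theorem mem₂ {y : M} (hy : y ∈ U) : σ₂ y ∈ f y := e.symm.mem₁ hy

theorem section₁ {y : M} (hy : y ∈ U) : IsSectionNear f y U σ₁ :=
  ⟨e.isOpen, hy, e.smooth₁, fun _ hz => e.mem₁ hz⟩

theorem contact₁ (h : IsLegendre f) {y : M} (hy : y ∈ U) (Z : TangentSpace (𝓡 2) y) :
    ∀ w ∈ f y, lieForm (vecDeriv σ₁ y Z) w = 0 :=
  h.contact y U σ₁ (e.section₁ hy) Z

theorem exists_coeff {V : Set M} (hV : IsOpen V) {τ : M → R42} (hτ : SmoothOn τ V)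
    (h : ∀ y ∈ V, τ y ∈ f y) : ∃ c d : M → ℝ, SmoothOn c (U ∩ V) ∧ SmoothOn d (U ∩ V) ∧
      (∀ y ∈ U ∩ V, τ y = c y • σ₁ y + d y • σ₂ y) ∧
      ∀ y ∈ U ∩ V, ∀ Z : TangentSpace (𝓡 2) y, vecDeriv τ y Z =
        vecDeriv c y Z • σ₁ y + c y • vecDeriv σ₁ y Z +
        (vecDeriv d y Z • σ₂ y + d y • vecDeriv σ₂ y Z) := by
  have hO := e.isOpen.inter hV
  have h1 := e.smooth₁.mono (Set.inter_subset_left (t := V))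
  have h2 := e.smooth₂.mono (Set.inter_subset_left (t := V))
  obtain ⟨c, d, hc, hd, hcd⟩ := exists_smooth_coeff₂ h1 h2 (hτ.mono (Set.inter_subset_right (s := U)))
    (fun y hy => e.indep y hy.1) (fun y hy => e.span y hy.1 ▸ h y hy.2)
  refine ⟨c, d, hc, hd, hcd, fun y hy Z => ?_⟩
  rw [vecDeriv_congr hO hy hcd, vecDeriv_add hO hy Z (hc.smul h1) (hd.smul h2),
    vecDeriv_smul hO hy Z hc h1, vecDeriv_smul hO hy Z hd h2]

/-- A section of `f` lying in `s₁` at `y` is `c σ₁ + d σ₂` with `d y = 0`. Modulo `f` its derivative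
is then `c y` times that of `σ₁`, so testing one section suffices. -/
theorem mem_curvatureDist_iff {y : M} (hy : y ∈ U) (Z : TangentSpace (𝓡 2) y) :
    Z ∈ curvatureDist f s₁ y ↔ vecDeriv σ₁ y Z ∈ f y := by
  constructor
  · intro h
    exact h U σ₁ (e.section₁ hy) (e.span₁ y hy ▸ Submodule.mem_span_singleton_self _)
  · intro h V τ hτ hτs
    obtain ⟨c, d, hc, hd, hcd, hD⟩ := e.exists_coeff hτ.isOpen hτ.smooth hτ.mem_fiber
    have hyV : y ∈ U ∩ V := ⟨hy, hτ.mem⟩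
    rw [dAlong_eq_vecDeriv, hD y hyV]
    have hd0 : d y = 0 := by
      rw [e.span₁ y hy, hcd y hyV] at hτs
      obtain ⟨a, ha⟩ := Submodule.mem_span_singleton.1 hτs
      refine (e.indep y hy (c y - a) (d y) ?_).2
      rw [sub_smul, ha]; abel
    rw [hd0, zero_smul, add_zero]
    exact (f y).add_mem ((f y).add_mem ((f y).smul_mem _ (e.mem₁ hy)) ((f y).smul_mem _ h))
      ((f y).smul_mem _ (e.mem₂ hy))

theorem eq_zero_of_mem (h : IsLegendre f) {y : M} (hy : y ∈ U) {Z : TangentSpace (𝓡 2) y}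
    (h₁ : Z ∈ curvatureDist f s₁ y) (h₂ : Z ∈ curvatureDist f s₂ y) : Z = 0 := by
  refine h.immerses y Z fun V τ hτ => ?_
  obtain ⟨c, d, hc, hd, hcd, hD⟩ := e.exists_coeff hτ.isOpen hτ.smooth hτ.mem_fiber
  rw [dAlong_eq_vecDeriv, hD y ⟨hy, hτ.mem⟩]
  exact (f y).add_mem
    ((f y).add_mem ((f y).smul_mem _ (e.mem₁ hy)) ((f y).smul_mem _ ((e.mem_curvatureDist_iff hy Z).1 h₁)))
    ((f y).add_mem ((f y).smul_mem _ (e.mem₂ hy))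
      ((f y).smul_mem _ ((e.symm.mem_curvatureDist_iff hy Z).1 h₂)))

/-- The derivatives `w₁, w₂` of `σ₁` along `A, B` lie in `f^⊥`, where the form is positive
semidefinite with null vectors exactly `f`. A curvature direction is thus a kernel vector of the
Gram matrix of `w₁, w₂`. This matrix is degenerate because the curvature space is nonzero, and where
`(w₂, w₂) ≠ 0` the combination `(w₂, w₂) A - (w₁, w₂) B` is a smooth nonzero kernel vector. -/
theorem exists_field_aux (h : IsUmbilicFree f s₁ s₂) {A B : (y : M) → TangentSpace (𝓡 2) y}
    (hA : SmoothFieldOn A U) (hB : SmoothFieldOn B U)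
    (hAB : ∀ y ∈ U, ∀ Z : TangentSpace (𝓡 2) y, ∃! c : ℝ × ℝ, Z = c.1 • A y + c.2 • B y)
    {x : M} (hx : x ∈ U) (hBx : B x ∉ curvatureDist f s₁ x) :
    ∃ V ⊆ U, IsOpen V ∧ x ∈ V ∧ ∃ X : (y : M) → TangentSpace (𝓡 2) y, SmoothFieldOn X V ∧
      ∀ y ∈ V, X y ≠ 0 ∧ X y ∈ curvatureDist f s₁ y := by
  have hP := h.legendre.subbundle.finrank_eq
  have hn := h.legendre.null
  set w₁ := fun y => vecDeriv σ₁ y (A y) with hw₁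
  set w₂ := fun y => vecDeriv σ₁ y (B y) with hw₂
  have s₁' : SmoothOn w₁ U := e.smooth₁.vecDeriv e.isOpen hA
  have s₂' : SmoothOn w₂ U := e.smooth₁.vecDeriv e.isOpen hB
  have hcont : ContinuousOn (fun y => lieForm (w₂ y) (w₂ y)) U := (s₂'.lie s₂').continuousOn
  have hpos : lieForm (w₂ x) (w₂ x) ≠ 0 := by
    refine (lieForm_pos_of_notMem (hP x) (hn x) (e.contact₁ h.legendre hx (B x)) ?_).ne'
    exact fun h' => hBx ((e.mem_curvatureDist_iff hx _).2 h')
  refine ⟨U ∩ (fun y => lieForm (w₂ y) (w₂ y)) ⁻¹' {0}ᶜ, Set.inter_subset_left,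
    hcont.isOpen_inter_preimage e.isOpen isOpen_compl_singleton, ⟨hx, hpos⟩,
    fun y => lieForm (w₂ y) (w₂ y) • A y + (-lieForm (w₁ y) (w₂ y)) • B y, ?_, ?_⟩
  · exact ContMDiffOn.mono (((s₂'.lie s₂').smul_section hA).add_section
      ((s₁'.lie s₂').neg.smul_section hB)) Set.inter_subset_left
  · rintro y ⟨hy, hy0 : lieForm (w₂ y) (w₂ y) ≠ 0⟩
    refine ⟨fun h0 => ?_, (e.mem_curvatureDist_iff hy _).2 ?_⟩
    · obtain ⟨c, hc, hu⟩ := hAB y hy 0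
      have h1 := hu (0, 0) (by simp)
      have h2 := hu (lieForm (w₂ y) (w₂ y), -lieForm (w₁ y) (w₂ y)) h0.symm
      exact hy0 (congrArg Prod.fst (h2.trans h1.symm))
    · obtain ⟨Z, hZ, hZ0⟩ := (Submodule.ne_bot_iff _).1 (h.curvature₁ y).2.2
      obtain ⟨⟨a, b⟩, hab, -⟩ := hAB y hy Z
      have hZf := (e.mem_curvatureDist_iff hy Z).1 hZ
      simp only at hab
      have hwf : a • w₁ y + b • w₂ y ∈ f y := by
        rw [hab, vecDeriv_add_vec, vecDeriv_smul_vec, vecDeriv_smul_vec] at hZf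
        exact hZf
      have c₁ := e.contact₁ h.legendre hy (A y) _ hwf
      have c₂ := e.contact₁ h.legendre hy (B y) _ hwf
      change lieForm (w₁ y) _ = 0 at c₁
      change lieForm (w₂ y) _ = 0 at c₂
      rw [map_add, map_smul, map_smul, smul_eq_mul, smul_eq_mul] at c₁ c₂
      have ha : a ≠ 0 := by
        rintro rfl
        have : b = 0 := by simpa [hy0] using c₂
        apply hZ0; rw [hab, this]; simp
      have hdet : lieForm (w₁ y) (w₁ y) * lieForm (w₂ y) (w₂ y)
          - lieForm (w₁ y) (w₂ y) * lieForm (w₁ y) (w₂ y) = 0 := by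
        rw [lieForm_comm (w₂ y) (w₁ y)] at c₂
        apply (mul_eq_zero.1 (?_ : a * _ = 0)).resolve_left ha
        linear_combination lieForm (w₂ y) (w₂ y) * c₁ - lieForm (w₁ y) (w₂ y) * c₂
      rw [vecDeriv_add_vec, vecDeriv_smul_vec, vecDeriv_smul_vec]
      change lieForm (w₂ y) (w₂ y) • w₁ y + (-lieForm (w₁ y) (w₂ y)) • w₂ y ∈ f y
      refine mem_of_orthogonal_of_nonpos (hP y) (hn y) (fun w hw => ?_) (le_of_eq ?_)
      · have h₁ : lieForm (w₁ y) w = 0 := e.contact₁ h.legendre hy (A y) w hw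
        have h₂ : lieForm (w₂ y) w = 0 := e.contact₁ h.legendre hy (B y) w hw
        simp [h₁, h₂]
      · simp only [map_add, map_smul, LinearMap.add_apply, LinearMap.smul_apply, smul_eq_mul,
          lieForm_comm (w₂ y) (w₁ y)]
        linear_combination lieForm (w₂ y) (w₂ y) * hdet

theorem exists_field (h : IsUmbilicFree f s₁ s₂) {x : M} (hx : x ∈ U) :
    ∃ V ⊆ U, IsOpen V ∧ x ∈ V ∧ ∃ X : (y : M) → TangentSpace (𝓡 2) y, SmoothFieldOn X V ∧
      ∀ y ∈ V, X y ≠ 0 ∧ X y ∈ curvatureDist f s₁ y := by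
  obtain ⟨W, hW, hxW, A, B, hA, hB, hAB⟩ := exists_local_fields x
  have e' := e.mono (e.isOpen.inter hW) Set.inter_subset_left
  have hA' : SmoothFieldOn A (U ∩ W) := ContMDiffOn.mono hA Set.inter_subset_right
  have hB' : SmoothFieldOn B (U ∩ W) := ContMDiffOn.mono hB Set.inter_subset_right
  have main : ∃ V ⊆ U ∩ W, IsOpen V ∧ x ∈ V ∧ ∃ X : (y : M) → TangentSpace (𝓡 2) y,
      SmoothFieldOn X V ∧ ∀ y ∈ V, X y ≠ 0 ∧ X y ∈ curvatureDist f s₁ y := by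
    -- `A` and `B` cannot both be curvature directions of `s₁`: then every vector would be one, in
    -- particular a nonzero element of the curvature space of `s₂`, against immersion of `f`.
    by_cases hBx : B x ∈ curvatureDist f s₁ x
    · by_cases hAx : A x ∈ curvatureDist f s₁ x
      · exfalso
        obtain ⟨Z, hZ, hZ0⟩ := (Submodule.ne_bot_iff _).1 (h.curvature₂ x).2.2
        obtain ⟨⟨a, b⟩, hab, -⟩ := hAB x hxW Z
        refine hZ0 (e.eq_zero_of_mem h.legendre hx ?_ hZ)
        rw [hab]
        exact Submodule.add_mem _ (Submodule.smul_mem _ _ hAx) (Submodule.smul_mem _ _ hBx)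
      · refine e'.exists_field_aux h hB' hA' (fun y hy Z => ?_) ⟨hx, hxW⟩ hAx
        obtain ⟨⟨a, b⟩, hab, hu⟩ := hAB y hy.2 Z
        refine ⟨(b, a), by simpa [add_comm] using hab, fun c hc => ?_⟩
        have := hu (c.2, c.1) (by simpa [add_comm] using hc)
        simp only [Prod.mk.injEq] at this
        exact Prod.ext this.2 this.1
    · exact e'.exists_field_aux h hA' hB' (fun y hy => hAB y hy.2) ⟨hx, hxW⟩ hBx
  obtain ⟨V, hV, r⟩ := main
  exact ⟨V, hV.trans Set.inter_subset_left, r⟩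

end IsSphereFrame

/-- Smooth frame fields for a pair of transverse line distributions. -/
structure IsFieldFrame (T₁ T₂ : (x : M) → Submodule ℝ (TangentSpace (𝓡 2) x)) (U : Set M)
    (X Y : (x : M) → TangentSpace (𝓡 2) x) : Prop where
  smooth₁ : SmoothFieldOn X U
  smooth₂ : SmoothFieldOn Y U
  span₁ : ∀ y ∈ U, T₁ y = Submodule.span ℝ {X y}
  span₂ : ∀ y ∈ U, T₂ y = Submodule.span ℝ {Y y}
  indep : ∀ y ∈ U, Indep (X y) (Y y)

theorem IsFieldFrame.symm {T₁ T₂ : (x : M) → Submodule ℝ (TangentSpace (𝓡 2) x)}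
    {X Y : (x : M) → TangentSpace (𝓡 2) x} (h : IsFieldFrame T₁ T₂ U X Y) :
    IsFieldFrame T₂ T₁ U Y X :=
  ⟨h.smooth₂, h.smooth₁, h.span₂, h.span₁, fun y hy => (h.indep y hy).symm⟩

theorem IsFieldFrame.mono {T₁ T₂ : (x : M) → Submodule ℝ (TangentSpace (𝓡 2) x)}
    {X Y : (x : M) → TangentSpace (𝓡 2) x} (h : IsFieldFrame T₁ T₂ U X Y) {V : Set M} (hV : V ⊆ U) :
    IsFieldFrame T₁ T₂ V X Y :=
  ⟨ContMDiffOn.mono h.smooth₁ hV, ContMDiffOn.mono h.smooth₂ hV, fun y hy => h.span₁ y (hV hy),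
    fun y hy => h.span₂ y (hV hy), fun y hy => h.indep y (hV hy)⟩

theorem IsFieldFrame.exists_eq {T₁ T₂ : (x : M) → Submodule ℝ (TangentSpace (𝓡 2) x)}
    {X Y : (x : M) → TangentSpace (𝓡 2) x} (h : IsFieldFrame T₁ T₂ U X Y) {y : M} (hy : y ∈ U)
    (Z : TangentSpace (𝓡 2) y) : ∃ a b : ℝ, Z = a • X y + b • Y y :=
  (h.indep y hy).exists_eq
    (show Module.finrank ℝ (EuclideanSpace ℝ (Fin 2)) = 2 by simp) Z

theorem IsFieldFrame.mem₁ {T₁ T₂ : (x : M) → Submodule ℝ (TangentSpace (𝓡 2) x)}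
    {X Y : (x : M) → TangentSpace (𝓡 2) x} (h : IsFieldFrame T₁ T₂ U X Y) {y : M} (hy : y ∈ U) :
    X y ∈ T₁ y := h.span₁ y hy ▸ Submodule.mem_span_singleton_self _

theorem IsFieldFrame.mem₂ {T₁ T₂ : (x : M) → Submodule ℝ (TangentSpace (𝓡 2) x)}
    {X Y : (x : M) → TangentSpace (𝓡 2) x} (h : IsFieldFrame T₁ T₂ U X Y) {y : M} (hy : y ∈ U) :
    Y y ∈ T₂ y := h.symm.mem₁ hy

theorem IsFieldFrame.smul {T₁ T₂ : (x : M) → Submodule ℝ (TangentSpace (𝓡 2) x)}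
    {X Y : (x : M) → TangentSpace (𝓡 2) x} (h : IsFieldFrame T₁ T₂ U X Y) {c d : M → ℝ}
    (hc : SmoothOn c U) (hd : SmoothOn d U) (hc0 : ∀ y ∈ U, c y ≠ 0) (hd0 : ∀ y ∈ U, d y ≠ 0) :
    IsFieldFrame T₁ T₂ U (fun y => c y • X y) (fun y => d y • Y y) where
  smooth₁ := hc.smul_section h.smooth₁
  smooth₂ := hd.smul_section h.smooth₂
  span₁ y hy := by
    rw [h.span₁ y hy, Submodule.span_singleton_smul_eq (IsUnit.mk0 _ (hc0 y hy))]
  span₂ y hy := by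
    rw [h.span₂ y hy, Submodule.span_singleton_smul_eq (IsUnit.mk0 _ (hd0 y hy))]
  indep y hy a b hab := by
    rw [smul_smul, smul_smul] at hab
    have := h.indep y hy _ _ hab
    exact ⟨(mul_eq_zero.1 this.1).resolve_right (hc0 y hy),
      (mul_eq_zero.1 this.2).resolve_right (hd0 y hy)⟩

theorem IsUmbilicFree.exists_fieldFrame (h : IsUmbilicFree f s₁ s₂) (x : M) :
    ∃ U : Set M, IsOpen U ∧ x ∈ U ∧ ∃ X Y : (x : M) → TangentSpace (𝓡 2) x,
      IsFieldFrame (curvatureDist f s₁) (curvatureDist f s₂) U X Y := by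
  obtain ⟨U, σ₁, σ₂, hx, e⟩ := h.exists_frame x
  obtain ⟨V, hVU, hV, hxV, X, hX, hX'⟩ := e.exists_field h hx
  obtain ⟨W, hWU, hW, hxW, Y, hY, hY'⟩ := e.symm.exists_field h.symm hx
  have key : ∀ y ∈ V ∩ W, Indep (X y) (Y y) := by
    intro y hy a b hab
    have hyU := hVU hy.1
    have ha : a • X y = 0 := by
      refine e.eq_zero_of_mem h.legendre hyU (Submodule.smul_mem _ _ (hX' y hy.1).2) ?_
      rw [eq_neg_of_add_eq_zero_left hab]
      exact Submodule.neg_mem _ (Submodule.smul_mem _ _ (hY' y hy.2).2)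
    rw [ha, zero_add] at hab
    exact ⟨(smul_eq_zero.1 ha).resolve_right (hX' y hy.1).1,
      (smul_eq_zero.1 hab).resolve_right (hY' y hy.2).1⟩
  have span_eq : ∀ y ∈ V ∩ W, ∀ Z : TangentSpace (𝓡 2) y, ∃ a b : ℝ, Z = a • X y + b • Y y :=
    fun y hy Z => (key y hy).exists_eq
      (show Module.finrank ℝ (EuclideanSpace ℝ (Fin 2)) = 2 by simp) Z
  refine ⟨V ∩ W, hV.inter hW, ⟨hxV, hxW⟩, X, Y, ContMDiffOn.mono hX Set.inter_subset_left,
    ContMDiffOn.mono hY Set.inter_subset_right, fun y hy => le_antisymm (fun Z hZ => ?_) ?_,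
    fun y hy => le_antisymm (fun Z hZ => ?_) ?_, key⟩
  · obtain ⟨a, b, rfl⟩ := span_eq y hy Z
    have hb : b • Y y = 0 := by
      refine e.eq_zero_of_mem h.legendre (hVU hy.1) ?_ (Submodule.smul_mem _ _ (hY' y hy.2).2)
      simpa using Submodule.sub_mem _ hZ (Submodule.smul_mem _ a (hX' y hy.1).2)
    rw [hb, add_zero]
    exact Submodule.smul_mem _ _ (Submodule.mem_span_singleton_self _)
  · rw [Submodule.span_singleton_le_iff_mem]; exact (hX' y hy.1).2
  · obtain ⟨a, b, rfl⟩ := span_eq y hy Z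
    have ha : a • X y = 0 := by
      refine e.eq_zero_of_mem h.legendre (hVU hy.1) (Submodule.smul_mem _ _ (hX' y hy.1).2) ?_
      simpa using Submodule.sub_mem _ hZ (Submodule.smul_mem _ b (hY' y hy.2).2)
    rw [ha, zero_add]
    exact Submodule.smul_mem _ _ (Submodule.mem_span_singleton_self _)
  · rw [Submodule.span_singleton_le_iff_mem]; exact (hY' y hy.2).2

end Fields

/-! ### The common sphere congruence avoids the curvature spheres -/

section Ribaucour

variable {M : Type*} [TopologicalSpace M] [ChartedSpace (EuclideanSpace ℝ (Fin 2)) M]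
  [IsManifold (𝓡 2) ∞ M] {f s₁ s₂ g r₁ r₂ : M → Submodule ℝ R42} {U : Set M}
  {σ₁ σ₂ ρ₁ ρ₂ : M → R42} {X Y : (x : M) → TangentSpace (𝓡 2) x}

theorem IsRegular.symm (h : IsRegular g r₁ r₂) : IsRegular g r₂ r₁ :=
  ⟨h.toIsUmbilicFree.symm, h.immerses₂, h.immerses₁⟩

theorem IsDupinCyclide.symm (h : IsDupinCyclide f s₁ s₂) : IsDupinCyclide f s₂ s₁ :=
  ⟨h.toIsUmbilicFree.symm, h.circular₂, h.circular₁⟩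

/-- `X` and `Y` span the curvature line distributions of `f`, framed by curvature spheres. -/
structure IsCurvatureFrame (f s₁ s₂ : M → Submodule ℝ R42) (U : Set M) (σ₁ σ₂ : M → R42)
    (X Y : (x : M) → TangentSpace (𝓡 2) x) : Prop where
  umbilicFree : IsUmbilicFree f s₁ s₂
  frame : IsSphereFrame f s₁ s₂ U σ₁ σ₂
  fields : IsFieldFrame (curvatureDist f s₁) (curvatureDist f s₂) U X Y

namespace IsCurvatureFrame

theorem symm (e : IsCurvatureFrame f s₁ s₂ U σ₁ σ₂ X Y) : IsCurvatureFrame f s₂ s₁ U σ₂ σ₁ Y X :=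
  ⟨e.umbilicFree.symm, e.frame.symm, e.fields.symm⟩

variable (e : IsCurvatureFrame f s₁ s₂ U σ₁ σ₂ X Y)
include e

theorem deriv_mem {y : M} (hy : y ∈ U) : vecDeriv σ₁ y (X y) ∈ f y :=
  (e.frame.mem_curvatureDist_iff hy _).1 (e.fields.mem₁ hy)

theorem deriv_notMem {y : M} (hy : y ∈ U) : vecDeriv σ₂ y (X y) ∉ f y := fun h =>
  (e.fields.indep y hy).left_ne_zero (e.frame.eq_zero_of_mem e.umbilicFree.legendre hy
    (e.fields.mem₁ hy) ((e.frame.symm.mem_curvatureDist_iff hy _).2 h))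

theorem deriv_pos {y : M} (hy : y ∈ U) :
    0 < lieForm (vecDeriv σ₂ y (X y)) (vecDeriv σ₂ y (X y)) :=
  lieForm_pos_of_notMem (e.umbilicFree.legendre.subbundle.finrank_eq y)
    (e.umbilicFree.legendre.null y) (e.frame.symm.contact₁ e.umbilicFree.legendre hy _)
    (e.deriv_notMem hy)

/-- The curvature directions of a Legendre map are conjugate. -/
theorem conjugate {y : M} (hy : y ∈ U) :
    lieForm (vecDeriv σ₂ y (X y)) (vecDeriv σ₁ y (Y y)) = 0 := by
  have hO := e.frame.isOpen
  have hl := e.umbilicFree.legendre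
  have c₁ := fun (z : M) (hz : z ∈ U) => e.frame.contact₁ hl hz
  have c₂ := fun (z : M) (hz : z ∈ U) => e.frame.symm.contact₁ hl hz
  have sX := e.fields.smooth₁
  have sY := e.fields.smooth₂
  have h1 := e.frame.smooth₁
  have h2 := e.frame.smooth₂
  have k1 := vecDeriv_lie_of_const hO hy h2 (h1.vecDeriv hO sY) (c := 0)
    (fun z hz => by rw [lieForm_comm]; exact c₁ z hz (Y z) _ (e.frame.mem₂ hz)) (X y)
  have k2 := vecDeriv_lie_of_const hO hy h2 (h1.vecDeriv hO sX) (c := 0)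
    (fun z hz => by rw [lieForm_comm]; exact c₁ z hz (X z) _ (e.frame.mem₂ hz)) (Y y)
  -- The two mixed derivatives of `σ₁` differ by a first derivative of `σ₁`, which is orthogonal to
  -- `σ₂` by contact.
  obtain ⟨Z, hZ⟩ := exists_commutator (F := R42) hO hy sX sY
  have k3 := c₁ y hy Z _ (e.frame.mem₂ hy)
  rw [← hZ σ₁ h1, map_sub, LinearMap.sub_apply, lieForm_comm _ (σ₂ y), lieForm_comm _ (σ₂ y)] at k3
  have k4 := c₂ y hy (Y y) _ (e.deriv_mem hy)
  linarith

/-- For a section of `f` with coefficient `d` along `σ₂`. -/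
theorem deriv_norm {y : M} (hy : y ∈ U) {p v : R42} {d : ℝ} (hp : p ∈ f y)
    (hv : v = p + d • vecDeriv σ₂ y (X y)) :
    lieForm v v = d * d * lieForm (vecDeriv σ₂ y (X y)) (vecDeriv σ₂ y (X y)) := by
  have c₂ := e.frame.symm.contact₁ e.umbilicFree.legendre hy (X y) p hp
  rw [hv]
  simp only [map_add, map_smul, LinearMap.add_apply, LinearMap.smul_apply, smul_eq_mul,
    e.umbilicFree.legendre.null y p hp p hp, c₂, lieForm_comm p]
  ring

theorem deriv_smul_add_smul {τ : M → R42} {c d : M → ℝ} (hc : SmoothOn c U) (hd : SmoothOn d U)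
    (h : ∀ y ∈ U, τ y = c y • σ₁ y + d y • σ₂ y) {y : M} (hy : y ∈ U) (Z : TangentSpace (𝓡 2) y) :
    vecDeriv τ y Z = vecDeriv c y Z • σ₁ y + c y • vecDeriv σ₁ y Z +
      (vecDeriv d y Z • σ₂ y + d y • vecDeriv σ₂ y Z) := by
  have hO := e.frame.isOpen
  have h1 := e.frame.smooth₁
  have h2 := e.frame.smooth₂
  rw [vecDeriv_congr hO hy h, vecDeriv_add hO hy Z (hc.smul h1) (hd.smul h2),
    vecDeriv_smul hO hy Z hc h1, vecDeriv_smul hO hy Z hd h2]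

theorem exists_coeff {τ : M → R42} (hτ : SmoothOn τ U) (h : ∀ y ∈ U, τ y ∈ f y) :
    ∃ c d : M → ℝ, SmoothOn c U ∧ SmoothOn d U ∧ ∀ y ∈ U, τ y = c y • σ₁ y + d y • σ₂ y :=
  exists_smooth_coeff₂ e.frame.smooth₁ e.frame.smooth₂ hτ e.frame.indep
    (fun y hy => e.frame.span y hy ▸ h y hy)

end IsCurvatureFrame

/-- At a zero of `h`, every term of the second derivative of `h² N` still carrying a factor `h`
drops out. Applied to squared lengths, this compares the orders of vanishing of two coefficients. -/
theorem vecDeriv_vecDeriv_sq_mul (hU : IsOpen U) {x : M} (hx : x ∈ U) (hX : SmoothFieldOn X U)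
    {h N : M → ℝ} (sh : SmoothOn h U) (sN : SmoothOn N U) (h0 : h x = 0) :
    vecDeriv (fun y => vecDeriv (fun z => h z * h z * N z) y (X y)) x (X x)
      = 2 * (vecDeriv h x (X x)) ^ 2 * N x := by
  have sh' : SmoothOn (fun y => vecDeriv h y (X y)) U := sh.vecDeriv hU hX
  have sN' : SmoothOn (fun y => vecDeriv N y (X y)) U := sN.vecDeriv hU hX
  have h1 : ∀ y ∈ U, vecDeriv (fun z => h z * h z * N z) y (X y) =
      h y * (2 * (vecDeriv h y (X y) * N y) + h y * vecDeriv N y (X y)) := by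
    intro y hy
    rw [vecDeriv_mul hU hy _ (sh.mul sh) sN, vecDeriv_mul hU hy _ sh sh]
    ring
  have s2 : SmoothOn (fun y => 2 * (vecDeriv h y (X y) * N y) + h y * vecDeriv N y (X y)) U :=
    ((smoothOn_const (2 : ℝ) U).mul (sh'.mul sN)).add (sh.mul sN')
  rw [vecDeriv_congr hU hx h1, vecDeriv_mul hU hx _ sh s2, h0]
  ring

/-- A Legendre map whose curvature spheres immerse shares no curvature sphere with a Dupin cyclide
of which it is a Ribaucour transform. -/
theorem sphere_notMem (hf : IsDupinCyclide f s₁ s₂) (hg : IsRegular g r₁ r₂)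
    (hfg : IsSubbundle 1 (fun x => f x ⊓ g x))
    (e : IsCurvatureFrame f s₁ s₂ U σ₁ σ₂ X Y) (e' : IsCurvatureFrame g r₁ r₂ U ρ₁ ρ₂ X Y)
    {σ₀ : M → R42} (h₀ : SmoothOn σ₀ U)
    (hσ₀ : ∀ y ∈ U, σ₀ y ≠ 0 ∧ f y ⊓ g y = Submodule.span ℝ {σ₀ y})
    {x : M} (hx : x ∈ U) : σ₁ x ∉ g x := by
  intro hxg
  have hO := e.frame.isOpen
  have hlf := hf.legendre
  have hlg := hg.legendre
  have m₀ : ∀ y ∈ U, σ₀ y ∈ f y ⊓ g y := fun y hy =>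
    (hσ₀ y hy).2 ▸ Submodule.mem_span_singleton_self _
  obtain ⟨p, q, sp, sq, hpq⟩ := e.exists_coeff h₀ (fun y hy => (m₀ y hy).1)
  obtain ⟨m, n, sm, sn, hmn⟩ := e'.exists_coeff h₀ (fun y hy => (m₀ y hy).2)
  have D := fun y hy => e.deriv_smul_add_smul sp sq hpq (y := y) hy (X y)
  have D' := fun y hy => e'.deriv_smul_add_smul sm sn hmn (y := y) hy (X y)
  have sX := e.fields.smooth₁
  have sNf := (e.frame.smooth₂.vecDeriv hO sX).lie (e.frame.smooth₂.vecDeriv hO sX)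
  have sNg := (e'.frame.smooth₂.vecDeriv hO sX).lie (e'.frame.smooth₂.vecDeriv hO sX)
  -- Both sides are the square of `d_X σ₀`, computed once in `f` and once in `g`: modulo the null
  -- space `f` (resp. `g`) only the derivative of the second curvature sphere contributes.
  have norm : ∀ y ∈ U, q y * q y * lieForm (vecDeriv σ₂ y (X y)) (vecDeriv σ₂ y (X y)) =
      n y * n y * lieForm (vecDeriv ρ₂ y (X y)) (vecDeriv ρ₂ y (X y)) := by
    intro y hy
    rw [← e.deriv_norm hy (p := vecDeriv p y (X y) • σ₁ y + p y • vecDeriv σ₁ y (X y) +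
        vecDeriv q y (X y) • σ₂ y) ?_ ((D y hy).trans (by abel)),
      ← e'.deriv_norm hy (p := vecDeriv m y (X y) • ρ₁ y + m y • vecDeriv ρ₁ y (X y) +
        vecDeriv n y (X y) • ρ₂ y) ?_ ((D' y hy).trans (by abel))]
    · exact Submodule.add_mem _ (Submodule.add_mem _ (Submodule.smul_mem _ _ (e'.frame.mem₁ hy))
        (Submodule.smul_mem _ _ (e'.deriv_mem hy))) (Submodule.smul_mem _ _ (e'.frame.mem₂ hy))
    · exact Submodule.add_mem _ (Submodule.add_mem _ (Submodule.smul_mem _ _ (e.frame.mem₁ hy))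
        (Submodule.smul_mem _ _ (e.deriv_mem hy))) (Submodule.smul_mem _ _ (e.frame.mem₂ hy))
  obtain ⟨t, ht⟩ : ∃ t : ℝ, t • σ₀ x = σ₁ x := by
    have : σ₁ x ∈ f x ⊓ g x := ⟨e.frame.mem₁ hx, hxg⟩
    rw [(hσ₀ x hx).2] at this
    exact Submodule.mem_span_singleton.1 this
  have hq : q x = 0 := by
    rw [hpq x hx] at ht
    have h1 := e.frame.indep x hx (t * p x - 1) (t * q x) (by
      have : (t * p x - 1) • σ₁ x + (t * q x) • σ₂ x = t • (p x • σ₁ x + q x • σ₂ x) - σ₁ x := by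
        module
      rw [this, ht, sub_self])
    rcases mul_eq_zero.1 h1.2 with h2 | h2
    · rw [h2] at h1; norm_num at h1
    · exact h2
  have hn : n x = 0 := by
    have h1 := norm x hx
    rw [hq] at h1
    have h2 := (e'.deriv_pos hx).ne'
    have h3 : n x * n x = 0 := (mul_eq_zero.1 (by linarith)).resolve_right h2
    exact mul_self_eq_zero.1 h3
  obtain ⟨a, ha⟩ : ∃ a : ℝ, a • σ₁ x = vecDeriv σ₁ x (X x) := by
    have h1 := hf.circular₁ x U σ₁ ⟨hO, hx, e.frame.smooth₁, fun y hy =>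
      e.frame.span₁ y hy ▸ Submodule.mem_span_singleton_self _⟩ (X x) (e.fields.mem₁ hx)
    rw [e.frame.span₁ x hx] at h1
    exact Submodule.mem_span_singleton.1 h1
  -- Otherwise `d_X σ₀ ⊥ g` yields `σ₂ ⊥ g`, hence `σ₂ ∈ g`. Then `f = g` at `x`, although the
  -- intersection has rank one.
  have hXq : vecDeriv q x (X x) = 0 := by
    by_contra hne
    have h2 : σ₂ x ∈ g x := by
      refine mem_of_orthogonal_of_nonpos (hlg.subbundle.finrank_eq x) (hlg.null x) (fun w hw => ?_)
        (hlf.null x _ (e.frame.mem₂ hx) _ (e.frame.mem₂ hx)).le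
      have h3 : lieForm (vecDeriv σ₀ x (X x)) w = 0 :=
        hlg.contact x U σ₀ ⟨hO, hx, h₀, fun y hy => (m₀ y hy).2⟩ (X x) w hw
      rw [D x hx, hq, ← ha] at h3
      have h4 := hlg.null x _ hxg w hw
      simp only [map_add, map_smul, LinearMap.add_apply, LinearMap.smul_apply, smul_eq_mul, h4,
        zero_smul, mul_zero, add_zero, zero_add] at h3
      exact (mul_eq_zero.1 h3).resolve_left hne
    have h5 : f x ⊓ g x = f x := by
      rw [inf_eq_left, e.frame.span x hx, Submodule.span_le]
      rintro v (rfl | rfl)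
      · exact hxg
      · exact h2
    have h6 := hfg.finrank_eq x
    rw [h5, hlf.subbundle.finrank_eq x] at h6
    norm_num at h6
  have hm : m x ≠ 0 := by
    intro h1
    have := hmn x hx
    rw [h1, hn, zero_smul, zero_smul, add_zero] at this
    exact (hσ₀ x hx).1 this
  -- If it vanished, `d_X σ₀` would be a multiple of `ρ₁` by circularity of `f`. Then `d_X ρ₁` would
  -- lie in `r₁`, and `r₁` would fail to immerse.
  have hXn : vecDeriv n x (X x) ≠ 0 := by
    intro hne
    have h1 := D' x hx
    rw [hne, hn, zero_smul, zero_smul, add_zero, add_zero, D x hx, hXq, hq, zero_smul, zero_smul,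
      add_zero, add_zero, ← ha, ← ht, hmn x hx, hn, zero_smul, add_zero] at h1
    have h2 : vecDeriv ρ₁ x (X x) ∈ r₁ x := by
      rw [e'.frame.span₁ x hx, Submodule.mem_span_singleton]
      refine ⟨(m x)⁻¹ * (vecDeriv p x (X x) * t * m x + p x * a * t * m x - vecDeriv m x (X x)), ?_⟩
      have h3 : m x • vecDeriv ρ₁ x (X x) = (vecDeriv p x (X x) * t * m x + p x * a * t * m x
          - vecDeriv m x (X x)) • ρ₁ x := by
        rw [← sub_eq_iff_eq_add'] at h1
        rw [← h1]; module
      rw [mul_smul, ← h3, smul_smul, inv_mul_cancel₀ hm, one_smul]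
    refine (e.fields.indep x hx).left_ne_zero (hg.immerses₁ x (X x) fun V τ hτ => ?_)
    exact dAlong_mem_of_frame hO hx e'.frame.smooth₁
      (fun y hy => ⟨(e'.frame.indep y hy).left_ne_zero, e'.frame.span₁ y hy⟩) h2 hτ
  -- The second derivative of `norm` along `X` at `x` is zero on the left, since `d_X q = 0`, but
  -- positive on the right.
  have k1 := vecDeriv_vecDeriv_sq_mul hO hx sX sq sNf hq
  have k2 := vecDeriv_vecDeriv_sq_mul hO hx sX sn sNg hn
  rw [vecDeriv_congr hO hx (fun y hy => vecDeriv_congr hO hy norm (X y)) (X x), k2, hXq] at k1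
  have := (e'.deriv_pos hx).ne'
  have h7 : vecDeriv n x (X x) ^ 2 = 0 := (mul_eq_zero.1 (by linarith)).resolve_right this
  exact hXn (pow_eq_zero_iff (two_ne_zero) |>.1 h7)

end Ribaucour

/-! ### Null frames adapted to an orthogonal splitting -/

/-- A basis of `ℝ^{4,2}` adapted to an orthogonal splitting into two subspaces of signature `(2,1)`,
each with a null basis. -/
structure IsNullFrame (σ₁ ν₁ τ₁ σ₂ ν₂ τ₂ : R42) : Prop where
  σ₁σ₁ : lieForm σ₁ σ₁ = 0
  σ₁ν₁ : lieForm σ₁ ν₁ = 0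
  σ₁τ₁ : lieForm σ₁ τ₁ = -1
  ν₁ν₁ : lieForm ν₁ ν₁ = 1
  ν₁τ₁ : lieForm ν₁ τ₁ = 0
  τ₁τ₁ : lieForm τ₁ τ₁ = 0
  σ₂σ₂ : lieForm σ₂ σ₂ = 0
  σ₂ν₂ : lieForm σ₂ ν₂ = 0
  σ₂τ₂ : lieForm σ₂ τ₂ = -1
  ν₂ν₂ : lieForm ν₂ ν₂ = 1
  ν₂τ₂ : lieForm ν₂ τ₂ = 0
  τ₂τ₂ : lieForm τ₂ τ₂ = 0
  σ₁σ₂ : lieForm σ₁ σ₂ = 0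
  σ₁ν₂ : lieForm σ₁ ν₂ = 0
  σ₁τ₂ : lieForm σ₁ τ₂ = 0
  ν₁σ₂ : lieForm ν₁ σ₂ = 0
  ν₁ν₂ : lieForm ν₁ ν₂ = 0
  ν₁τ₂ : lieForm ν₁ τ₂ = 0
  τ₁σ₂ : lieForm τ₁ σ₂ = 0
  τ₁ν₂ : lieForm τ₁ ν₂ = 0
  τ₁τ₂ : lieForm τ₁ τ₂ = 0

namespace IsNullFrame

variable {σ₁ ν₁ τ₁ σ₂ ν₂ τ₂ : R42}

theorem symm (h : IsNullFrame σ₁ ν₁ τ₁ σ₂ ν₂ τ₂) : IsNullFrame σ₂ ν₂ τ₂ σ₁ ν₁ τ₁ where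
  σ₁σ₁ := h.σ₂σ₂
  σ₁ν₁ := h.σ₂ν₂
  σ₁τ₁ := h.σ₂τ₂
  ν₁ν₁ := h.ν₂ν₂
  ν₁τ₁ := h.ν₂τ₂
  τ₁τ₁ := h.τ₂τ₂
  σ₂σ₂ := h.σ₁σ₁
  σ₂ν₂ := h.σ₁ν₁
  σ₂τ₂ := h.σ₁τ₁
  ν₂ν₂ := h.ν₁ν₁
  ν₂τ₂ := h.ν₁τ₁
  τ₂τ₂ := h.τ₁τ₁
  σ₁σ₂ := (lieForm_comm _ _).trans h.σ₁σ₂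
  σ₁ν₂ := (lieForm_comm _ _).trans h.ν₁σ₂
  σ₁τ₂ := (lieForm_comm _ _).trans h.τ₁σ₂
  ν₁σ₂ := (lieForm_comm _ _).trans h.σ₁ν₂
  ν₁ν₂ := (lieForm_comm _ _).trans h.ν₁ν₂
  ν₁τ₂ := (lieForm_comm _ _).trans h.τ₁ν₂
  τ₁σ₂ := (lieForm_comm _ _).trans h.σ₁τ₂
  τ₁ν₂ := (lieForm_comm _ _).trans h.ν₁τ₂
  τ₁τ₂ := (lieForm_comm _ _).trans h.τ₁τ₂

variable (h : IsNullFrame σ₁ ν₁ τ₁ σ₂ ν₂ τ₂)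
include h

/-- The scalar products of a vector given by its coordinates with the frame. -/
theorem coords (x₁ y₁ z₁ x₂ y₂ z₂ : ℝ) {v : R42}
    (hv : v = x₁ • σ₁ + y₁ • ν₁ + z₁ • τ₁ + (x₂ • σ₂ + y₂ • ν₂ + z₂ • τ₂)) :
    lieForm v σ₁ = -z₁ ∧ lieForm v ν₁ = y₁ ∧ lieForm v τ₁ = -x₁ ∧
    lieForm v σ₂ = -z₂ ∧ lieForm v ν₂ = y₂ ∧ lieForm v τ₂ = -x₂ := by
  have h' := h.symm
  subst hv
  simp [lieForm_comm ν₁ σ₁, lieForm_comm τ₁ σ₁, lieForm_comm τ₁ ν₁, lieForm_comm ν₂ σ₂,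
    lieForm_comm τ₂ σ₂, lieForm_comm τ₂ ν₂, h.σ₁σ₁, h.σ₁ν₁, h.σ₁τ₁, h.ν₁ν₁, h.ν₁τ₁, h.τ₁τ₁,
    h.σ₂σ₂, h.σ₂ν₂, h.σ₂τ₂, h.ν₂ν₂, h.ν₂τ₂, h.τ₂τ₂, h.σ₁σ₂, h.σ₁ν₂, h.σ₁τ₂, h.ν₁σ₂, h.ν₁ν₂,
    h.ν₁τ₂, h.τ₁σ₂, h.τ₁ν₂, h.τ₁τ₂, h'.σ₁σ₂, h'.σ₁ν₂, h'.σ₁τ₂, h'.ν₁σ₂, h'.ν₁ν₂,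
    h'.ν₁τ₂, h'.τ₁σ₂, h'.τ₁ν₂, h'.τ₁τ₂]

/-- A vector orthogonal to the frame vanishes. -/
theorem eq_zero {v : R42} (h1 : lieForm v σ₁ = 0) (h2 : lieForm v ν₁ = 0) (h3 : lieForm v τ₁ = 0)
    (h4 : lieForm v σ₂ = 0) (h5 : lieForm v ν₂ = 0) (h6 : lieForm v τ₂ = 0) : v = 0 := by
  let L : R42 →ₗ[ℝ] R42 := LinearMap.pi ![lieForm.flip σ₁, lieForm.flip ν₁, lieForm.flip τ₁,
    lieForm.flip σ₂, lieForm.flip ν₂, lieForm.flip τ₂]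
  -- `coords` shows that pairing with the frame is onto; equality of dimensions then makes it
  -- injective.
  have hL : Function.Surjective L := by
    intro c
    refine ⟨(-c 2) • σ₁ + c 1 • ν₁ + (-c 0) • τ₁ + ((-c 5) • σ₂ + c 4 • ν₂ + (-c 3) • τ₂), ?_⟩
    obtain ⟨k1, k2, k3, k4, k5, k6⟩ := h.coords _ _ _ _ _ _ (v := _) rfl
    ext i
    fin_cases i
    · exact k1.trans (neg_neg _)
    · exact k2
    · exact k3.trans (neg_neg _)
    · exact k4.trans (neg_neg _)
    · exact k5
    · exact k6.trans (neg_neg _)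
  refine LinearMap.injective_iff_surjective.2 hL ?_
  rw [map_zero]
  ext i
  fin_cases i
  · exact h1
  · exact h2
  · exact h3
  · exact h4
  · exact h5
  · exact h6

theorem eq_of_coords {v : R42} (x₁ y₁ z₁ x₂ y₂ z₂ : ℝ) (h1 : lieForm v σ₁ = -z₁)
    (h2 : lieForm v ν₁ = y₁) (h3 : lieForm v τ₁ = -x₁) (h4 : lieForm v σ₂ = -z₂)
    (h5 : lieForm v ν₂ = y₂) (h6 : lieForm v τ₂ = -x₂) :
    v = x₁ • σ₁ + y₁ • ν₁ + z₁ • τ₁ + (x₂ • σ₂ + y₂ • ν₂ + z₂ • τ₂) := by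
  obtain ⟨k1, k2, k3, k4, k5, k6⟩ := h.coords x₁ y₁ z₁ x₂ y₂ z₂ rfl
  rw [← sub_eq_zero]
  apply h.eq_zero <;> rw [map_sub, LinearMap.sub_apply] <;> simp only [*, sub_self]

/-- The frame is a basis. -/
theorem exists_coords (v : R42) : ∃ x₁ y₁ z₁ x₂ y₂ z₂ : ℝ,
    v = x₁ • σ₁ + y₁ • ν₁ + z₁ • τ₁ + (x₂ • σ₂ + y₂ • ν₂ + z₂ • τ₂) :=
  ⟨_, _, _, _, _, _, h.eq_of_coords _ _ _ _ _ _ (neg_neg _).symm rfl (neg_neg _).symm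
    (neg_neg _).symm rfl (neg_neg _).symm⟩

theorem lieForm_eq (x₁ y₁ z₁ x₂ y₂ z₂ : ℝ) {v : R42} (w : R42)
    (hv : v = x₁ • σ₁ + y₁ • ν₁ + z₁ • τ₁ + (x₂ • σ₂ + y₂ • ν₂ + z₂ • τ₂)) :
    lieForm v w = x₁ * lieForm w σ₁ + y₁ * lieForm w ν₁ + z₁ * lieForm w τ₁ +
      (x₂ * lieForm w σ₂ + y₂ * lieForm w ν₂ + z₂ * lieForm w τ₂) := by
  rw [hv, lieForm_comm]
  simp

end IsNullFrame

/-! ### Normalised frames of a Ribaucour pair -/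

section Ribaucour

variable {M : Type*} [TopologicalSpace M] [ChartedSpace (EuclideanSpace ℝ (Fin 2)) M]
  [IsManifold (𝓡 2) ∞ M] {f s₁ s₂ g r₁ r₂ : M → Submodule ℝ R42} {U : Set M}
  {σ₁ σ₂ ρ₁ ρ₂ : M → R42} {X Y : (x : M) → TangentSpace (𝓡 2) x}

theorem IsSphereFrame.smul (e : IsSphereFrame f s₁ s₂ U σ₁ σ₂) {c d : M → ℝ}
    (hc : SmoothOn c U) (hd : SmoothOn d U) (hc0 : ∀ y ∈ U, c y ≠ 0) (hd0 : ∀ y ∈ U, d y ≠ 0) :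
    IsSphereFrame f s₁ s₂ U (fun y => c y • σ₁ y) (fun y => d y • σ₂ y) where
  isOpen := e.isOpen
  smooth₁ := hc.smul e.smooth₁
  smooth₂ := hd.smul e.smooth₂
  indep y hy a b hab := by
    rw [smul_smul, smul_smul] at hab
    have := e.indep y hy _ _ hab
    exact ⟨(mul_eq_zero.1 this.1).resolve_right (hc0 y hy),
      (mul_eq_zero.1 this.2).resolve_right (hd0 y hy)⟩
  span₁ y hy := by
    rw [e.span₁ y hy, Submodule.span_singleton_smul_eq (IsUnit.mk0 _ (hc0 y hy))]
  span₂ y hy := by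
    rw [e.span₂ y hy, Submodule.span_singleton_smul_eq (IsUnit.mk0 _ (hd0 y hy))]
  span y hy := by
    rw [e.span y hy, Submodule.span_insert, Submodule.span_insert,
      Submodule.span_singleton_smul_eq (IsUnit.mk0 _ (hd0 y hy)),
      Submodule.span_singleton_smul_eq (IsUnit.mk0 _ (hc0 y hy))]

/-- Local frames for a Ribaucour pair consisting of a Dupin cyclide `f` and a Legendre map `g`,
such that `σ₁ + σ₂` spans `f ∩ g`. -/
structure IsRibaucourFrame (f s₁ s₂ g r₁ r₂ : M → Submodule ℝ R42) (U : Set M)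
    (σ₁ σ₂ ρ₁ ρ₂ : M → R42) (X Y : (x : M) → TangentSpace (𝓡 2) x) (a b : M → ℝ) : Prop where
  left : IsCurvatureFrame f s₁ s₂ U σ₁ σ₂ X Y
  right : IsCurvatureFrame g r₁ r₂ U ρ₁ ρ₂ X Y
  smooth₁ : SmoothOn a U
  smooth₂ : SmoothOn b U
  mem : ∀ y ∈ U, σ₁ y + σ₂ y ∈ g y
  notMem₁ : ∀ y ∈ U, σ₁ y ∉ g y
  notMem₂ : ∀ y ∈ U, σ₂ y ∉ g y
  deriv₁ : ∀ y ∈ U, vecDeriv σ₁ y (X y) = a y • σ₁ y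
  deriv₂ : ∀ y ∈ U, vecDeriv σ₂ y (Y y) = b y • σ₂ y
  unit₁ : ∀ y ∈ U, lieForm (vecDeriv σ₁ y (Y y)) (vecDeriv σ₁ y (Y y)) = 1
  unit₂ : ∀ y ∈ U, lieForm (vecDeriv σ₂ y (X y)) (vecDeriv σ₂ y (X y)) = 1

theorem IsRibaucourFrame.symm {a b : M → ℝ}
    (e : IsRibaucourFrame f s₁ s₂ g r₁ r₂ U σ₁ σ₂ ρ₁ ρ₂ X Y a b) :
    IsRibaucourFrame f s₂ s₁ g r₂ r₁ U σ₂ σ₁ ρ₂ ρ₁ Y X b a :=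
  ⟨e.left.symm, e.right.symm, e.smooth₂, e.smooth₁, fun y hy => add_comm (σ₁ y) _ ▸ e.mem y hy,
    e.notMem₂, e.notMem₁, e.deriv₂, e.deriv₁, e.unit₂, e.unit₁⟩

theorem exists_circular_coeff (h : ConstantAlong s₁ (curvatureDist f s₁))
    (e : IsCurvatureFrame f s₁ s₂ U σ₁ σ₂ X Y) :
    ∃ a : M → ℝ, SmoothOn a U ∧ ∀ y ∈ U, vecDeriv σ₁ y (X y) = a y • σ₁ y := by
  refine exists_smooth_coeff e.frame.smooth₁ (e.frame.smooth₁.vecDeriv e.frame.isOpen e.fields.smooth₁)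
    (fun y hy => (e.frame.indep y hy).left_ne_zero) fun y hy => ?_
  rw [← e.frame.span₁ y hy]
  exact h y U σ₁ ⟨e.frame.isOpen, hy, e.frame.smooth₁, fun z hz =>
    e.frame.span₁ z hz ▸ Submodule.mem_span_singleton_self _⟩ (X y) (e.fields.mem₁ hy)

/-- Since `f ∩ g` contains neither curvature sphere, its generator has two nonvanishing
coefficients, and these are absorbed into `σ₁` and `σ₂`. The freedom left in `X` and `Y` is spent on
making the transverse derivatives unit vectors, which is possible because `deriv_pos` shows them to
be spacelike. -/
theorem exists_ribaucourFrame (hf : IsDupinCyclide f s₁ s₂) (hg : IsRegular g r₁ r₂)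
    (hfg : IsRibaucourPair f s₁ s₂ g r₁ r₂) (x : M) : ∃ U, x ∈ U ∧ ∃ σ₁ σ₂ ρ₁ ρ₂ X Y a b,
      IsRibaucourFrame f s₁ s₂ g r₁ r₂ U σ₁ σ₂ ρ₁ ρ₂ X Y a b := by
  obtain ⟨U₁, σ₁, σ₂, hx₁, e₁⟩ := hf.exists_frame x
  obtain ⟨U₂, ρ₁, ρ₂, hx₂, e₂⟩ := hg.exists_frame x
  obtain ⟨U₃, hU₃, hx₃, X, Y, e₃⟩ := hf.exists_fieldFrame x
  obtain ⟨U₄, hU₄, hx₄, σ₀, h₀, hσ₀⟩ := hfg.envelope.exists_section x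
  set U := (U₁ ∩ U₂) ∩ (U₃ ∩ U₄)
  have hU : IsOpen U := (e₁.isOpen.inter e₂.isOpen).inter (hU₃.inter hU₄)
  have hT₁ : curvatureDist f s₁ = curvatureDist g r₁ := funext hfg.curvatureLines₁
  have hT₂ : curvatureDist f s₂ = curvatureDist g r₂ := funext hfg.curvatureLines₂
  have e : IsCurvatureFrame f s₁ s₂ U σ₁ σ₂ X Y :=
    ⟨hf.toIsUmbilicFree, e₁.mono hU fun y hy => hy.1.1, e₃.mono fun y hy => hy.2.1⟩
  have e' : IsCurvatureFrame g r₁ r₂ U ρ₁ ρ₂ X Y :=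
    ⟨hg.toIsUmbilicFree, e₂.mono hU fun y hy => hy.1.2, hT₁ ▸ hT₂ ▸ e.fields⟩
  have h₀' : SmoothOn σ₀ U := h₀.mono fun y hy => hy.2.2
  have hσ₀' : ∀ y ∈ U, σ₀ y ≠ 0 ∧ f y ⊓ g y = Submodule.span ℝ {σ₀ y} := fun y hy => hσ₀ y hy.2.2
  have m₀ : ∀ y ∈ U, σ₀ y ∈ f y ⊓ g y := fun y hy =>
    (hσ₀' y hy).2 ▸ Submodule.mem_span_singleton_self _
  have n₁ : ∀ y ∈ U, σ₁ y ∉ g y := fun y hy =>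
    sphere_notMem hf hg hfg.envelope e e' h₀' hσ₀' hy
  have n₂ : ∀ y ∈ U, σ₂ y ∉ g y := fun y hy =>
    sphere_notMem hf.symm hg.symm hfg.envelope e.symm e'.symm h₀' hσ₀' hy
  obtain ⟨p, q, sp, sq, hpq⟩ := e.exists_coeff h₀' (fun y hy => (m₀ y hy).1)
  have smul_notMem : ∀ {y : M} {c : ℝ} {v : R42}, c ≠ 0 → v ∉ g y → c • v ∉ g y :=
    fun hc hv h => hv ((Submodule.smul_mem_iff _ hc).1 h)
  have hp0 : ∀ y ∈ U, p y ≠ 0 := fun y hy hp => by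
    have h := hpq y hy
    rw [hp, zero_smul, zero_add] at h
    have hq : q y ≠ 0 := fun hq => (hσ₀' y hy).1 (by rw [h, hq, zero_smul])
    exact smul_notMem hq (n₂ y hy) (h ▸ (m₀ y hy).2)
  have hq0 : ∀ y ∈ U, q y ≠ 0 := fun y hy hq => by
    have h := hpq y hy
    rw [hq, zero_smul, add_zero] at h
    exact smul_notMem (hp0 y hy) (n₁ y hy) (h ▸ (m₀ y hy).2)
  have E : IsCurvatureFrame f s₁ s₂ U (fun y => p y • σ₁ y) (fun y => q y • σ₂ y) X Y :=
    ⟨e.umbilicFree, e.frame.smul sp sq hp0 hq0, e.fields⟩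
  have posX := fun (y : M) (hy : y ∈ U) => E.deriv_pos hy
  have posY := fun (y : M) (hy : y ∈ U) => E.symm.deriv_pos hy
  have SX := E.frame.smooth₂.vecDeriv hU E.fields.smooth₁
  have SY := E.frame.smooth₁.vecDeriv hU E.fields.smooth₂
  have sX := ((SX.lie SX).sqrt fun y hy => (posX y hy).ne').inv
    fun y hy => (Real.sqrt_pos.2 (posX y hy)).ne'
  have sY := ((SY.lie SY).sqrt fun y hy => (posY y hy).ne').inv
    fun y hy => (Real.sqrt_pos.2 (posY y hy)).ne'
  have fields := e.fields.smul sX sY (fun y hy => (inv_pos.2 (Real.sqrt_pos.2 (posX y hy))).ne')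
    (fun y hy => (inv_pos.2 (Real.sqrt_pos.2 (posY y hy))).ne')
  have E₁ : IsCurvatureFrame f s₁ s₂ U _ _ _ _ := ⟨e.umbilicFree, E.frame, fields⟩
  have E₂ : IsCurvatureFrame g r₁ r₂ U ρ₁ ρ₂ _ _ := ⟨e'.umbilicFree, e'.frame, hT₁ ▸ hT₂ ▸ fields⟩
  obtain ⟨a, sa, ha⟩ := exists_circular_coeff hf.circular₁ E₁
  obtain ⟨b, sb, hb⟩ := exists_circular_coeff hf.circular₂ E₁.symm
  have unit : ∀ (v : R42), 0 < lieForm v v →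
      lieForm ((Real.sqrt (lieForm v v))⁻¹ • v) ((Real.sqrt (lieForm v v))⁻¹ • v) = 1 := by
    intro v hv
    have h1 := Real.mul_self_sqrt hv.le
    have h2 := (Real.sqrt_pos.2 hv).ne'
    simp only [map_smul, LinearMap.smul_apply, smul_eq_mul]
    field_simp
    rw [pow_two, h1]
  refine ⟨U, ⟨⟨hx₁, hx₂⟩, hx₃, hx₄⟩, _, _, ρ₁, ρ₂, _, _, a, b, E₁, E₂, sa, sb,
    fun y hy => hpq y hy ▸ (m₀ y hy).2, fun y hy => smul_notMem (hp0 y hy) (n₁ y hy),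
    fun y hy => smul_notMem (hq0 y hy) (n₂ y hy), ha, hb, fun y hy => ?_, fun y hy => ?_⟩
  · rw [vecDeriv_smul_vec]; exact unit _ (posY y hy)
  · rw [vecDeriv_smul_vec]; exact unit _ (posX y hy)

end Ribaucour

/-! ### Structure equations of the normalised frame -/

section Ribaucour

variable {M : Type*} [TopologicalSpace M] [ChartedSpace (EuclideanSpace ℝ (Fin 2)) M]
  [IsManifold (𝓡 2) ∞ M] {f s₁ s₂ g r₁ r₂ : M → Submodule ℝ R42} {U : Set M}
  {σ₁ σ₂ ρ₁ ρ₂ : M → R42} {X Y : (x : M) → TangentSpace (𝓡 2) x} {a b : M → ℝ}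

/-- The derivative of the curvature sphere `σ` along `Y`, covariant with respect to the
connection form with value `b` on `Y`. -/
noncomputable def sphereNormal (σ : M → R42) (Y : (x : M) → TangentSpace (𝓡 2) x) (b : M → ℝ)
    (y : M) : R42 :=
  vecDeriv σ y (Y y) - b y • σ y

/-- The curvature of the null curve described by `σ` along `Y`. -/
noncomputable def sphereCurvature (σ : M → R42) (Y : (x : M) → TangentSpace (𝓡 2) x) (b : M → ℝ)
    (y : M) : ℝ :=
  -2⁻¹ * lieForm (vecDeriv (sphereNormal σ Y b) y (Y y)) (vecDeriv (sphereNormal σ Y b) y (Y y))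

/-- The null vector dual to `σ` in the Lie cyclide. -/
noncomputable def sphereDual (σ : M → R42) (Y : (x : M) → TangentSpace (𝓡 2) x) (b : M → ℝ)
    (y : M) : R42 :=
  vecDeriv (sphereNormal σ Y b) y (Y y) - sphereCurvature σ Y b y • σ y

namespace IsRibaucourFrame

variable (e : IsRibaucourFrame f s₁ s₂ g r₁ r₂ U σ₁ σ₂ ρ₁ ρ₂ X Y a b)
include e

theorem isOpen : IsOpen U := e.left.frame.isOpen

theorem smooth_σ₁ : SmoothOn σ₁ U := e.left.frame.smooth₁

theorem smooth_normal : SmoothOn (sphereNormal σ₁ Y b) U :=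
  (e.smooth_σ₁.vecDeriv e.isOpen e.left.fields.smooth₂).sub (e.smooth₂.smul e.smooth_σ₁)

theorem smooth_curvature : SmoothOn (sphereCurvature σ₁ Y b) U :=
  have h := e.smooth_normal.vecDeriv e.isOpen e.left.fields.smooth₂
  (smoothOn_const _ U).mul (h.lie h)

theorem smooth_dual : SmoothOn (sphereDual σ₁ Y b) U :=
  (e.smooth_normal.vecDeriv e.isOpen e.left.fields.smooth₂).sub (e.smooth_curvature.smul e.smooth_σ₁)

omit e in
theorem deriv_σ₁_Y (y : M) :
    vecDeriv σ₁ y (Y y) = sphereNormal σ₁ Y b y + b y • σ₁ y := by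
  rw [sphereNormal, sub_add_cancel]

omit e in
theorem deriv_normal_Y (y : M) :
    vecDeriv (sphereNormal σ₁ Y b) y (Y y) =
      sphereDual σ₁ Y b y + sphereCurvature σ₁ Y b y • σ₁ y := by
  rw [sphereDual, sub_add_cancel]

theorem null_left {y : M} (hy : y ∈ U) : lieForm (σ₁ y) (σ₁ y) = 0 ∧ lieForm (σ₁ y) (σ₂ y) = 0 :=
  have h := e.left.umbilicFree.legendre.null y _ (e.left.frame.mem₁ hy)
  ⟨h _ (e.left.frame.mem₁ hy), h _ (e.left.frame.mem₂ hy)⟩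

theorem normal_orthogonal_left {y : M} (hy : y ∈ U) : ∀ w ∈ f y,
    lieForm (sphereNormal σ₁ Y b y) w = 0 := by
  intro w hw
  rw [sphereNormal, map_sub, map_smul, LinearMap.sub_apply, LinearMap.smul_apply,
    e.left.frame.contact₁ e.left.umbilicFree.legendre hy _ w hw,
    e.left.umbilicFree.legendre.null y _ (e.left.frame.mem₁ hy) w hw, smul_zero, sub_zero]

theorem normal_normal {y : M} (hy : y ∈ U) :
    lieForm (sphereNormal σ₁ Y b y) (sphereNormal σ₁ Y b y) = 1 := by
  have h1 := e.normal_orthogonal_left hy _ (e.left.frame.mem₁ hy)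
  have h2 := e.unit₁ y hy
  rw [deriv_σ₁_Y (σ₁ := σ₁) (b := b)] at h2
  simp only [map_add, map_smul, LinearMap.add_apply, LinearMap.smul_apply, smul_eq_mul, h1,
    lieForm_comm (σ₁ y), (e.null_left hy).1] at h2
  linarith [(e.null_left hy).1]

/-- The term `d_Y σ₂ - b σ₂` is zero and may be added. This expresses `ν₁` through a section of `g`,
so that the contact condition of `g` applies to it as well as that of `f`. -/
theorem normal_eq {y : M} (hy : y ∈ U) : sphereNormal σ₁ Y b y =
    vecDeriv (fun z => σ₁ z + σ₂ z) y (Y y) - b y • (σ₁ y + σ₂ y) := by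
  rw [vecDeriv_add e.isOpen hy _ e.smooth_σ₁ e.symm.smooth_σ₁, e.deriv₂ y hy, sphereNormal]
  module

theorem normal_orthogonal_right {y : M} (hy : y ∈ U) : ∀ w ∈ g y,
    lieForm (sphereNormal σ₁ Y b y) w = 0 := by
  intro w hw
  rw [e.normal_eq hy, map_sub, map_smul, LinearMap.sub_apply, LinearMap.smul_apply]
  have h1 : lieForm (vecDeriv (fun z => σ₁ z + σ₂ z) y (Y y)) w = 0 :=
    e.right.umbilicFree.legendre.contact y U _
      ⟨e.isOpen, hy, e.smooth_σ₁.add e.symm.smooth_σ₁, e.mem⟩ _ w hw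
  rw [h1, e.right.umbilicFree.legendre.null y _ (e.mem y hy) w hw, smul_zero, sub_zero]

/-- Expand the common sphere as `m ρ₁ + n ρ₂`. The vector `d_X ρ₂` is orthogonal to `g`, hence to
`d_Y ρ₂`, and it is orthogonal to `d_Y ρ₁` by conjugacy for `g`. -/
theorem lieForm_normal_deriv {y : M} (hy : y ∈ U) :
    lieForm (sphereNormal σ₁ Y b y) (vecDeriv ρ₂ y (X y)) = 0 := by
  have hl := e.right.umbilicFree.legendre
  have c₂ := fun w hw => (lieForm_comm w _).trans (e.right.frame.symm.contact₁ hl hy (X y) w hw)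
  obtain ⟨m, n, sm, sn, hmn⟩ := e.right.exists_coeff (e.smooth_σ₁.add e.symm.smooth_σ₁) e.mem
  rw [e.normal_eq hy, e.right.deriv_smul_add_smul sm sn hmn hy]
  have h1 := (lieForm_comm _ _).trans (e.right.conjugate hy)
  simp only [map_add, map_sub, map_smul, LinearMap.add_apply, LinearMap.sub_apply,
    LinearMap.smul_apply, h1, c₂ _ (e.right.frame.mem₁ hy), c₂ _ (e.right.frame.mem₂ hy),
    c₂ _ (e.right.symm.deriv_mem hy)]
  have h2 := c₂ _ (e.mem y hy)
  rw [map_add, LinearMap.add_apply] at h2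
  simp [h2]

/-- The commutator relation on `σ₁` leaves only components along `σ₁` and `ν₁`, and the unit length
of `ν₁` removes the second. The first is excluded by `g`: since `ν₁` is orthogonal to `g` and to all
`d_X ρ_i`, a nonzero component would make `σ₁` orthogonal to `g`, and a null vector orthogonal to
the null plane `g` lies in it. -/
theorem deriv_normal_X {y : M} (hy : y ∈ U) : vecDeriv (sphereNormal σ₁ Y b) y (X y) = 0 := by
  have hO := e.isOpen
  have hl := e.right.umbilicFree.legendre
  have sY := e.left.fields.smooth₂
  have sν := e.smooth_normal
  obtain ⟨Z, hZ⟩ := exists_commutator (F := R42) hO hy e.left.fields.smooth₁ sY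
  obtain ⟨z₁, z₂, rfl⟩ := e.left.fields.exists_eq hy Z
  have h1 := hZ σ₁ e.smooth_σ₁
  rw [vecDeriv_congr hO hy e.deriv₁, vecDeriv_smul hO hy _ e.smooth₁ e.smooth_σ₁,
    vecDeriv_add_vec, vecDeriv_smul_vec, vecDeriv_smul_vec, e.deriv₁ y hy, sub_eq_iff_eq_add] at h1
  obtain ⟨A, B, hAB⟩ : ∃ A B : ℝ, vecDeriv (sphereNormal σ₁ Y b) y (X y) =
      A • σ₁ y + B • sphereNormal σ₁ Y b y := by
    have h2 : vecDeriv (sphereNormal σ₁ Y b) y (X y) = _ :=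
      (vecDeriv_sub hO hy (X y) (e.smooth_σ₁.vecDeriv hO sY) (e.smooth₂.smul e.smooth_σ₁))
    rw [h2, h1, vecDeriv_smul hO hy _ e.smooth₂ e.smooth_σ₁, e.deriv₁ y hy,
      deriv_σ₁_Y (b := b) y]
    exact ⟨z₁ * a y + z₂ * b y + vecDeriv a y (Y y) - vecDeriv b y (X y), z₂ + a y, by module⟩
  have h3 := vecDeriv_lie_of_const hO hy sν sν (fun z hz => e.normal_normal hz) (X y)
  have hν := e.normal_normal hy
  have hB : B = 0 := by
    rw [hAB] at h3
    have h4 := e.normal_orthogonal_left hy _ (e.left.frame.mem₁ hy)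
    simp only [map_add, map_smul, LinearMap.add_apply, LinearMap.smul_apply, smul_eq_mul, hν, h4,
      lieForm_comm (σ₁ y)] at h3
    linarith
  rw [hB, zero_smul, add_zero] at hAB
  rw [hAB, smul_eq_zero]
  left
  by_contra hA
  have pair : ∀ (ρ : M → R42), SmoothOn ρ U → (∀ z ∈ U, ρ z ∈ g z) →
      lieForm (sphereNormal σ₁ Y b y) (vecDeriv ρ y (X y)) = 0 → lieForm (σ₁ y) (ρ y) = 0 := by
    intro ρ hρ hm h0
    have h5 := vecDeriv_lie_of_const hO hy sν hρ
      (fun z hz => e.normal_orthogonal_right hz _ (hm z hz)) (X y)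
    rw [h0, hAB, map_smul, LinearMap.smul_apply, add_zero, smul_eq_mul] at h5
    exact (mul_eq_zero.1 h5).resolve_left hA
  have p₁ := pair ρ₁ e.right.frame.smooth₁ (fun z hz => e.right.frame.mem₁ hz)
    (e.normal_orthogonal_right hy _ (e.right.deriv_mem hy))
  have p₂ := pair ρ₂ e.right.frame.smooth₂ (fun z hz => e.right.frame.mem₂ hz)
    (e.lieForm_normal_deriv hy)
  exact e.notMem₁ y hy (mem_of_orthogonal_of_nonpos (hl.subbundle.finrank_eq y) (hl.null y)
    (lieForm_zero_of_span (e.right.frame.span y hy) p₁ p₂) (e.null_left hy).1.le)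

theorem deriv_normal_Y_pairings {y : M} (hy : y ∈ U) :
    lieForm (vecDeriv (sphereNormal σ₁ Y b) y (Y y)) (sphereNormal σ₁ Y b y) = 0 ∧
    lieForm (vecDeriv (sphereNormal σ₁ Y b) y (Y y)) (σ₁ y) = -1 ∧
    lieForm (vecDeriv (sphereNormal σ₁ Y b) y (Y y)) (σ₂ y) = 0 := by
  have hO := e.isOpen
  have sν := e.smooth_normal
  have h1 := vecDeriv_lie_of_const hO hy sν sν (fun z hz => e.normal_normal hz) (Y y)
  have h2 := vecDeriv_lie_of_const hO hy sν e.smooth_σ₁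
    (fun z hz => e.normal_orthogonal_left hz _ (e.left.frame.mem₁ hz)) (Y y)
  have h3 := vecDeriv_lie_of_const hO hy sν e.symm.smooth_σ₁
    (fun z hz => e.normal_orthogonal_left hz _ (e.left.frame.mem₂ hz)) (Y y)
  rw [lieForm_comm (sphereNormal σ₁ Y b y)] at h1
  rw [deriv_σ₁_Y (σ₁ := σ₁) (b := b) y, map_add, map_smul, e.normal_normal hy,
    e.normal_orthogonal_left hy _ (e.left.frame.mem₁ hy), smul_zero] at h2
  rw [e.deriv₂ y hy, map_smul, e.normal_orthogonal_left hy _ (e.left.frame.mem₂ hy), smul_zero] at h3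
  exact ⟨by linarith, by linarith, by linarith⟩

theorem normal_normal_symm {y : M} (hy : y ∈ U) :
    lieForm (sphereNormal σ₁ Y b y) (sphereNormal σ₂ X a y) = 0 := by
  have h1 := (lieForm_comm _ _).trans (e.left.conjugate hy)
  have h2 := e.symm.normal_orthogonal_left hy _ (e.left.frame.mem₁ hy)
  have h3 := e.left.frame.contact₁ e.left.umbilicFree.legendre hy (Y y) _ (e.left.frame.mem₂ hy)
  rw [sphereNormal, map_sub, map_smul, LinearMap.sub_apply, LinearMap.smul_apply,
    lieForm_comm (σ₁ y), h2, sphereNormal, map_sub, h1, map_smul, h3]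
  simp

theorem dual_pairings {y : M} (hy : y ∈ U) :
    lieForm (σ₁ y) (sphereDual σ₁ Y b y) = -1 ∧
    lieForm (sphereNormal σ₁ Y b y) (sphereDual σ₁ Y b y) = 0 ∧
    lieForm (sphereDual σ₁ Y b y) (sphereDual σ₁ Y b y) = 0 ∧
    lieForm (sphereDual σ₁ Y b y) (σ₂ y) = 0 ∧
    lieForm (sphereDual σ₁ Y b y) (sphereNormal σ₂ X a y) = 0 := by
  obtain ⟨h1, h2, h3⟩ := e.deriv_normal_Y_pairings hy
  have h4 := vecDeriv_lie_of_const e.isOpen hy e.smooth_normal e.symm.smooth_normal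
    (fun z hz => e.normal_normal_symm hz) (Y y)
  rw [e.symm.deriv_normal_X hy, map_zero, add_zero] at h4
  have n := e.null_left hy
  have h5 := e.normal_orthogonal_left hy _ (e.left.frame.mem₁ hy)
  have h6 := (lieForm_comm _ _).trans (e.symm.normal_orthogonal_left hy _ (e.left.frame.mem₁ hy))
  have hκ : sphereCurvature σ₁ Y b y = -2⁻¹ * lieForm (vecDeriv (sphereNormal σ₁ Y b) y (Y y))
    (vecDeriv (sphereNormal σ₁ Y b) y (Y y)) := rfl
  refine ⟨?_, ?_, ?_, ?_, ?_⟩ <;>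
  simp only [sphereDual, map_sub, map_smul, LinearMap.sub_apply, LinearMap.smul_apply, smul_eq_mul,
    n.1, n.2, lieForm_comm (σ₁ y) (vecDeriv _ _ _), lieForm_comm (sphereNormal σ₁ Y b y) (vecDeriv _ _ _),
    h1, h2, h3, h4, h5, h6]
  · ring
  · ring
  -- Since `d_Y ν₁` pairs to `-1` with `σ₁`, the factor `-1/2` in `sphereCurvature` is exactly what
  -- makes the dual vector null.
  · rw [hκ]; ring
  · ring
  · ring

/-- As `d_X ν₁ = 0`, the commutator relation on `ν₁` makes `d_X d_Y ν₁` a multiple of `d_Y ν₁`.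
Pairing with `σ₁` fixes the multiple as `-a`, and nullity of the dual vector then fixes the
derivative of the curvature. -/
theorem deriv_dual_X {y : M} (hy : y ∈ U) :
    vecDeriv (sphereDual σ₁ Y b) y (X y) = -a y • sphereDual σ₁ Y b y ∧
    vecDeriv (sphereCurvature σ₁ Y b) y (X y) = -2 * a y * sphereCurvature σ₁ Y b y := by
  have hO := e.isOpen
  have sν := e.smooth_normal
  have sY := e.left.fields.smooth₂
  obtain ⟨Z, hZ⟩ := exists_commutator (F := R42) hO hy e.left.fields.smooth₁ sY
  obtain ⟨z₁, z₂, rfl⟩ := e.left.fields.exists_eq hy Z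
  have h1 := hZ _ sν
  rw [vecDeriv_congr hO hy (fun z hz => e.deriv_normal_X hz), vecDeriv_const, sub_zero,
    vecDeriv_add_vec, vecDeriv_smul_vec, vecDeriv_smul_vec, e.deriv_normal_X hy, smul_zero, zero_add,
    deriv_normal_Y] at h1
  have h2 : vecDeriv (sphereDual σ₁ Y b) y (X y) = _ :=
    vecDeriv_sub hO hy (X y) (sν.vecDeriv hO sY) (e.smooth_curvature.smul e.smooth_σ₁)
  rw [h1, vecDeriv_smul hO hy _ e.smooth_curvature e.smooth_σ₁, e.deriv₁ y hy] at h2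
  obtain ⟨d1, d2, d3, -, -⟩ := e.dual_pairings hy
  have h3 := vecDeriv_lie_of_const hO hy e.smooth_dual e.smooth_dual
    (fun z hz => (e.dual_pairings hz).2.2.1) (X y)
  have h4 := vecDeriv_lie_of_const hO hy e.smooth_dual e.smooth_σ₁
    (fun z hz => (lieForm_comm _ _).trans (e.dual_pairings hz).1) (X y)
  rw [e.deriv₁ y hy] at h4
  rw [lieForm_comm (sphereDual σ₁ Y b y)] at h3
  rw [h2] at h3 h4
  simp only [map_add, map_sub, map_smul, LinearMap.add_apply, LinearMap.sub_apply,
    LinearMap.smul_apply, smul_eq_mul, d1, d3, lieForm_comm (sphereDual σ₁ Y b y) (σ₁ y),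
    (e.null_left hy).1] at h3 h4
  have hz : z₂ = -a y := by linarith
  subst hz
  have hκ : vecDeriv (sphereCurvature σ₁ Y b) y (X y) = -2 * a y * sphereCurvature σ₁ Y b y := by
    linarith
  refine ⟨?_, hκ⟩
  rw [h2, hκ]
  module

theorem isNullFrame {y : M} (hy : y ∈ U) :
    IsNullFrame (σ₁ y) (sphereNormal σ₁ Y b y) (sphereDual σ₁ Y b y)
      (σ₂ y) (sphereNormal σ₂ X a y) (sphereDual σ₂ X a y) := by
  have e' := e.symm
  obtain ⟨d1, d2, d3, d4, d5⟩ := e.dual_pairings hy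
  obtain ⟨d1', d2', d3', d4', d5'⟩ := e'.dual_pairings hy
  have n := fun w hw => (lieForm_comm w _).trans (e.normal_orthogonal_left hy w hw)
  have n' := fun w hw => (lieForm_comm w _).trans (e'.normal_orthogonal_left hy w hw)
  have c := lieForm_comm
  refine ⟨(e.null_left hy).1, n _ (e.left.frame.mem₁ hy), d1, e.normal_normal hy, d2, d3,
    (e'.null_left hy).1, n' _ (e.left.frame.mem₂ hy), d1', e'.normal_normal hy, d2', d3',
    (e.null_left hy).2, n' _ (e.left.frame.mem₁ hy), (c _ _).trans d4',
    (c _ _).trans (n _ (e.left.frame.mem₂ hy)), e.normal_normal_symm hy, (c _ _).trans d5', d4, d5, ?_⟩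
  -- The remaining pairing of the two dual vectors comes from differentiating `(ν₁, τ₂) = 0` along
  -- `Y`, where `d_Y τ₂ = -b τ₂`.
  have h1 := vecDeriv_lie_of_const e.isOpen hy e.smooth_normal e'.smooth_dual
    (fun z hz => (c _ _).trans (e'.dual_pairings hz).2.2.2.2) (Y y)
  rw [(e'.deriv_dual_X hy).1, map_smul, (c _ _).trans d5', smul_zero, add_zero] at h1
  rw [sphereDual, map_sub, map_smul, LinearMap.sub_apply, LinearMap.smul_apply, h1, c (σ₁ y), d4',
    smul_zero, sub_zero]

/-- All six pairings of `d_Y τ₁` with the frame follow by differentiating constant scalar products,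
because the `Y`-derivatives of the other five vectors are already known. -/
theorem deriv_dual_Y {y : M} (hy : y ∈ U) :
    vecDeriv (sphereDual σ₁ Y b) y (Y y) = -b y • sphereDual σ₁ Y b y +
      sphereCurvature σ₁ Y b y • sphereNormal σ₁ Y b y := by
  have e' := e.symm
  have hO := e.isOpen
  have sτ := e.smooth_dual
  have N := e.isNullFrame hy
  have N' := N.symm
  have c := lieForm_comm
  have h1 := vecDeriv_lie_of_const hO hy sτ e.smooth_σ₁
    (fun z hz => (c _ _).trans (e.isNullFrame hz).σ₁τ₁) (Y y)
  have h2 := vecDeriv_lie_of_const hO hy sτ e.smooth_normal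
    (fun z hz => (c _ _).trans (e.isNullFrame hz).ν₁τ₁) (Y y)
  have h3 := vecDeriv_lie_of_const hO hy sτ sτ (fun z hz => (e.isNullFrame hz).τ₁τ₁) (Y y)
  have h4 := vecDeriv_lie_of_const hO hy sτ e'.smooth_σ₁
    (fun z hz => (e.isNullFrame hz).τ₁σ₂) (Y y)
  have h5 := vecDeriv_lie_of_const hO hy sτ e'.smooth_normal
    (fun z hz => (e.isNullFrame hz).τ₁ν₂) (Y y)
  have h6 := vecDeriv_lie_of_const hO hy sτ e'.smooth_dual
    (fun z hz => (e.isNullFrame hz).τ₁τ₂) (Y y)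
  rw [deriv_σ₁_Y (σ₁ := σ₁) (b := b) y, map_add, map_smul, c _ (sphereNormal σ₁ Y b y), N.ν₁τ₁, c _ (σ₁ y),
    c _ (σ₁ y), N.σ₁τ₁, smul_eq_mul] at h1
  rw [deriv_normal_Y, map_add, map_smul, N.τ₁τ₁, c _ (σ₁ y), N.σ₁τ₁, smul_eq_mul] at h2
  rw [c (sphereDual σ₁ Y b y)] at h3
  rw [e.deriv₂ y hy, map_smul, N.τ₁σ₂, smul_zero, add_zero] at h4
  rw [e'.deriv_normal_X hy, map_zero, add_zero] at h5
  rw [(e'.deriv_dual_X hy).1, map_smul, N.τ₁τ₂, smul_zero, add_zero] at h6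
  rw [c (σ₁ y)] at h1
  rw [N.eq_of_coords 0 (sphereCurvature σ₁ Y b y) (-b y) 0 0 0 (by linarith) (by linarith)
    (by linarith) (by linarith) h5 (by linarith)]
  module

end IsRibaucourFrame

end Ribaucour

theorem span_singleton_neg (v : R42) : Submodule.span ℝ {-v} = Submodule.span ℝ {v} := by
  rw [← neg_one_smul ℝ v, Submodule.span_singleton_smul_eq (by simp)]

/-! ### The transform expressed in the frame of the Dupin cyclide -/

section Adapted

variable {M : Type*} [TopologicalSpace M] [ChartedSpace (EuclideanSpace ℝ (Fin 2)) M]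
  [IsManifold (𝓡 2) ∞ M]

/-- A moving frame for a Ribaucour transform `g` of a Dupin cyclide, with its structure
equations. -/
structure AdaptedFrame (g r₁ r₂ : M → Submodule ℝ R42) (U : Set M) where
  (X Y : (x : M) → TangentSpace (𝓡 2) x)
  (σ₁ ν₁ τ₁ σ₂ ν₂ τ₂ : M → R42)
  (a b κ₁ κ₂ : M → ℝ)
  isOpen : IsOpen U
  fields : IsFieldFrame (curvatureDist g r₁) (curvatureDist g r₂) U X Y
  smooth_σ₁ : SmoothOn σ₁ U
  smooth_ν₁ : SmoothOn ν₁ U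
  smooth_τ₁ : SmoothOn τ₁ U
  smooth_σ₂ : SmoothOn σ₂ U
  smooth_ν₂ : SmoothOn ν₂ U
  smooth_τ₂ : SmoothOn τ₂ U
  smooth_a : SmoothOn a U
  smooth_b : SmoothOn b U
  smooth_κ₁ : SmoothOn κ₁ U
  smooth_κ₂ : SmoothOn κ₂ U
  gram : ∀ y ∈ U, IsNullFrame (σ₁ y) (ν₁ y) (τ₁ y) (σ₂ y) (ν₂ y) (τ₂ y)
  X_σ₁ : ∀ y ∈ U, vecDeriv σ₁ y (X y) = a y • σ₁ y
  X_ν₁ : ∀ y ∈ U, vecDeriv ν₁ y (X y) = 0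
  X_τ₁ : ∀ y ∈ U, vecDeriv τ₁ y (X y) = -a y • τ₁ y
  X_κ₁ : ∀ y ∈ U, vecDeriv κ₁ y (X y) = -2 * a y * κ₁ y
  Y_σ₁ : ∀ y ∈ U, vecDeriv σ₁ y (Y y) = ν₁ y + b y • σ₁ y
  Y_ν₁ : ∀ y ∈ U, vecDeriv ν₁ y (Y y) = τ₁ y + κ₁ y • σ₁ y
  Y_τ₁ : ∀ y ∈ U, vecDeriv τ₁ y (Y y) = -b y • τ₁ y + κ₁ y • ν₁ y
  Y_σ₂ : ∀ y ∈ U, vecDeriv σ₂ y (Y y) = b y • σ₂ y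
  Y_ν₂ : ∀ y ∈ U, vecDeriv ν₂ y (Y y) = 0
  Y_τ₂ : ∀ y ∈ U, vecDeriv τ₂ y (Y y) = -b y • τ₂ y
  Y_κ₂ : ∀ y ∈ U, vecDeriv κ₂ y (Y y) = -2 * b y * κ₂ y
  X_σ₂ : ∀ y ∈ U, vecDeriv σ₂ y (X y) = ν₂ y + a y • σ₂ y
  X_ν₂ : ∀ y ∈ U, vecDeriv ν₂ y (X y) = τ₂ y + κ₂ y • σ₂ y
  X_τ₂ : ∀ y ∈ U, vecDeriv τ₂ y (X y) = -a y • τ₂ y + κ₂ y • ν₂ y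
  span : ∀ y ∈ U, g y = Submodule.span ℝ {σ₁ y + σ₂ y, τ₁ y - τ₂ y}
  span₁ : ∀ y ∈ U, r₁ y = Submodule.span ℝ {τ₁ y - τ₂ y + κ₂ y • (σ₁ y + σ₂ y)}
  span₂ : ∀ y ∈ U, r₂ y = Submodule.span ℝ {τ₂ y - τ₁ y + κ₁ y • (σ₂ y + σ₁ y)}
  regular₁ : ∀ y ∈ U, vecDeriv κ₁ y (Y y) + 2 * b y * κ₁ y ≠ 0
  regular₂ : ∀ y ∈ U, vecDeriv κ₂ y (X y) + 2 * a y * κ₂ y ≠ 0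
  umbilicFree : ∀ y ∈ U, κ₁ y + κ₂ y ≠ 0

/-- Exchange of the two families of curvature lines. -/
def AdaptedFrame.symm {g r₁ r₂ : M → Submodule ℝ R42} {U : Set M} (e : AdaptedFrame g r₁ r₂ U) :
    AdaptedFrame g r₂ r₁ U where
  X := e.Y
  Y := e.X
  σ₁ := e.σ₂
  ν₁ := e.ν₂
  τ₁ := e.τ₂
  σ₂ := e.σ₁
  ν₂ := e.ν₁
  τ₂ := e.τ₁
  a := e.b
  b := e.a
  κ₁ := e.κ₂
  κ₂ := e.κ₁
  isOpen := e.isOpen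
  fields := e.fields.symm
  smooth_σ₁ := e.smooth_σ₂
  smooth_ν₁ := e.smooth_ν₂
  smooth_τ₁ := e.smooth_τ₂
  smooth_σ₂ := e.smooth_σ₁
  smooth_ν₂ := e.smooth_ν₁
  smooth_τ₂ := e.smooth_τ₁
  smooth_a := e.smooth_b
  smooth_b := e.smooth_a
  smooth_κ₁ := e.smooth_κ₂
  smooth_κ₂ := e.smooth_κ₁
  gram y hy := (e.gram y hy).symm
  X_σ₁ := e.Y_σ₂
  X_ν₁ := e.Y_ν₂
  X_τ₁ := e.Y_τ₂
  X_κ₁ := e.Y_κ₂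
  Y_σ₁ := e.X_σ₂
  Y_ν₁ := e.X_ν₂
  Y_τ₁ := e.X_τ₂
  Y_σ₂ := e.X_σ₁
  Y_ν₂ := e.X_ν₁
  Y_τ₂ := e.X_τ₁
  Y_κ₂ := e.X_κ₁
  X_σ₂ := e.Y_σ₁
  X_ν₂ := e.Y_ν₁
  X_τ₂ := e.Y_τ₁
  span y hy := by
    rw [e.span y hy, add_comm (e.σ₂ y), ← neg_sub (e.τ₁ y) (e.τ₂ y), Submodule.span_insert,
      Submodule.span_insert, span_singleton_neg]
  span₁ := e.span₂
  span₂ := e.span₁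
  regular₁ := e.regular₂
  regular₂ := e.regular₁
  umbilicFree y hy := by rw [add_comm]; exact e.umbilicFree y hy

namespace IsRibaucourFrame

variable {f s₁ s₂ g r₁ r₂ : M → Submodule ℝ R42} {U : Set M}
  {σ₁ σ₂ ρ₁ ρ₂ : M → R42} {X Y : (x : M) → TangentSpace (𝓡 2) x} {a b : M → ℝ}
  (e : IsRibaucourFrame f s₁ s₂ g r₁ r₂ U σ₁ σ₂ ρ₁ ρ₂ X Y a b)
include e

/-- `g` is a null plane orthogonal to `ν₁` and `ν₂` that contains `σ₁ + σ₂` but not `σ₁`. A second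
generator has no `ν`-components and opposite `τ`-components. Nullity together with `σ₁ ∉ g` makes
its `σ`-components equal, so it can be reduced to `τ₁ - τ₂`. -/
theorem span_eq {y : M} (hy : y ∈ U) :
    g y = Submodule.span ℝ {σ₁ y + σ₂ y, sphereDual σ₁ Y b y - sphereDual σ₂ X a y} := by
  have N := e.isNullFrame hy
  have hl := e.right.umbilicFree.legendre
  have h2 := hl.subbundle.finrank_eq y
  have hm := e.mem y hy
  have ind : Indep (σ₁ y + σ₂ y) (sphereDual σ₁ Y b y - sphereDual σ₂ X a y) := by
    intro c d hcd
    obtain ⟨k1, -, k3, -⟩ := N.coords c 0 d c 0 (-d) (v := 0) (by rw [← hcd]; module)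
    simp only [map_zero, LinearMap.zero_apply] at k1 k3
    exact ⟨by linarith, by linarith⟩
  refine ind.eq_span h2 hm ?_
  obtain ⟨γ, hγ, hγ'⟩ : ∃ γ ∈ g y, γ ∉ Submodule.span ℝ {σ₁ y + σ₂ y} := by
    by_contra! hcon
    have h3 := Submodule.finrank_mono (show g y ≤ _ from hcon)
    have h4 := finrank_span_singleton (K := ℝ) ind.left_ne_zero
    omega
  obtain ⟨x₁, y₁, z₁, x₂, y₂, z₂, hv⟩ := N.exists_coords γ
  obtain ⟨k1, k2, k3, k4, k5, k6⟩ := N.coords _ _ _ _ _ _ hv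
  have n1 := e.normal_orthogonal_right hy γ hγ
  have n2 := e.symm.normal_orthogonal_right hy γ hγ
  rw [lieForm_comm, k2] at n1
  rw [lieForm_comm, k5] at n2
  have h0 := hl.null y γ hγ _ hm
  rw [map_add, k1, k4] at h0
  have hγγ := hl.null y γ hγ γ hγ
  rw [N.lieForm_eq _ _ _ _ _ _ γ hv, k1, k2, k3, k4, k5, k6, n1, n2] at hγγ
  subst n1 n2
  obtain rfl : z₂ = -z₁ := by linarith
  have h5 : z₁ * (x₁ - x₂) = 0 := by linarith
  rcases mul_eq_zero.1 h5 with h6 | h6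
  · subst h6
    have h7 : (x₁ - x₂) • σ₁ y ∈ g y := by
      have := (g y).sub_mem hγ ((g y).smul_mem x₂ hm)
      rw [hv] at this
      convert this using 1
      module
    have h8 : x₁ - x₂ = 0 := by
      by_contra hne
      exact e.notMem₁ y hy (((g y).smul_mem_iff hne).1 h7)
    refine absurd (Submodule.mem_span_singleton.2 ⟨x₂, ?_⟩) hγ'
    rw [hv, show x₁ = x₂ by linarith]
    module
  · have hz : z₁ ≠ 0 := by
      rintro rfl
      refine hγ' (Submodule.mem_span_singleton.2 ⟨x₂, ?_⟩)
      rw [hv, show x₁ = x₂ by linarith]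
      module
    rw [← (g y).smul_mem_iff hz]
    have := (g y).sub_mem hγ ((g y).smul_mem x₂ hm)
    rw [hv, show x₁ = x₂ by linarith] at this
    convert this using 1
    module

theorem curvatureSphere_ne_zero {y : M} (hy : y ∈ U) :
    sphereDual σ₁ Y b y - sphereDual σ₂ X a y + sphereCurvature σ₂ X a y • (σ₁ y + σ₂ y) ≠ 0 := by
  intro h
  obtain ⟨k1, -⟩ := (e.isNullFrame hy).coords (sphereCurvature σ₂ X a y) 0 1
    (sphereCurvature σ₂ X a y) 0 (-1) (v := 0) (by rw [← h]; module)
  simp at k1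

theorem smooth_curvatureSphere : SmoothOn (fun y => sphereDual σ₁ Y b y - sphereDual σ₂ X a y +
    sphereCurvature σ₂ X a y • (σ₁ y + σ₂ y)) U :=
  (e.smooth_dual.sub e.symm.smooth_dual).add
    (e.symm.smooth_curvature.smul (e.smooth_σ₁.add e.symm.smooth_σ₁))

theorem deriv_curvatureSphere {y : M} (hy : y ∈ U) :
    vecDeriv (fun y => sphereDual σ₁ Y b y - sphereDual σ₂ X a y +
      sphereCurvature σ₂ X a y • (σ₁ y + σ₂ y)) y (X y) =
    -a y • (sphereDual σ₁ Y b y - sphereDual σ₂ X a y +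
      sphereCurvature σ₂ X a y • (σ₁ y + σ₂ y)) +
    (vecDeriv (sphereCurvature σ₂ X a) y (X y) + 2 * a y * sphereCurvature σ₂ X a y) •
      (σ₁ y + σ₂ y) := by
  have hO := e.isOpen
  have s0 := e.smooth_σ₁.add e.symm.smooth_σ₁
  rw [vecDeriv_add hO hy _ (e.smooth_dual.sub e.symm.smooth_dual) (e.symm.smooth_curvature.smul s0),
    vecDeriv_sub hO hy _ e.smooth_dual e.symm.smooth_dual,
    vecDeriv_smul hO hy _ e.symm.smooth_curvature s0,
    vecDeriv_add hO hy _ e.smooth_σ₁ e.symm.smooth_σ₁, e.deriv₁ y hy, (e.deriv_dual_X hy).1,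
    e.symm.deriv_dual_Y hy, deriv_σ₁_Y (σ₁ := σ₂) (b := a) y]
  module

theorem curvatureSphere_mem {y : M} (hy : y ∈ U) :
    sphereDual σ₁ Y b y - sphereDual σ₂ X a y + sphereCurvature σ₂ X a y • (σ₁ y + σ₂ y) ∈ g y := by
  rw [e.span_eq hy]
  exact Submodule.add_mem _ (Submodule.subset_span (by simp))
    (Submodule.smul_mem _ _ (Submodule.subset_span (by simp)))

/-- The `X`-derivative of the displayed section stays in `g`, its `ν₂`-terms cancelling. A component
along `ρ₂` would put `d_X ρ₂` into `g`, which is impossible. -/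
theorem span₁_eq {y : M} (hy : y ∈ U) : r₁ y = Submodule.span ℝ
    {sphereDual σ₁ Y b y - sphereDual σ₂ X a y + sphereCurvature σ₂ X a y • (σ₁ y + σ₂ y)} := by
  obtain ⟨c, d, sc, sd, hcd⟩ := e.right.exists_coeff e.smooth_curvatureSphere
    (fun y hy => e.curvatureSphere_mem hy)
  have h1 := e.right.deriv_smul_add_smul sc sd hcd hy (X y)
  rw [e.deriv_curvatureSphere hy] at h1
  have hd : d y = 0 := by
    by_contra hne
    refine e.right.deriv_notMem hy (((g y).smul_mem_iff hne).1 ?_)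
    have h2 : d y • vecDeriv ρ₂ y (X y) = _ := (sub_eq_of_eq_add' (h1.trans (add_assoc _ _ _).symm)).symm
    rw [h2]
    refine Submodule.sub_mem _ (Submodule.add_mem _ (Submodule.smul_mem _ _ (e.curvatureSphere_mem hy))
      (Submodule.smul_mem _ _ (e.mem y hy))) (Submodule.add_mem _ (Submodule.add_mem _
        (Submodule.smul_mem _ _ (e.right.frame.mem₁ hy))
        (Submodule.smul_mem _ _ (e.right.deriv_mem hy)))
        (Submodule.smul_mem _ _ (e.right.frame.mem₂ hy)))
  have h3 := hcd y hy
  have h0 := e.curvatureSphere_ne_zero hy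
  rw [hd, zero_smul, add_zero] at h3
  have hc : c y ≠ 0 := by
    intro hc
    rw [hc, zero_smul] at h3
    exact h0 h3
  rw [h3, Submodule.span_singleton_smul_eq (IsUnit.mk0 _ hc), e.right.frame.span₁ y hy]

/-- This is the coefficient of `σ₁ + σ₂` in the `X`-derivative of the curvature sphere; its
vanishing would keep that derivative inside `r₁`. -/
theorem regular (hg : IsRegular g r₁ r₂) {y : M} (hy : y ∈ U) :
    vecDeriv (sphereCurvature σ₂ X a) y (X y) + 2 * a y * sphereCurvature σ₂ X a y ≠ 0 := by
  intro h
  have h1 := e.deriv_curvatureSphere hy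
  rw [h, zero_smul, add_zero] at h1
  refine (e.left.fields.indep y hy).left_ne_zero (hg.immerses₁ y (X y) fun V τ hτ => ?_)
  refine dAlong_mem_of_frame e.isOpen hy e.smooth_curvatureSphere
    (fun z hz => ⟨e.curvatureSphere_ne_zero hz, e.span₁_eq hz⟩) ?_ hτ
  rw [h1, e.span₁_eq hy]
  exact Submodule.smul_mem _ _ (Submodule.mem_span_singleton_self _)

/-- If the sum vanished, the two curvature spheres of `g` would have generators that differ only by
sign. -/
theorem curvature_add_ne_zero {y : M} (hy : y ∈ U) :
    sphereCurvature σ₁ Y b y + sphereCurvature σ₂ X a y ≠ 0 := by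
  intro h
  have h1 := e.span₁_eq hy
  have h2 := e.symm.span₁_eq hy
  have h3 : sphereDual σ₂ X a y - sphereDual σ₁ Y b y + sphereCurvature σ₁ Y b y • (σ₂ y + σ₁ y) =
      -(sphereDual σ₁ Y b y - sphereDual σ₂ X a y + sphereCurvature σ₂ X a y • (σ₁ y + σ₂ y)) := by
    rw [eq_neg_of_add_eq_zero_left h]; module
  rw [h3, span_singleton_neg, ← h1] at h2
  have h4 := e.right.umbilicFree.disjoint y
  rw [h2, disjoint_self, h1, Submodule.span_singleton_eq_bot] at h4
  exact e.curvatureSphere_ne_zero hy h4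

/-- The adapted frame of a regular Ribaucour transform of a Dupin cyclide. -/
noncomputable def adaptedFrame (hg : IsRegular g r₁ r₂) : AdaptedFrame g r₁ r₂ U where
  X := X
  Y := Y
  σ₁ := σ₁
  ν₁ := sphereNormal σ₁ Y b
  τ₁ := sphereDual σ₁ Y b
  σ₂ := σ₂
  ν₂ := sphereNormal σ₂ X a
  τ₂ := sphereDual σ₂ X a
  a := a
  b := b
  κ₁ := sphereCurvature σ₁ Y b
  κ₂ := sphereCurvature σ₂ X a
  isOpen := e.isOpen
  fields := e.right.fields
  smooth_σ₁ := e.smooth_σ₁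
  smooth_ν₁ := e.smooth_normal
  smooth_τ₁ := e.smooth_dual
  smooth_σ₂ := e.symm.smooth_σ₁
  smooth_ν₂ := e.symm.smooth_normal
  smooth_τ₂ := e.symm.smooth_dual
  smooth_a := e.smooth₁
  smooth_b := e.smooth₂
  smooth_κ₁ := e.smooth_curvature
  smooth_κ₂ := e.symm.smooth_curvature
  gram _ hy := e.isNullFrame hy
  X_σ₁ := e.deriv₁
  X_ν₁ _ hy := e.deriv_normal_X hy
  X_τ₁ _ hy := (e.deriv_dual_X hy).1
  X_κ₁ _ hy := (e.deriv_dual_X hy).2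
  Y_σ₁ y _ := deriv_σ₁_Y y
  Y_ν₁ y _ := deriv_normal_Y y
  Y_τ₁ _ hy := e.deriv_dual_Y hy
  Y_σ₂ := e.deriv₂
  Y_ν₂ _ hy := e.symm.deriv_normal_X hy
  Y_τ₂ _ hy := (e.symm.deriv_dual_X hy).1
  Y_κ₂ _ hy := (e.symm.deriv_dual_X hy).2
  X_σ₂ y _ := deriv_σ₁_Y y
  X_ν₂ y _ := deriv_normal_Y y
  X_τ₂ _ hy := e.symm.deriv_dual_Y hy
  span _ hy := e.span_eq hy
  span₁ _ hy := e.span₁_eq hy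
  span₂ _ hy := e.symm.span₁_eq hy
  regular₁ _ hy := e.symm.regular hg.symm hy
  regular₂ _ hy := e.regular hg hy
  umbilicFree _ hy := e.curvature_add_ne_zero hy

end IsRibaucourFrame

theorem exists_adaptedFrame {f s₁ s₂ g r₁ r₂ : M → Submodule ℝ R42} (hf : IsDupinCyclide f s₁ s₂)
    (hg : IsRegular g r₁ r₂) (hfg : IsRibaucourPair f s₁ s₂ g r₁ r₂) (x : M) :
    ∃ U, x ∈ U ∧ Nonempty (AdaptedFrame g r₁ r₂ U) := by
  obtain ⟨U, hx, σ₁, σ₂, ρ₁, ρ₂, X, Y, a, b, e⟩ := exists_ribaucourFrame hf hg hfg x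
  exact ⟨U, hx, ⟨e.adaptedFrame hg⟩⟩

end Adapted

/-! ### Lie cyclides, osculating complexes and osculating bundles -/

section Osculating

variable {M : Type*} [TopologicalSpace M] [ChartedSpace (EuclideanSpace ℝ (Fin 2)) M]
  [IsManifold (𝓡 2) ∞ M]

/-- One neighbourhood, a chart ball, serves all maps `φ` at once. This uniformity is needed when a
whole family of projections is shown to be constant. -/
theorem exists_nhds_const {U : Set M} (hU : IsOpen U) {x : M} (hx : x ∈ U) :
    ∃ V ⊆ U, IsOpen V ∧ x ∈ V ∧ ∀ φ : M → R42, SmoothOn φ U →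
      (∀ y ∈ U, ∀ Z : TangentSpace (𝓡 2) y, vecDeriv φ y Z = 0) → ∀ y ∈ V, φ y = φ x := by
  set e := extChartAt (𝓡 2) x with he
  have hxs : x ∈ e.source := mem_extChartAt_source x
  have hO : IsOpen (e.target ∩ e.symm ⁻¹' U) :=
    (continuousOn_extChartAt_symm x).isOpen_inter_preimage (isOpen_extChartAt_target x) hU
  obtain ⟨r, hr, hB⟩ := Metric.isOpen_iff.1 hO (e x)
    ⟨e.map_source hxs, by rw [Set.mem_preimage, e.left_inv hxs]; exact hx⟩
  refine ⟨e.source ∩ e ⁻¹' Metric.ball (e x) r, ?_,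
    (continuousOn_extChartAt x).isOpen_inter_preimage (isOpen_extChartAt_source x) Metric.isOpen_ball,
    ⟨hxs, Metric.mem_ball_self hr⟩, fun φ hφ h0 y hy => ?_⟩
  · rintro y ⟨hy, hy'⟩
    have := (hB hy').2
    rwa [Set.mem_preimage, e.left_inv hy] at this
  · have hc := contDiffOn_comp_chart_symm x hφ
    have hz : ∀ z ∈ Metric.ball (e x) r, fderiv ℝ (φ ∘ e.symm) z = 0 := by
      intro z hz
      have hz' := hB hz
      have hs : e.symm z ∈ e.source := e.map_target hz'.1
      ext1 w
      obtain ⟨Z, hZ⟩ : ∃ Z : TangentSpace (𝓡 2) (e.symm z), vecDeriv e (e.symm z) Z = w :=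
        (isInvertible_mfderiv_extChartAt hs).bijective.surjective w
      have h1 := vecDeriv_eq_fderiv_chart hU hφ x hz'.2 hs Z
      rw [h0 _ hz'.2, ← he, hZ, e.right_inv hz'.1] at h1
      exact h1.symm
    have h2 := IsOpen.is_const_of_fderiv_eq_zero (𝕜 := ℝ) Metric.isOpen_ball
      (convex_ball (e x) r).isPreconnected
      ((hc.mono hB).differentiableOn (by simp)) hz hy.2 (Metric.mem_ball_self hr)
    rwa [Function.comp_apply, Function.comp_apply, e.left_inv hy.1, e.left_inv hxs] at h2

variable {g r₁ r₂ E : M → Submodule ℝ R42} {U : Set M}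

/-- The second jet is defined by all sections and all fields. Rescaling either only adds
combinations of lower derivatives, so a bound on one frame `η`, `Y` bounds every choice. -/
theorem secondJet_le {T : (x : M) → Submodule ℝ (TangentSpace (𝓡 2) x)}
    {Y : (x : M) → TangentSpace (𝓡 2) x} {η θ : M → R42} (hU : IsOpen U)
    (hη : SmoothOn η U) (hθ : SmoothOn θ U) (hE : ∀ y ∈ U, E y = Submodule.span ℝ {η y})
    (hT : ∀ y ∈ U, T y = Submodule.span ℝ {Y y}) (hi : ∀ y ∈ U, Indep (η y) (θ y))
    (hD : ∀ y ∈ U, vecDeriv η y (Y y) ∈ Submodule.span ℝ {η y, θ y})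
    {x : M} (hx : x ∈ U) {S : Submodule ℝ R42} (h₁ : η x ∈ S) (h₂ : θ x ∈ S)
    (h₃ : vecDeriv θ x (Y x) ∈ S) : secondJet E T x ≤ S := by
  have h₄ : vecDeriv η x (Y x) ∈ S := by
    obtain ⟨a, b, hab⟩ := Submodule.mem_span_pair.1 (hD x hx)
    rw [← hab]
    exact S.add_mem (S.smul_mem _ h₁) (S.smul_mem _ h₂)
  refine Submodule.span_le.2 ?_
  rintro v ⟨V, σ, W, hσ, hW, hv⟩
  have hO := hU.inter hσ.isOpen
  have hxO : x ∈ U ∩ V := ⟨hx, hσ.mem⟩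
  have hη' := hη.mono (Set.inter_subset_left (t := V))
  have hθ' := hθ.mono (Set.inter_subset_left (t := V))
  have hσ' : SmoothOn σ (U ∩ V) := SmoothOn.mono hσ.smooth Set.inter_subset_right
  have hW' : SmoothFieldOn W (U ∩ V) := ContMDiffOn.mono hW.smooth Set.inter_subset_right
  have hWY : ∀ y ∈ U ∩ V, ∃ t : ℝ, W y = t • Y y := by
    intro y hy
    have := hW.mem_fiber y hy.2
    rw [hT y hy.1] at this
    obtain ⟨t, ht⟩ := Submodule.mem_span_singleton.1 this
    exact ⟨t, ht.symm⟩
  obtain ⟨c, hc, hcσ⟩ := exists_smooth_coeff hη' hσ' (fun y hy => (hi y hy.1).left_ne_zero)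
    (fun y hy => hE y hy.1 ▸ hσ.mem_fiber y hy.2)
  have hd : ∀ y ∈ U ∩ V, vecDeriv σ y (W y) ∈ Submodule.span ℝ {η y, θ y} := by
    intro y hy
    obtain ⟨t, ht⟩ := hWY y hy
    rw [vecDeriv_congr hO hy hcσ, vecDeriv_smul hO hy _ hc hη', ht, vecDeriv_smul_vec,
      vecDeriv_smul_vec]
    exact Submodule.add_mem _ (Submodule.smul_mem _ _ (Submodule.subset_span (by simp)))
      (Submodule.smul_mem _ _ (Submodule.smul_mem _ _ (hD y hy.1)))
  rcases hv with rfl | rfl | rfl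
  · rw [hcσ x hxO]; exact S.smul_mem _ h₁
  · obtain ⟨a, b, hab⟩ := Submodule.mem_span_pair.1 (hd x hxO)
    rw [dAlong_eq_vecDeriv, ← hab]
    exact S.add_mem (S.smul_mem _ h₁) (S.smul_mem _ h₂)
  · obtain ⟨p, q, hp, hq, hpq⟩ := exists_smooth_coeff₂ hη' hθ' (hσ'.vecDeriv hO hW')
      (fun y hy => hi y hy.1) hd
    obtain ⟨t, ht⟩ := hWY x hxO
    change vecDeriv (fun y => vecDeriv σ y (W y)) x (W x) ∈ S
    rw [vecDeriv_congr hO hxO hpq, vecDeriv_add hO hxO _ (hp.smul hη') (hq.smul hθ'),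
      vecDeriv_smul hO hxO _ hp hη', vecDeriv_smul hO hxO _ hq hθ', ht]
    simp only [vecDeriv_smul_vec]
    exact S.add_mem (S.add_mem (S.smul_mem _ h₁) (S.smul_mem _ (S.smul_mem _ h₄)))
      (S.add_mem (S.smul_mem _ h₂) (S.smul_mem _ (S.smul_mem _ h₃)))

theorem mem_secondJet {T : (x : M) → Submodule ℝ (TangentSpace (𝓡 2) x)}
    {Y : (x : M) → TangentSpace (𝓡 2) x} {η : M → R42} (hU : IsOpen U)
    (hη : SmoothOn η U) (hE : ∀ y ∈ U, E y = Submodule.span ℝ {η y})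
    (hY : SmoothFieldOn Y U) (hT : ∀ y ∈ U, Y y ∈ T y) {x : M} (hx : x ∈ U) :
    η x ∈ secondJet E T x ∧ vecDeriv η x (Y x) ∈ secondJet E T x ∧
    vecDeriv (fun y => vecDeriv η y (Y y)) x (Y x) ∈ secondJet E T x := by
  have hs : IsSectionNear E x U η :=
    ⟨hU, hx, hη, fun y hy => hE y hy ▸ Submodule.mem_span_singleton_self _⟩
  have hf : IsFieldOn T U Y := ⟨hY, hT⟩
  exact ⟨Submodule.subset_span ⟨U, η, Y, hs, hf, Or.inl rfl⟩,
    Submodule.subset_span ⟨U, η, Y, hs, hf, Or.inr (Or.inl rfl)⟩,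
    Submodule.subset_span ⟨U, η, Y, hs, hf, Or.inr (Or.inr rfl)⟩⟩

namespace AdaptedFrame

variable (e : AdaptedFrame g r₁ r₂ U)

/-- The common sphere congruence. -/
def σ₀ (y : M) : R42 := e.σ₁ y + e.σ₂ y

/-- The first curvature sphere of `g`. -/
def ρ (y : M) : R42 := e.τ₁ y - e.τ₂ y + e.κ₂ y • (e.σ₁ y + e.σ₂ y)

/-- The derivative of `ν₁` along `Y`. -/
def μ (y : M) : R42 := e.τ₁ y + e.κ₁ y • e.σ₁ y

theorem smooth_ρ : SmoothOn e.ρ U :=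
  (e.smooth_τ₁.sub e.smooth_τ₂).add (e.smooth_κ₂.smul (e.smooth_σ₁.add e.smooth_σ₂))

theorem smooth_μ : SmoothOn e.μ U := e.smooth_τ₁.add (e.smooth_κ₁.smul e.smooth_σ₁)

variable {y : M} (hy : y ∈ U)
include hy

theorem deriv_ρ_Y : vecDeriv e.ρ y (e.Y y) = -e.b y • e.ρ y + (e.κ₁ y + e.κ₂ y) • e.ν₁ y := by
  have hO := e.isOpen
  have s0 := e.smooth_σ₁.add e.smooth_σ₂
  have h : vecDeriv e.ρ y (e.Y y) = _ :=
    vecDeriv_add hO hy (e.Y y) (e.smooth_τ₁.sub e.smooth_τ₂) (e.smooth_κ₂.smul s0)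
  rw [h, vecDeriv_sub hO hy _ e.smooth_τ₁ e.smooth_τ₂, vecDeriv_smul hO hy _ e.smooth_κ₂ s0,
    vecDeriv_add hO hy _ e.smooth_σ₁ e.smooth_σ₂, e.Y_τ₁ y hy, e.Y_τ₂ y hy, e.Y_κ₂ y hy,
    e.Y_σ₁ y hy, e.Y_σ₂ y hy, ρ]
  module

theorem deriv_ρ_X : vecDeriv e.ρ y (e.X y) = -e.a y • e.ρ y +
    (vecDeriv e.κ₂ y (e.X y) + 2 * e.a y * e.κ₂ y) • e.σ₀ y := by
  have hO := e.isOpen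
  have s0 := e.smooth_σ₁.add e.smooth_σ₂
  have h : vecDeriv e.ρ y (e.X y) = _ :=
    vecDeriv_add hO hy (e.X y) (e.smooth_τ₁.sub e.smooth_τ₂) (e.smooth_κ₂.smul s0)
  rw [h, vecDeriv_sub hO hy _ e.smooth_τ₁ e.smooth_τ₂, vecDeriv_smul hO hy _ e.smooth_κ₂ s0,
    vecDeriv_add hO hy _ e.smooth_σ₁ e.smooth_σ₂, e.X_τ₁ y hy, e.X_τ₂ y hy,
    e.X_σ₁ y hy, e.X_σ₂ y hy, ρ, σ₀]
  module

theorem deriv_μ_Y : vecDeriv e.μ y (e.Y y) = -e.b y • e.μ y + (2 * e.κ₁ y) • e.ν₁ y +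
    (vecDeriv e.κ₁ y (e.Y y) + 2 * e.b y * e.κ₁ y) • e.σ₁ y := by
  have hO := e.isOpen
  have h : vecDeriv e.μ y (e.Y y) = _ :=
    vecDeriv_add hO hy (e.Y y) e.smooth_τ₁ (e.smooth_κ₁.smul e.smooth_σ₁)
  rw [h, vecDeriv_smul hO hy _ e.smooth_κ₁ e.smooth_σ₁, e.Y_τ₁ y hy, e.Y_σ₁ y hy, μ]
  module

theorem deriv_ν_Y : vecDeriv e.ν₁ y (e.Y y) = e.μ y := e.Y_ν₁ y hy

theorem coords_ρ : lieForm (e.ρ y) (e.σ₁ y) = -1 ∧ lieForm (e.ρ y) (e.ν₁ y) = 0 ∧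
    lieForm (e.ρ y) (e.τ₁ y) = -e.κ₂ y ∧ lieForm (e.ρ y) (e.σ₂ y) = 1 ∧
    lieForm (e.ρ y) (e.ν₂ y) = 0 ∧ lieForm (e.ρ y) (e.τ₂ y) = -e.κ₂ y := by
  simpa using (e.gram y hy).coords (e.κ₂ y) 0 1 (e.κ₂ y) 0 (-1) (v := e.ρ y) (by rw [ρ]; module)

theorem coords_μ : lieForm (e.μ y) (e.σ₁ y) = -1 ∧ lieForm (e.μ y) (e.ν₁ y) = 0 ∧
    lieForm (e.μ y) (e.τ₁ y) = -e.κ₁ y ∧ lieForm (e.μ y) (e.σ₂ y) = 0 ∧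
    lieForm (e.μ y) (e.ν₂ y) = 0 ∧ lieForm (e.μ y) (e.τ₂ y) = 0 := by
  simpa using (e.gram y hy).coords (e.κ₁ y) 0 1 0 0 0 (v := e.μ y) (by rw [μ]; module)

theorem indep_ρ_ν : Indep (e.ρ y) (e.ν₁ y) := by
  intro c d hcd
  have N := e.gram y hy
  obtain ⟨k1, k2, -⟩ := e.coords_ρ hy
  have h1 := congrArg (fun v => lieForm v (e.σ₁ y)) hcd
  have h2 := congrArg (fun v => lieForm v (e.ν₁ y)) hcd
  simp [k1, k2, N.ν₁ν₁, lieForm_comm (e.ν₁ y), N.σ₁ν₁] at h1 h2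
  exact ⟨h1, h2⟩

theorem indep_ν_μ : Indep (e.ν₁ y) (e.μ y) := by
  intro c d hcd
  have N := e.gram y hy
  obtain ⟨k1, k2, -⟩ := e.coords_μ hy
  have h1 := congrArg (fun v => lieForm v (e.σ₁ y)) hcd
  have h2 := congrArg (fun v => lieForm v (e.ν₁ y)) hcd
  simp [k1, k2, N.ν₁ν₁, lieForm_comm (e.ν₁ y), N.σ₁ν₁] at h1 h2
  exact ⟨h2, h1⟩

/-- Modulo `ρ`, the first derivative is `(κ₁ + κ₂) ν₁`; modulo `ρ` and `ν₁`, the second is `(κ₁ +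
κ₂) μ`. The factor never vanishes since the curvature spheres are distinct. -/
theorem lieCyclide_eq :
    lieCyclide g r₁ r₂ y = Submodule.span ℝ {e.ρ y, e.ν₁ y, e.μ y} := by
  have hO := e.isOpen
  apply le_antisymm
  · refine secondJet_le hO e.smooth_ρ e.smooth_ν₁ e.span₁ e.fields.span₂
      (fun z hz => e.indep_ρ_ν hz) (fun z hz => ?_) hy (Submodule.subset_span (by simp))
      (Submodule.subset_span (by simp)) ?_
    · rw [e.deriv_ρ_Y hz]
      exact Submodule.add_mem _ (Submodule.smul_mem _ _ (Submodule.subset_span (by simp)))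
        (Submodule.smul_mem _ _ (Submodule.subset_span (by simp)))
    · rw [e.deriv_ν_Y hy]; exact Submodule.subset_span (by simp)
  · obtain ⟨h1, h2, h3⟩ := mem_secondJet (T := curvatureDist g r₂) hO e.smooth_ρ e.span₁
      e.fields.smooth₂ (fun z hz => e.fields.mem₂ hz) hy
    change _ ≤ secondJet r₁ (curvatureDist g r₂) y
    set S := secondJet r₁ (curvatureDist g r₂) y
    rw [e.deriv_ρ_Y hy] at h2
    have hν : e.ν₁ y ∈ S := by
      rw [← S.smul_mem_iff (e.umbilicFree y hy)]
      exact (S.add_mem_iff_right (S.smul_mem _ h1)).1 h2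
    have hμ : e.μ y ∈ S := by
      have sκ := e.smooth_κ₁.add e.smooth_κ₂
      rw [vecDeriv_congr hO hy (fun z hz => e.deriv_ρ_Y hz),
        vecDeriv_add hO hy _ (e.smooth_b.neg.smul e.smooth_ρ) (sκ.smul e.smooth_ν₁),
        vecDeriv_smul hO hy _ e.smooth_b.neg e.smooth_ρ, vecDeriv_smul hO hy _ sκ e.smooth_ν₁,
        e.deriv_ν_Y hy, e.deriv_ρ_Y hy] at h3
      rw [← S.smul_mem_iff (e.umbilicFree y hy)]
      refine (S.add_mem_iff_right (S.smul_mem _ hν)).1 ((S.add_mem_iff_right ?_).1 h3)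
      exact S.add_mem (S.smul_mem _ h1) (S.smul_mem _ h2)
    rw [Submodule.span_le]
    rintro v (rfl | rfl | rfl)
    · exact h1
    · exact hν
    · exact hμ

theorem osculatingComplex_eq : osculatingComplex g r₁ r₂ y = Submodule.span ℝ {e.ν₁ y} := by
  have hO := e.isOpen
  have N := e.gram y hy
  apply le_antisymm
  · refine Submodule.span_le.2 ?_
    rintro ξ ⟨hξ, V, τ, hτ, rfl, hX⟩
    have hO' := hO.inter hτ.isOpen
    have hyV : y ∈ U ∩ V := ⟨hy, hτ.mem⟩
    have mem : ∀ z ∈ U ∩ V, τ z ∈ Submodule.span ℝ {e.ρ z, e.ν₁ z, e.μ z} := fun z hz =>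
      e.lieCyclide_eq hz.1 ▸ hτ.mem_fiber z hz.2
    -- `e.symm.μ` lies in the other Lie cyclide, and orthogonality to this one vector is enough to
    -- detect a `ρ`-component.
    have orth : ∀ z ∈ U, ∀ v ∈ Submodule.span ℝ {e.ρ z, e.ν₁ z, e.μ z},
        lieForm v (e.symm.μ z) = 0 := by
      intro z hz v hv
      obtain ⟨α, β, γ, rfl⟩ := Submodule.mem_span_triple.1 hv
      obtain ⟨-, -, -, k4, -, k6⟩ := e.coords_ρ hz
      obtain ⟨-, -, -, l4, -, l6⟩ := e.coords_μ hz
      have N := e.gram z hz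
      change lieForm _ (e.τ₂ z + e.κ₂ z • e.σ₂ z) = 0
      simp [k4, k6, l4, l6, N.ν₁σ₂, N.ν₁τ₂]
    have h1 := vecDeriv_lie_of_const hO' hyV
      (SmoothOn.mono hτ.smooth (Set.inter_subset_right (s := U)))
      (e.symm.smooth_μ.mono Set.inter_subset_left) (fun z hz => orth z hz.1 _ (mem z hz)) (e.X y)
    have h2 := hX _ (e.fields.mem₁ hy)
    rw [e.lieCyclide_eq hy] at h2
    obtain ⟨α, β, γ, hξ'⟩ := Submodule.mem_span_triple.1 (mem y hyV)
    obtain ⟨k1, k2, k3, k4, k5, k6⟩ := e.coords_ρ hy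
    obtain ⟨l1, l2, l3, l4, l5, l6⟩ := e.coords_μ hy
    have hγ : γ = 0 := by
      have h3 := hξ (e.σ₁ y + e.σ₂ y) (by rw [e.span y hy]; exact Submodule.subset_span (by simp))
      rw [← hξ'] at h3
      simp [k1, k4, l1, l4, N.ν₁σ₂, lieForm_comm (e.ν₁ y) (e.σ₁ y), N.σ₁ν₁] at h3
      exact h3
    -- Since `d_X τ` stays in the Lie cyclide, differentiating `(τ, e.symm.μ) = 0` gives `(ξ, d_X
    -- e.symm.μ) = 0`. By `deriv_μ_Y` for the exchanged frame, this is `α` times a factor that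
    -- regularity keeps nonzero.
    have hα : α = 0 := by
      have h4 := orth y hy _ h2
      rw [dAlong_eq_vecDeriv] at h4
      have h5 : vecDeriv e.symm.μ y (e.X y) = _ := e.symm.deriv_μ_Y hy
      rw [h4, h5, zero_add, map_add, map_add, map_smul, map_smul, map_smul,
        orth y hy _ (mem y hyV), ← hξ', hγ] at h1
      change _ + (2 * e.κ₂ y) • lieForm _ (e.ν₂ y) +
        (vecDeriv e.κ₂ y (e.X y) + 2 * e.a y * e.κ₂ y) • lieForm _ (e.σ₂ y) = 0 at h1
      simp [k4, k5, N.ν₁σ₂, N.ν₁ν₂] at h1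
      exact h1.resolve_left (e.regular₂ y hy)
    rw [← hξ', hα, hγ, zero_smul, zero_smul, zero_add, add_zero]
    exact Submodule.smul_mem _ _ (Submodule.mem_span_singleton_self _)
  · rw [Submodule.span_singleton_le_iff_mem]
    refine Submodule.subset_span ⟨?_, U, e.ν₁, ⟨hO, hy, e.smooth_ν₁, fun z hz => ?_⟩, rfl, ?_⟩
    · refine lieForm_zero_of_span (e.span y hy) ?_ ?_
      · simp [lieForm_comm (e.ν₁ y) (e.σ₁ y), N.σ₁ν₁, N.ν₁σ₂]
      · simp [N.ν₁τ₁, N.ν₁τ₂]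
    · rw [e.lieCyclide_eq hz]; exact Submodule.subset_span (by simp)
    · intro Z hZ
      rw [e.fields.span₁ y hy] at hZ
      obtain ⟨c, rfl⟩ := Submodule.mem_span_singleton.1 hZ
      rw [dAlong_eq_vecDeriv, vecDeriv_smul_vec, e.X_ν₁ y hy, smul_zero]
      exact Submodule.zero_mem _

/-- The derivatives of `ν₁` give first `μ`, then `σ₁` with the nonvanishing coefficient `regular₁`.
From `μ` and `σ₁` one recovers `τ₁`. -/
theorem osculatingBundle_eq :
    osculatingBundle g r₁ r₂ y = Submodule.span ℝ {e.σ₁ y, e.ν₁ y, e.τ₁ y} := by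
  have hO := e.isOpen
  have hE : ∀ z ∈ U, osculatingComplex g r₁ r₂ z = Submodule.span ℝ {e.ν₁ z} :=
    fun z hz => e.osculatingComplex_eq hz
  have hσ : e.σ₁ y ∈ Submodule.span ℝ {e.σ₁ y, e.ν₁ y, e.τ₁ y} := Submodule.subset_span (by simp)
  have hν : e.ν₁ y ∈ Submodule.span ℝ {e.σ₁ y, e.ν₁ y, e.τ₁ y} := Submodule.subset_span (by simp)
  have hτ : e.τ₁ y ∈ Submodule.span ℝ {e.σ₁ y, e.ν₁ y, e.τ₁ y} := Submodule.subset_span (by simp)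
  have hμ : e.μ y ∈ Submodule.span ℝ {e.σ₁ y, e.ν₁ y, e.τ₁ y} :=
    Submodule.add_mem _ hτ (Submodule.smul_mem _ _ hσ)
  apply le_antisymm
  · refine secondJet_le hO e.smooth_ν₁ e.smooth_μ hE e.fields.span₂
      (fun z hz => e.indep_ν_μ hz) (fun z hz => ?_) hy hν hμ ?_
    · rw [e.deriv_ν_Y hz]
      exact Submodule.subset_span (by simp)
    · rw [e.deriv_μ_Y hy]
      exact Submodule.add_mem _ (Submodule.add_mem _ (Submodule.smul_mem _ _ hμ)
        (Submodule.smul_mem _ _ hν)) (Submodule.smul_mem _ _ hσ)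
  · obtain ⟨h1, h2, h3⟩ := mem_secondJet (T := curvatureDist g r₂) hO e.smooth_ν₁ hE
      e.fields.smooth₂ (fun z hz => e.fields.mem₂ hz) hy
    change _ ≤ secondJet (osculatingComplex g r₁ r₂) (curvatureDist g r₂) y
    set S := secondJet (osculatingComplex g r₁ r₂) (curvatureDist g r₂) y
    rw [e.deriv_ν_Y hy] at h2
    rw [vecDeriv_congr hO hy (fun z hz => e.deriv_ν_Y hz), e.deriv_μ_Y hy] at h3
    have hσ' : e.σ₁ y ∈ S := by
      rw [← S.smul_mem_iff (e.regular₁ y hy)]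
      exact (S.add_mem_iff_right (S.add_mem (S.smul_mem _ h2) (S.smul_mem _ h1))).1 h3
    rw [Submodule.span_le]
    rintro v (rfl | rfl | rfl)
    · exact hσ'
    · exact h1
    · exact (S.add_mem_iff_left (S.smul_mem _ hσ')).1 h2

omit hy

/-- The orthogonal projection to `⟨σ₁, ν₁, τ₁⟩`. -/
def proj (v : R42) (y : M) : R42 :=
  lieForm v (e.ν₁ y) • e.ν₁ y - (lieForm v (e.τ₁ y) • e.σ₁ y + lieForm v (e.σ₁ y) • e.τ₁ y)

theorem smooth_proj (v : R42) : SmoothOn (e.proj v) U :=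
  have hv := smoothOn_const (M := M) v U
  ((hv.lie e.smooth_ν₁).smul e.smooth_ν₁).sub
    (((hv.lie e.smooth_τ₁).smul e.smooth_σ₁).add ((hv.lie e.smooth_σ₁).smul e.smooth_τ₁))

include hy

/-- The structure equations close on `σ₁, ν₁, τ₁` with coefficients skew for the form, so projecting
a fixed vector to their span commutes with differentiation. -/
theorem deriv_proj (v : R42) (Z : TangentSpace (𝓡 2) y) : vecDeriv (e.proj v) y Z = 0 := by
  have hO := e.isOpen
  have hv := smoothOn_const (M := M) v U
  have s1 := hv.lie e.smooth_ν₁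
  have s2 := hv.lie e.smooth_τ₁
  have s3 := hv.lie e.smooth_σ₁
  have key : ∀ Z : TangentSpace (𝓡 2) y, vecDeriv (e.proj v) y Z =
      lieForm v (vecDeriv e.ν₁ y Z) • e.ν₁ y + lieForm v (e.ν₁ y) • vecDeriv e.ν₁ y Z -
      (lieForm v (vecDeriv e.τ₁ y Z) • e.σ₁ y + lieForm v (e.τ₁ y) • vecDeriv e.σ₁ y Z +
      (lieForm v (vecDeriv e.σ₁ y Z) • e.τ₁ y + lieForm v (e.σ₁ y) • vecDeriv e.τ₁ y Z)) := by
    intro Z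
    have h : vecDeriv (e.proj v) y Z = _ := vecDeriv_sub hO hy Z (s1.smul e.smooth_ν₁)
      ((s2.smul e.smooth_σ₁).add (s3.smul e.smooth_τ₁))
    rw [h, vecDeriv_add hO hy _ (s2.smul e.smooth_σ₁) (s3.smul e.smooth_τ₁),
      vecDeriv_smul hO hy _ s1 e.smooth_ν₁, vecDeriv_smul hO hy _ s2 e.smooth_σ₁,
      vecDeriv_smul hO hy _ s3 e.smooth_τ₁, vecDeriv_lie hO hy _ hv e.smooth_ν₁,
      vecDeriv_lie hO hy _ hv e.smooth_τ₁, vecDeriv_lie hO hy _ hv e.smooth_σ₁]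
    simp only [vecDeriv_const, map_zero, LinearMap.zero_apply, zero_add]
  obtain ⟨p, q, rfl⟩ := e.fields.exists_eq hy Z
  rw [vecDeriv_add_vec, vecDeriv_smul_vec, vecDeriv_smul_vec, key, key, e.X_ν₁ y hy, e.X_τ₁ y hy,
    e.X_σ₁ y hy, e.Y_ν₁ y hy, e.Y_τ₁ y hy, e.Y_σ₁ y hy]
  simp only [map_add, map_smul, map_zero, smul_eq_mul]
  module

theorem proj_eq {v : R42} (hv : v ∈ Submodule.span ℝ {e.σ₁ y, e.ν₁ y, e.τ₁ y}) :
    e.proj v y = v := by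
  obtain ⟨α, β, γ, rfl⟩ := Submodule.mem_span_triple.1 hv
  obtain ⟨k1, k2, k3, -⟩ := (e.gram y hy).coords α β γ 0 0 0
    (v := α • e.σ₁ y + β • e.ν₁ y + γ • e.τ₁ y) (by module)
  rw [proj, k1, k2, k3]
  module

omit hy in
theorem proj_mem (v : R42) : e.proj v y ∈ Submodule.span ℝ {e.σ₁ y, e.ν₁ y, e.τ₁ y} :=
  Submodule.sub_mem _ (Submodule.smul_mem _ _ (Submodule.subset_span (by simp)))
    (Submodule.add_mem _ (Submodule.smul_mem _ _ (Submodule.subset_span (by simp)))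
      (Submodule.smul_mem _ _ (Submodule.subset_span (by simp))))

include e in
-- The fibres are the ranges of orthogonal projections which, applied to any fixed vector, give
-- locally constant maps.
theorem osculatingBundle_locally_const : ∃ V : Set M, IsOpen V ∧ y ∈ V ∧
    ∀ z ∈ V, osculatingBundle g r₁ r₂ z = osculatingBundle g r₁ r₂ y := by
  obtain ⟨V, hVU, hV, hyV, h⟩ := exists_nhds_const e.isOpen hy
  refine ⟨V, hV, hyV, fun z hz => ?_⟩
  have hc := fun v => h (e.proj v) (e.smooth_proj v) (fun w hw Z => e.deriv_proj hw v Z) z hz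
  rw [e.osculatingBundle_eq (hVU hz), e.osculatingBundle_eq hy]
  apply le_antisymm
  · intro v hv
    rw [← e.proj_eq (hVU hz) hv, hc v]
    exact e.proj_mem v
  · intro v hv
    rw [← e.proj_eq hy hv, ← hc v]
    exact e.proj_mem v

end AdaptedFrame

theorem osculatingBundle_const [ConnectedSpace M]
    (h : ∀ x, ∃ U, x ∈ U ∧ Nonempty (AdaptedFrame g r₁ r₂ U)) (x y : M) :
    osculatingBundle g r₁ r₂ x = osculatingBundle g r₁ r₂ y := by
  refine IsLocallyConstant.apply_eq_of_preconnectedSpace ?_ x y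
  refine (IsLocallyConstant.iff_exists_open _).2 fun z => ?_
  obtain ⟨U, hz, ⟨e⟩⟩ := h z
  exact e.osculatingBundle_locally_const hz

end Osculating

/-! ### Orthonormal bases of the osculating bundles -/

/-- `n₁, n₂, p` is an orthonormal basis of `W`, with `p` timelike. -/
structure IsOrthoBasis (W : Submodule ℝ R42) (n₁ n₂ p : R42) : Prop where
  span : W = Submodule.span ℝ {n₁, n₂, p}
  n₁n₁ : lieForm n₁ n₁ = 1
  n₂n₂ : lieForm n₂ n₂ = 1
  pp : lieForm p p = -1
  n₁n₂ : lieForm n₁ n₂ = 0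
  n₁p : lieForm n₁ p = 0
  n₂p : lieForm n₂ p = 0

namespace IsOrthoBasis

variable {W : Submodule ℝ R42} {n₁ n₂ p : R42} (h : IsOrthoBasis W n₁ n₂ p)
include h

theorem mem₁ : n₁ ∈ W := h.span ▸ Submodule.subset_span (by simp)

theorem mem₂ : n₂ ∈ W := h.span ▸ Submodule.subset_span (by simp)

theorem mem₃ : p ∈ W := h.span ▸ Submodule.subset_span (by simp)

theorem isTwoOneSpace : IsTwoOneSpace W := by
  refine ⟨![n₁, n₂, p], ?_, fun i j => ?_⟩
  · rw [h.span]
    congr 1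
    ext v
    simp [eq_comm, or_comm, or_left_comm]
  · fin_cases i <;> fin_cases j <;>
      simp [h.n₁n₁, h.n₂n₂, h.pp, h.n₁n₂, h.n₁p, h.n₂p, lieForm_comm n₂ n₁, lieForm_comm p]

theorem exists_of_orthogonal {w : R42} (hw : w ∈ W) (hwp : lieForm w p = 0) :
    ∃ c d : ℝ, w = c • n₁ + d • n₂ := by
  rw [h.span] at hw
  obtain ⟨c, d, t, rfl⟩ := Submodule.mem_span_triple.1 hw
  simp [h.pp, h.n₁p, h.n₂p] at hwp
  exact ⟨c, d, by simp [hwp]⟩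

/-- The orthogonal complement of `p` in `W` is positive definite and contains no nonzero null
vector. -/
theorem ne_zero_of_null {w : R42} (hw : w ∈ W) (hww : lieForm w w = 0) (h0 : w ≠ 0) :
    lieForm w p ≠ 0 := by
  intro hwp
  obtain ⟨c, d, rfl⟩ := h.exists_of_orthogonal hw hwp
  simp [h.n₁n₁, h.n₂n₂, h.n₁n₂, lieForm_comm n₂ n₁] at hww
  have hc : c = 0 := by nlinarith [mul_self_nonneg c, mul_self_nonneg d]
  have hd : d = 0 := by nlinarith [mul_self_nonneg c, mul_self_nonneg d]
  exact h0 (by simp [hc, hd])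

end IsOrthoBasis

theorem IsNullFrame.exists_isOrthoBasis {σ₁ ν₁ τ₁ σ₂ ν₂ τ₂ : R42}
    (h : IsNullFrame σ₁ ν₁ τ₁ σ₂ ν₂ τ₂) :
    ∃ n₁ n₂ p, IsOrthoBasis (Submodule.span ℝ {σ₁, ν₁, τ₁}) n₁ n₂ p := by
  -- `σ₁ - τ₁` and `σ₁ + τ₁` have squares `2` and `-2`, so `s` normalises both.
  obtain ⟨s, hs⟩ : ∃ s : ℝ, s * s = 2⁻¹ :=
    ⟨Real.sqrt 2⁻¹, Real.mul_self_sqrt (by norm_num)⟩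
  have hs0 : s ≠ 0 := by rintro rfl; norm_num at hs
  refine ⟨ν₁, s • (σ₁ - τ₁), s • (σ₁ + τ₁), ?_, h.ν₁ν₁, ?_, ?_, ?_, ?_, ?_⟩
  · apply le_antisymm <;> rw [Submodule.span_le] <;> rintro v (rfl | rfl | rfl)
    · exact Submodule.mem_span_triple.2 ⟨0, s, s, by
        rw [smul_smul, smul_smul, hs]; module⟩
    · exact Submodule.subset_span (by simp)
    · exact Submodule.mem_span_triple.2 ⟨0, -s, s, by
        rw [smul_smul, smul_smul, neg_mul, hs]; module⟩
    · exact Submodule.subset_span (by simp)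
    · exact Submodule.mem_span_triple.2 ⟨s, 0, -s, by module⟩
    · exact Submodule.mem_span_triple.2 ⟨s, 0, s, by module⟩
  · simp [h.σ₁σ₁, h.σ₁τ₁, h.τ₁τ₁, lieForm_comm τ₁ σ₁]; linarith
  · simp [h.σ₁σ₁, h.σ₁τ₁, h.τ₁τ₁, lieForm_comm τ₁ σ₁]; linarith
  · simp [h.ν₁τ₁, lieForm_comm ν₁ σ₁, h.σ₁ν₁]
  · simp [h.ν₁τ₁, lieForm_comm ν₁ σ₁, h.σ₁ν₁]
  · simp [h.σ₁σ₁, h.σ₁τ₁, h.τ₁τ₁, lieForm_comm τ₁ σ₁]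

/-! ### The space form and the Joachimsthal property -/

section Joachimsthal

variable {M : Type*} [TopologicalSpace M] [ChartedSpace (EuclideanSpace ℝ (Fin 2)) M]
  [IsManifold (𝓡 2) ∞ M] {g r₁ r₂ : M → Submodule ℝ R42} {U : Set M}

namespace AdaptedFrame

/-- The space form vectors `p` and `q` lie in the osculating bundles. -/
structure IsCompatible (e : AdaptedFrame g r₁ r₂ U) (p q : R42) : Prop where
  timelike : lieForm p p = -1
  ne_zero : q ≠ 0
  p_mem : ∀ y ∈ U, p ∈ Submodule.span ℝ {e.σ₁ y, e.ν₁ y, e.τ₁ y}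
  q_mem : ∀ y ∈ U, q ∈ Submodule.span ℝ {e.σ₂ y, e.ν₂ y, e.τ₂ y}
  σ₁p : ∀ y ∈ U, lieForm (e.σ₁ y) p ≠ 0

variable (e : AdaptedFrame g r₁ r₂ U) {p q : R42}

theorem orthogonal_of_mem {y : M} (hy : y ∈ U) {v : R42}
    (hv : v ∈ Submodule.span ℝ {e.σ₁ y, e.ν₁ y, e.τ₁ y}) :
    lieForm (e.σ₂ y) v = 0 ∧ lieForm (e.ν₂ y) v = 0 ∧ lieForm (e.τ₂ y) v = 0 := by
  obtain ⟨α, β, γ, rfl⟩ := Submodule.mem_span_triple.1 hv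
  have N := (e.gram y hy).symm
  simp [N.σ₁σ₂, N.σ₁ν₂, N.σ₁τ₂, N.ν₁σ₂, N.ν₁ν₂, N.ν₁τ₂, N.τ₁σ₂, N.τ₁ν₂, N.τ₁τ₂]

theorem ν_orthogonal {y : M} (hy : y ∈ U) : ∀ w ∈ g y, lieForm (e.ν₁ y) w = 0 := by
  have N := e.gram y hy
  refine lieForm_zero_of_span (e.span y hy) ?_ ?_
  · simp [lieForm_comm (e.ν₁ y) (e.σ₁ y), N.σ₁ν₁, N.ν₁σ₂]
  · simp [N.ν₁τ₁, N.ν₁τ₂]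

/-- A vector of `g = ⟨σ₁ + σ₂, τ₁ - τ₂⟩` with no component along the second triple has both
coefficients zero. -/
theorem eq_zero_of_mem_of_mem {y : M} (hy : y ∈ U) {v : R42} (hv : v ∈ g y)
    (hv' : v ∈ Submodule.span ℝ {e.σ₁ y, e.ν₁ y, e.τ₁ y}) : v = 0 := by
  obtain ⟨h1, -, h3⟩ := e.orthogonal_of_mem hy hv'
  rw [e.span y hy] at hv
  obtain ⟨c, d, rfl⟩ := Submodule.mem_span_pair.1 hv
  have N := (e.gram y hy).symm
  simp [N.σ₁σ₂, N.σ₁τ₂, N.σ₁σ₁, N.σ₁τ₁] at h1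
  simp [N.τ₁σ₂, N.τ₁τ₂, N.τ₁τ₁, lieForm_comm (e.τ₂ y) (e.σ₂ y), N.σ₁τ₁] at h3
  simp [h1, h3]

/-- The map `v ↦ v + (v, p) p`, which for timelike unit `p` is the projection to `⟨p⟩^⊥`. -/
noncomputable def _root_.LieSphere.conformalProj (p : R42) : R42 →ₗ[ℝ] R42 :=
  LinearMap.id + (lieForm.flip p).smulRight p

theorem _root_.LieSphere.conformalProj_apply (p v : R42) :
    conformalProj p v = v + lieForm v p • p := rfl

theorem smooth_conformalProj (p : R42) : SmoothOn (fun y => conformalProj p (e.ν₁ y)) U :=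
  e.smooth_ν₁.add ((e.smooth_ν₁.lie (smoothOn_const p U)).smul (smoothOn_const p U))

/-- The square is `1 + (ν₁, p)²`: removing a timelike component only increases the length. -/
theorem conformalProj_pos (hp : lieForm p p = -1) {y : M} (hy : y ∈ U) :
    0 < lieForm (conformalProj p (e.ν₁ y)) (conformalProj p (e.ν₁ y)) := by
  simp only [conformalProj_apply, map_add, map_smul, LinearMap.add_apply, LinearMap.smul_apply,
    smul_eq_mul, (e.gram y hy).ν₁ν₁, hp, lieForm_comm p (e.ν₁ y)]
  nlinarith [mul_self_nonneg (lieForm (e.ν₁ y) p)]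

theorem map_conformalProj_eq {y : M} (hy : y ∈ U) (p : R42) :
    (osculatingComplex g r₁ r₂ y).map (conformalProj p) =
      Submodule.span ℝ {conformalProj p (e.ν₁ y)} := by
  rw [e.osculatingComplex_eq hy, Submodule.map_span, Set.image_singleton]

theorem conformalProj_frame (hp : lieForm p p = -1) : ∀ y ∈ U, conformalProj p (e.ν₁ y) ≠ 0 ∧
    (osculatingComplex g r₁ r₂ y).map (conformalProj p) =
      Submodule.span ℝ {conformalProj p (e.ν₁ y)} := fun y hy =>
  ⟨fun h => by have := e.conformalProj_pos hp hy; simp [h] at this, e.map_conformalProj_eq hy p⟩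

theorem complex_frame : ∀ y ∈ U, e.ν₁ y ≠ 0 ∧
    osculatingComplex g r₁ r₂ y = Submodule.span ℝ {e.ν₁ y} := fun y hy =>
  ⟨fun h => by have := (e.gram y hy).ν₁ν₁; simp [h] at this, e.osculatingComplex_eq hy⟩

theorem deriv_eq_zero {φ : M → R42} {y : M} (hy : y ∈ U) (h : vecDeriv φ y (e.X y) = 0)
    {Z : TangentSpace (𝓡 2) y} (hZ : Z ∈ curvatureDist g r₁ y) : vecDeriv φ y Z = 0 := by
  rw [e.fields.span₁ y hy] at hZ
  obtain ⟨c, rfl⟩ := Submodule.mem_span_singleton.1 hZ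
  rw [vecDeriv_smul_vec, h, smul_zero]

theorem deriv_conformalProj (p : R42) {y : M} (hy : y ∈ U) :
    vecDeriv (fun y => conformalProj p (e.ν₁ y)) y (e.X y) = 0 := by
  have hp := smoothOn_const (M := M) p U
  have h : vecDeriv (fun y => conformalProj p (e.ν₁ y)) y (e.X y) =
      vecDeriv e.ν₁ y (e.X y) + vecDeriv (fun y => lieForm (e.ν₁ y) p • p) y (e.X y) :=
    vecDeriv_add e.isOpen hy (e.X y) e.smooth_ν₁ ((e.smooth_ν₁.lie hp).smul hp)
  rw [h, vecDeriv_smul e.isOpen hy _ (e.smooth_ν₁.lie hp) hp, vecDeriv_const,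
    vecDeriv_lie e.isOpen hy _ e.smooth_ν₁ hp, e.X_ν₁ y hy, vecDeriv_const]
  simp

/-- The point sphere map of `g`. -/
noncomputable def pointSphere (p : R42) (y : M) : R42 :=
  lieForm (e.τ₁ y) p • (e.σ₁ y + e.σ₂ y) - lieForm (e.σ₁ y) p • (e.τ₁ y - e.τ₂ y)

theorem smooth_pointSphere (p : R42) : SmoothOn (e.pointSphere p) U :=
  have hp := smoothOn_const (M := M) p U
  ((e.smooth_τ₁.lie hp).smul (e.smooth_σ₁.add e.smooth_σ₂)).sub
    ((e.smooth_σ₁.lie hp).smul (e.smooth_τ₁.sub e.smooth_τ₂))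

theorem pointSphere_mem (p : R42) {y : M} (hy : y ∈ U) : e.pointSphere p y ∈ g y := by
  rw [e.span y hy]
  exact Submodule.sub_mem _ (Submodule.smul_mem _ _ (Submodule.subset_span (by simp)))
    (Submodule.smul_mem _ _ (Submodule.subset_span (by simp)))

theorem coords_pointSphere (p : R42) {y : M} (hy : y ∈ U) :
    lieForm (e.pointSphere p y) (e.σ₁ y) = lieForm (e.σ₁ y) p ∧
    lieForm (e.pointSphere p y) (e.τ₁ y) = -lieForm (e.τ₁ y) p ∧
    lieForm (e.pointSphere p y) (e.σ₂ y) = -lieForm (e.σ₁ y) p ∧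
    lieForm (e.pointSphere p y) (e.τ₂ y) = -lieForm (e.τ₁ y) p := by
  obtain ⟨k1, -, k3, k4, -, k6⟩ := (e.gram y hy).coords (lieForm (e.τ₁ y) p) 0
    (-lieForm (e.σ₁ y) p) (lieForm (e.τ₁ y) p) 0 (lieForm (e.σ₁ y) p) (v := e.pointSphere p y)
    (by rw [pointSphere]; module)
  exact ⟨k1.trans (neg_neg _), k3, k4, k6⟩

namespace IsCompatible

variable {e} (h : e.IsCompatible p q)
include h

theorem lieForm_σ₀ {y : M} (hy : y ∈ U) : lieForm (e.σ₀ y) p = lieForm (e.σ₁ y) p := by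
  rw [σ₀, map_add, LinearMap.add_apply, (e.orthogonal_of_mem hy (h.p_mem y hy)).1, add_zero]

theorem pointSphere_p {y : M} (hy : y ∈ U) : lieForm (e.pointSphere p y) p = 0 := by
  obtain ⟨k1, k2, k3⟩ := e.orthogonal_of_mem hy (h.p_mem y hy)
  simp [pointSphere, k1, k3]
  ring

theorem pointSphere_q {y : M} (hy : y ∈ U) : lieForm (e.pointSphere p y) q =
    lieForm (e.τ₁ y) p * lieForm (e.σ₂ y) q + lieForm (e.σ₁ y) p * lieForm (e.τ₂ y) q := by
  obtain ⟨k1, k2, k3⟩ := e.symm.orthogonal_of_mem hy (h.q_mem y hy)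
  change lieForm (e.σ₁ y) q = 0 at k1
  change lieForm (e.τ₁ y) q = 0 at k3
  simp [pointSphere, k1, k3]

theorem ρ_p {y : M} (hy : y ∈ U) :
    lieForm (e.ρ y) p = lieForm (e.τ₁ y) p + e.κ₂ y * lieForm (e.σ₁ y) p := by
  obtain ⟨k1, k2, k3⟩ := e.orthogonal_of_mem hy (h.p_mem y hy)
  simp [ρ, k1, k3]

theorem ρ_symm_p {y : M} (hy : y ∈ U) :
    lieForm (e.symm.ρ y) p = -lieForm (e.τ₁ y) p + e.κ₁ y * lieForm (e.σ₁ y) p := by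
  obtain ⟨k1, k2, k3⟩ := e.orthogonal_of_mem hy (h.p_mem y hy)
  change lieForm (e.τ₂ y - e.τ₁ y + e.κ₁ y • (e.σ₂ y + e.σ₁ y)) p = _
  simp [k1, k3]

omit h in
-- If `ρ ⊥ p` on an open set, its `X`-derivative is orthogonal to `p` too. That derivative contains
-- `σ₀` with the nonzero coefficient of `regular₂`.
theorem _root_.LieSphere.AdaptedFrame.exists_ρ_ne_zero (e : AdaptedFrame g r₁ r₂ U) {O : Set M}
    (hO : IsOpen O) (hOU : O ⊆ U) (hne : O.Nonempty)
    (hp : ∀ y ∈ U, lieForm (e.σ₀ y) p ≠ 0) : ∃ y ∈ O, lieForm (e.ρ y) p ≠ 0 := by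
  by_contra! hcon
  obtain ⟨y, hy⟩ := hne
  have h1 := vecDeriv_lie_of_const hO hy (e.smooth_ρ.mono hOU) (smoothOn_const p O) hcon (e.X y)
  rw [vecDeriv_const, map_zero, add_zero, e.deriv_ρ_X (hOU hy), map_add, map_smul, map_smul,
    LinearMap.add_apply, LinearMap.smul_apply, LinearMap.smul_apply, hcon y hy, smul_zero, zero_add,
    smul_eq_mul] at h1
  exact mul_ne_zero (e.regular₂ y (hOU hy)) (hp y (hOU hy)) h1

/-- If the point sphere is orthogonal to `q` on an open set, one derivative along `X` gives `(ρ, p)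
(ν₂, q) = 0`, so `ν₂ ⊥ q`. Two further derivatives and `regular₂` give `σ₂ ⊥ q`, and then `τ₂ ⊥ q`.
As `q` lies in the span of these three vectors, it would be zero. -/
theorem exists_pointSphere_ne_zero {O : Set M} (hO : IsOpen O) (hOU : O ⊆ U) (hne : O.Nonempty)
    (hρ : ∀ y ∈ O, lieForm (e.ρ y) p ≠ 0) : ∃ y ∈ O, lieForm (e.pointSphere p y) q ≠ 0 := by
  by_contra! hcon
  have sp := smoothOn_const (M := M) p O
  have sq := smoothOn_const (M := M) q O
  have sσ₁ := (e.smooth_σ₁.mono hOU).lie sp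
  have sτ₁ := (e.smooth_τ₁.mono hOU).lie sp
  have sσ₂ := (e.smooth_σ₂.mono hOU).lie sq
  have sτ₂ := (e.smooth_τ₂.mono hOU).lie sq
  have hC : ∀ y ∈ O, lieForm (e.τ₁ y) p * lieForm (e.σ₂ y) q +
      lieForm (e.σ₁ y) p * lieForm (e.τ₂ y) q = 0 := fun y hy =>
    (h.pointSphere_q (hOU hy)).symm.trans (hcon y hy)
  have hν : ∀ y ∈ O, lieForm (e.ν₂ y) q = 0 := by
    intro y hy
    have hyU := hOU hy
    have h1 := vecDeriv_congr hO hy hC (e.X y)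
    rw [vecDeriv_const, vecDeriv_add hO hy _ (sτ₁.mul sσ₂) (sσ₁.mul sτ₂), vecDeriv_mul hO hy _ sτ₁ sσ₂,
      vecDeriv_mul hO hy _ sσ₁ sτ₂, vecDeriv_lie hO hy _ (e.smooth_τ₁.mono hOU) sp,
      vecDeriv_lie hO hy _ (e.smooth_σ₁.mono hOU) sp, vecDeriv_lie hO hy _ (e.smooth_τ₂.mono hOU) sq,
      vecDeriv_lie hO hy _ (e.smooth_σ₂.mono hOU) sq, vecDeriv_const, vecDeriv_const, e.X_σ₁ y hyU,
      e.X_τ₁ y hyU, e.X_σ₂ y hyU, e.X_τ₂ y hyU] at h1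
    simp only [map_add, map_smul, map_zero, LinearMap.add_apply, LinearMap.smul_apply, smul_eq_mul]
      at h1
    have h2 := hρ y hy
    rw [h.ρ_p hyU] at h2
    exact (mul_eq_zero.1 (by linear_combination h1 : _ * _ = (0 : ℝ))).resolve_left h2
  have hμ : ∀ y ∈ O, lieForm (e.symm.μ y) q = 0 := by
    intro y hy
    have h1 := vecDeriv_lie_of_const hO hy (e.smooth_ν₂.mono hOU) sq hν (e.X y)
    rw [vecDeriv_const, map_zero, add_zero] at h1
    rw [← e.symm.deriv_ν_Y (hOU hy)]
    exact h1
  obtain ⟨y, hy⟩ := hne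
  have hyU := hOU hy
  have h1 := vecDeriv_lie_of_const hO hy (e.symm.smooth_μ.mono hOU) sq hμ (e.X y)
  have h2 : vecDeriv e.symm.μ y (e.X y) = _ := e.symm.deriv_μ_Y hyU
  have h3 : lieForm (e.symm.ν₁ y) q = 0 := hν y hy
  rw [vecDeriv_const, map_zero, add_zero, h2] at h1
  simp only [map_add, map_smul, LinearMap.add_apply, LinearMap.smul_apply, smul_eq_mul, hμ y hy, h3,
    mul_zero, zero_add] at h1
  have h4 : lieForm (e.σ₂ y) q = 0 := (mul_eq_zero.1 h1).resolve_left (e.regular₂ y hyU)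
  have h5 : lieForm (e.τ₂ y) q = 0 := by
    have h6 := hμ y hy
    change lieForm (e.τ₂ y + e.κ₂ y • e.σ₂ y) q = 0 at h6
    simpa [h4] using h6
  obtain ⟨k1, k2, k3⟩ := e.symm.orthogonal_of_mem hyU (h.q_mem y hyU)
  refine h.ne_zero ((e.gram y hyU).eq_zero ?_ ?_ ?_ ?_ ?_ ?_) <;> rw [lieForm_comm]
  exacts [k1, k2, k3, h4, hν y hy, h5]

/-- Both `ν₁` and `ν₂` are orthogonal to `g`. If `d_Z` of the point sphere stays in `g`, moving the
derivative onto `ν₂` and `ν₁` leaves the `X`-component of `Z` times `(ρ, p)` and the `Y`-component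
times `(e.symm.ρ, p)`. The two hypotheses say that neither curvature sphere is a point sphere. -/
theorem immersesAt {y : M} (hy : y ∈ U) (h₁ : lieForm (e.ρ y) p ≠ 0)
    (h₂ : lieForm (e.symm.ρ y) p ≠ 0) :
    ImmersesAt (fun z => g z ⊓ lieForm.orthogonal (Submodule.span ℝ {p})) y := by
  intro Z hZ
  have hO := e.isOpen
  have hs := (hZ U (e.pointSphere p) ⟨hO, hy, e.smooth_pointSphere p, fun z hz =>
    ⟨e.pointSphere_mem p hz, ?_⟩⟩).1
  · rw [dAlong_eq_vecDeriv] at hs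
    obtain ⟨a, b, rfl⟩ := e.fields.exists_eq hy Z
    obtain ⟨c1, c2, c3, c4⟩ := e.coords_pointSphere p hy
    have k1 := vecDeriv_lie_of_const hO hy (e.smooth_pointSphere p) e.smooth_ν₁ (fun z hz =>
      (lieForm_comm _ _).trans (e.ν_orthogonal hz _ (e.pointSphere_mem p hz))) (a • e.X y + b • e.Y y)
    have k2 := vecDeriv_lie_of_const hO hy (e.smooth_pointSphere p) e.smooth_ν₂ (fun z hz =>
      (lieForm_comm _ _).trans (e.symm.ν_orthogonal hz _ (e.pointSphere_mem p hz)))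
      (a • e.X y + b • e.Y y)
    rw [lieForm_comm, e.ν_orthogonal hy _ hs, vecDeriv_add_vec, vecDeriv_smul_vec, vecDeriv_smul_vec,
      e.X_ν₁ y hy, e.Y_ν₁ y hy] at k1
    have hs' : lieForm (vecDeriv (e.pointSphere p) y (a • e.X y + b • e.Y y)) (e.ν₂ y) = 0 :=
      (lieForm_comm _ _).trans (e.symm.ν_orthogonal hy _ hs)
    rw [hs', vecDeriv_add_vec, vecDeriv_smul_vec, vecDeriv_smul_vec,
      e.X_ν₂ y hy, e.Y_ν₂ y hy] at k2
    simp only [map_add, map_smul, map_zero, smul_eq_mul, c1, c2, c3, c4] at k1 k2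
    rw [h.ρ_p hy] at h₁
    rw [h.ρ_symm_p hy] at h₂
    have ha : a = 0 := (mul_eq_zero.1 (by linear_combination -k2 : a * _ = 0)).resolve_right h₁
    have hb : b = 0 := (mul_eq_zero.1 (by linear_combination k1 : b * _ = 0)).resolve_right h₂
    rw [ha, hb, zero_smul, zero_smul, add_zero]
  · intro n hn
    obtain ⟨c, rfl⟩ := Submodule.mem_span_singleton.1 hn
    have := h.pointSphere_p hz
    rw [lieForm_comm] at this
    simp [this]

/-- The three nonvanishing conditions are imposed one after another, each on the nonempty open set
left by the previous one. -/
theorem exists_good {O : Set M} (hO : IsOpen O) (hOU : O ⊆ U) (hne : O.Nonempty)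
    (hnull : ∀ x, ∀ v ∈ g x, ∀ w ∈ g x, lieForm v w = 0) :
    ∃ y ∈ O, (∃ v ∈ g y, v ∈ spaceForm p q) ∧
      ImmersesAt (fun z => g z ⊓ lieForm.orthogonal (Submodule.span ℝ {p})) y := by
  have hσ₀ : ∀ y ∈ U, lieForm (e.σ₀ y) p ≠ 0 := fun y hy => h.lieForm_σ₀ hy ▸ h.σ₁p y hy
  have hσ₀' : ∀ y ∈ U, lieForm (e.symm.σ₀ y) p ≠ 0 := fun y hy => by
    have : e.symm.σ₀ y = e.σ₀ y := add_comm _ _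
    rw [this]; exact hσ₀ y hy
  have step : ∀ {O : Set M}, IsOpen O → O ⊆ U → ∀ φ : M → R42, SmoothOn φ U →
      IsOpen (O ∩ (fun y => lieForm (φ y) p) ⁻¹' {0}ᶜ) := fun hO hOU φ hφ =>
    (((hφ.mono hOU).lie (smoothOn_const p _)).continuousOn).isOpen_inter_preimage hO
      isOpen_compl_singleton
  obtain ⟨y₁, hy₁, hA⟩ := e.exists_ρ_ne_zero hO hOU hne hσ₀
  have hO₁ := step hO hOU _ e.smooth_ρ
  have hO₁U := (Set.inter_subset_left (s := O) (t := (fun y => lieForm (e.ρ y) p) ⁻¹' {0}ᶜ)).trans hOU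
  obtain ⟨y₂, hy₂, hB⟩ := e.symm.exists_ρ_ne_zero hO₁ hO₁U ⟨y₁, hy₁, hA⟩ hσ₀'
  have hO₂ := step hO₁ hO₁U _ e.symm.smooth_ρ
  obtain ⟨y, hy, hC⟩ := h.exists_pointSphere_ne_zero hO₂ (Set.inter_subset_left.trans hO₁U)
    ⟨y₂, hy₂, hB⟩ (fun z hz => hz.1.2)
  have hyU := hOU hy.1.1
  have hm := e.pointSphere_mem p hyU
  refine ⟨y, hy.1.1, ⟨(-(lieForm (e.pointSphere p y) q)⁻¹) • e.pointSphere p y,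
    (g y).smul_mem _ hm, ?_, ?_, ?_⟩, h.immersesAt hyU hy.1.2 hy.2⟩
  · simp [hnull y _ hm _ hm]
  · simp [inv_mul_cancel₀ hC]
  · simp [h.pointSphere_p hyU]

end IsCompatible

end AdaptedFrame

/-- A Legendre map with adapted frames projects to a Joachimsthal surface. -/
theorem projectsToJoachimsthal {p q n₁ n₂ : R42} {W₁ W₂ : Submodule ℝ R42}
    (hnull : ∀ x, ∀ v ∈ g x, ∀ w ∈ g x, lieForm v w = 0)
    (hW : ∀ v ∈ W₁, ∀ w ∈ W₂, lieForm v w = 0) (hB : IsOrthoBasis W₁ n₁ n₂ p)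
    (hq : q ∈ W₂)
    (hfr : ∀ x, ∃ U, x ∈ U ∧ ∃ e : AdaptedFrame g r₁ r₂ U, e.IsCompatible p q ∧
      (∀ y ∈ U, W₁ = Submodule.span ℝ {e.σ₁ y, e.ν₁ y, e.τ₁ y}) ∧
      ∀ y ∈ U, W₂ = Submodule.span ℝ {e.σ₂ y, e.ν₂ y, e.τ₂ y}) :
    ProjectsToJoachimsthal g (curvatureDist g r₁) (curvatureDist g r₂) p q := by
  have hp := hB.pp
  have memW : ∀ x, ∀ s ∈ (osculatingComplex g r₁ r₂ x).map (conformalProj p),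
      s ∈ W₁ ∧ lieForm s p = 0 := by
    intro x s hs
    obtain ⟨U, hx, e, he, hW₁, -⟩ := hfr x
    rw [e.map_conformalProj_eq hx] at hs
    obtain ⟨c, rfl⟩ := Submodule.mem_span_singleton.1 hs
    refine ⟨W₁.smul_mem _ (W₁.add_mem ?_ (W₁.smul_mem _ hB.mem₃)), ?_⟩
    · rw [hW₁ x hx]; exact Submodule.subset_span (by simp)
    · simp [conformalProj_apply, hp]
  have memW' : ∀ x, ∀ s ∈ osculatingComplex g r₂ r₁ x, s ∈ W₂ := by
    intro x s hs
    obtain ⟨U, hx, e, he, -, hW₂⟩ := hfr x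
    rw [e.symm.osculatingComplex_eq hx] at hs
    obtain ⟨c, rfl⟩ := Submodule.mem_span_singleton.1 hs
    rw [hW₂ x hx]
    exact Submodule.smul_mem _ _ (Submodule.subset_span (by simp [AdaptedFrame.symm]))
  -- The planes are the osculating complexes along `T₁` projected to `p^⊥`. The spheres are the
  -- complexes along `T₂` themselves, which lie in `W₂` and so are already orthogonal to `p ∈ W₁`.
  refine ⟨?_, n₁, n₂, ⟨hB.n₁n₁, hB.n₂n₂, hB.n₁n₂⟩, ⟨hB.n₁p, hW _ hB.mem₁ _ hq, hB.n₂p,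
    hW _ hB.mem₂ _ hq⟩, ⟨fun x => (osculatingComplex g r₁ r₂ x).map (conformalProj p), ⟨⟨?_, ?_, ?_,
      ?_, ?_, ?_⟩, ?_⟩, ?_⟩, ⟨fun x => osculatingComplex g r₂ r₁ x, ⟨⟨?_, ?_, ?_, ?_, ?_, ?_⟩, ?_⟩, ?_⟩⟩
  · refine dense_iff_inter_open.2 fun O hO ⟨x, hxO⟩ => ?_
    obtain ⟨U, hx, e, he, -⟩ := hfr x
    obtain ⟨y, hy, h⟩ := he.exists_good (hO.inter e.isOpen) Set.inter_subset_right ⟨x, hxO, hx⟩ hnull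
    exact ⟨y, hy.1, h⟩
  · refine isSubbundle_one_of_local fun x => ?_
    obtain ⟨U, hx, e, -⟩ := hfr x
    exact ⟨U, e.isOpen, hx, _, e.smooth_conformalProj p, e.conformalProj_frame hp⟩
  · intro x s hs h0
    obtain ⟨U, hx, e, -⟩ := hfr x
    rw [e.map_conformalProj_eq hx] at hs
    obtain ⟨c, rfl⟩ := Submodule.mem_span_singleton.1 hs
    have hc : c ≠ 0 := by rintro rfl; simp at h0
    have := e.conformalProj_pos hp hx
    simp only [map_smul, LinearMap.smul_apply, smul_eq_mul, ← mul_assoc]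
    exact mul_pos (mul_self_pos.2 hc) this
  · exact fun x s hs => (memW x s hs).2
  · intro x V σ hσ Z hZ
    obtain ⟨U, hx, e, -⟩ := hfr x
    refine dAlong_mem_of_frame e.isOpen hx (e.smooth_conformalProj p) (e.conformalProj_frame hp) ?_ hσ
    rw [e.deriv_eq_zero hx (e.deriv_conformalProj p hx) hZ]
    exact Submodule.zero_mem _
  · intro x s hs y hy hyp
    obtain ⟨U, hx, e, -⟩ := hfr x
    rw [e.map_conformalProj_eq hx] at hs
    obtain ⟨c, rfl⟩ := Submodule.mem_span_singleton.1 hs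
    simp [conformalProj_apply, lieForm_comm y (e.ν₁ x), e.ν_orthogonal hx y hy, hyp.2.2]
  -- Transversality of the planes: if `v = γ + d p` with `γ ∈ g`, then `γ ∈ g ∩ W₁ = 0`, and `v ⊥ p`
  -- forces `d = 0`.
  · intro x
    obtain ⟨U, hx, e, -, hW₁, -⟩ := hfr x
    refine Submodule.disjoint_def.2 fun v hv hv' => ?_
    obtain ⟨hvW, hvp⟩ := memW x v hv
    obtain ⟨γ, hγ, u, hu, huv⟩ := Submodule.mem_sup.1 hv'
    obtain ⟨d, rfl⟩ := Submodule.mem_span_singleton.1 hu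
    have hγW : γ ∈ W₁ := (W₁.add_mem_iff_left (W₁.smul_mem d hB.mem₃)).1 (huv ▸ hvW)
    rw [hW₁ x hx] at hγW
    rw [e.eq_zero_of_mem_of_mem hx hγ hγW, zero_add] at huv
    rw [← huv, map_smul, LinearMap.smul_apply, hp] at hvp
    have hd : d = 0 := by simpa using hvp
    rw [← huv, hd, zero_smul]
  · exact fun x s hs => hW _ (memW x s hs).1 _ hq
  · intro x s hs y hy h1 h2
    obtain ⟨c, d, rfl⟩ := hB.exists_of_orthogonal (memW x s hs).1 (memW x s hs).2
    simp [h1, h2]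
  · refine isSubbundle_one_of_local fun x => ?_
    obtain ⟨U, hx, e, -⟩ := hfr x
    exact ⟨U, e.isOpen, hx, _, e.symm.smooth_ν₁, e.symm.complex_frame⟩
  · intro x s hs h0
    obtain ⟨U, hx, e, -⟩ := hfr x
    rw [e.symm.osculatingComplex_eq hx] at hs
    obtain ⟨c, rfl⟩ := Submodule.mem_span_singleton.1 hs
    have hc : c ≠ 0 := by rintro rfl; simp at h0
    simp only [map_smul, LinearMap.smul_apply, smul_eq_mul, (e.symm.gram x hx).ν₁ν₁, mul_one]
    exact mul_self_pos.2 hc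
  · exact fun x s hs => (lieForm_comm _ _).trans (hW _ hB.mem₃ _ (memW' x s hs))
  · intro x V σ hσ Z hZ
    obtain ⟨U, hx, e, -⟩ := hfr x
    refine dAlong_mem_of_frame e.isOpen hx e.symm.smooth_ν₁ e.symm.complex_frame ?_ hσ
    rw [e.symm.deriv_eq_zero hx (e.symm.X_ν₁ x hx) hZ]
    exact Submodule.zero_mem _
  · intro x s hs y hy hyp
    obtain ⟨U, hx, e, -⟩ := hfr x
    rw [e.symm.osculatingComplex_eq hx] at hs
    obtain ⟨c, rfl⟩ := Submodule.mem_span_singleton.1 hs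
    rw [map_smul, lieForm_comm, e.symm.ν_orthogonal hx y hy, smul_zero]
  -- Transversality of the spheres: `ν₂` is orthogonal to `g` and to `p`, so a multiple of it in `g
  -- + ⟨p⟩` is orthogonal to itself, although `ν₂` is a unit vector.
  · intro x
    obtain ⟨U, hx, e, -⟩ := hfr x
    refine Submodule.disjoint_def.2 fun v hv hv' => ?_
    have hvp := (lieForm_comm _ _).trans (hW _ hB.mem₃ _ (memW' x v hv))
    obtain ⟨γ, hγ, u, hu, huv⟩ := Submodule.mem_sup.1 hv'
    obtain ⟨d, rfl⟩ := Submodule.mem_span_singleton.1 hu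
    rw [e.symm.osculatingComplex_eq hx] at hv
    obtain ⟨c, rfl⟩ := Submodule.mem_span_singleton.1 hv
    have h1 : lieForm (c • e.symm.ν₁ x) (c • e.symm.ν₁ x) = 0 := by
      nth_rw 2 [← huv]
      rw [map_add, map_smul _ d p, hvp, map_smul, LinearMap.smul_apply, e.symm.ν_orthogonal hx γ hγ]
      simp
    simp only [map_smul, LinearMap.smul_apply, smul_eq_mul, (e.symm.gram x hx).ν₁ν₁, mul_one,
      mul_self_eq_zero] at h1
    rw [h1, zero_smul]
  · intro x s hs y hy _ t ht _
    obtain ⟨U, hx, e, -⟩ := hfr x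
    rw [e.symm.osculatingComplex_eq hx] at hs
    obtain ⟨c, rfl⟩ := Submodule.mem_span_singleton.1 hs
    rw [map_smul, lieForm_comm, e.symm.ν_orthogonal hx t ht, smul_zero]
  · exact fun x s hs => ⟨(lieForm_comm _ _).trans (hW _ hB.mem₁ _ (memW' x s hs)),
      (lieForm_comm _ _).trans (hW _ hB.mem₂ _ (memW' x s hs))⟩

end Joachimsthal

end LieSphere

/-! ### Choice of the space form and conclusion -/

theorem mainTheorem12 {M : Type*} [TopologicalSpace M]
    [ChartedSpace (EuclideanSpace ℝ (Fin 2)) M] [IsManifold (𝓡 2) ∞ M] [ConnectedSpace M]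
    (f s₁ s₂ g r₁ r₂ : M → Submodule ℝ LieSphere.R42)
    (hf : LieSphere.IsDupinCyclide f s₁ s₂)
    (hg : LieSphere.IsRegular g r₁ r₂)
    (hfg : LieSphere.IsRibaucourPair f s₁ s₂ g r₁ r₂) :
    ∃ W₁ W₂ : Submodule ℝ LieSphere.R42,
      (∀ x, LieSphere.osculatingBundle g r₁ r₂ x = W₁) ∧
      (∀ x, LieSphere.osculatingBundle g r₂ r₁ x = W₂) ∧
      LieSphere.IsTwoOneSpace W₁ ∧ LieSphere.IsTwoOneSpace W₂ ∧
      ∃ p ∈ W₁, ∃ q ∈ W₂, LieSphere.IsEuclideanPair p q ∧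
        LieSphere.ProjectsToJoachimsthal g
          (LieSphere.curvatureDist g r₁) (LieSphere.curvatureDist g r₂) p q := by
  open LieSphere in
  have hfr : ∀ x, ∃ U, x ∈ U ∧ Nonempty (AdaptedFrame g r₁ r₂ U) :=
    exists_adaptedFrame hf hg hfg
  have hfr' : ∀ x, ∃ U, x ∈ U ∧ Nonempty (AdaptedFrame g r₂ r₁ U) := fun x => by
    obtain ⟨U, hx, ⟨e⟩⟩ := hfr x
    exact ⟨U, hx, ⟨e.symm⟩⟩
  obtain ⟨x₀⟩ : Nonempty M := inferInstance
  have c₁ := fun x => osculatingBundle_const hfr x x₀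
  have c₂ := fun x => osculatingBundle_const hfr' x x₀
  obtain ⟨U₀, hx₀, ⟨e₀⟩⟩ := hfr x₀
  have N := e₀.gram x₀ hx₀
  have w₁ := e₀.osculatingBundle_eq hx₀
  have w₂ : osculatingBundle g r₂ r₁ x₀ =
      Submodule.span ℝ {e₀.σ₂ x₀, e₀.ν₂ x₀, e₀.τ₂ x₀} := e₀.symm.osculatingBundle_eq hx₀
  obtain ⟨n₁, n₂, p, hB⟩ := N.exists_isOrthoBasis
  obtain ⟨n₁', n₂', p', hB'⟩ := N.symm.exists_isOrthoBasis
  rw [← w₁] at hB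
  rw [← w₂] at hB'
  -- Any nonzero null vector of the second bundle can serve as `q`; `σ₂` at the base point is at
  -- hand.
  have hq : e₀.σ₂ x₀ ∈ osculatingBundle g r₂ r₁ x₀ := by
    rw [w₂]; exact Submodule.subset_span (by simp)
  have ne_zero : ∀ {v w : R42}, lieForm v w = -1 → v ≠ 0 := by
    rintro v w h rfl
    simp at h
  have hW : ∀ v ∈ osculatingBundle g r₁ r₂ x₀, ∀ w ∈ osculatingBundle g r₂ r₁ x₀,
      lieForm v w = 0 := by
    intro v hv w hw
    rw [w₁] at hv
    rw [w₂] at hw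
    obtain ⟨h1, h2, h3⟩ := e₀.orthogonal_of_mem hx₀ hv
    obtain ⟨a, b, c, rfl⟩ := Submodule.mem_span_triple.1 hw
    rw [lieForm_comm]
    simp [h1, h2, h3]
  refine ⟨_, _, c₁, c₂, hB.isTwoOneSpace, hB'.isTwoOneSpace, p, hB.mem₃, _, hq,
    ⟨hB.pp, ne_zero N.σ₂τ₂, N.σ₂σ₂, hW _ hB.mem₃ _ hq⟩,
    projectsToJoachimsthal hg.legendre.null hW hB hq fun x => ?_⟩
  obtain ⟨U, hx, ⟨e⟩⟩ := hfr x
  have h₁ : ∀ y ∈ U, osculatingBundle g r₁ r₂ x₀ = Submodule.span ℝ {e.σ₁ y, e.ν₁ y, e.τ₁ y} :=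
    fun y hy => (c₁ y).symm.trans (e.osculatingBundle_eq hy)
  have h₂ : ∀ y ∈ U, osculatingBundle g r₂ r₁ x₀ = Submodule.span ℝ {e.σ₂ y, e.ν₂ y, e.τ₂ y} :=
    fun y hy => (c₂ y).symm.trans (e.symm.osculatingBundle_eq hy)
  -- Constancy of the two bundles carries `p` and `q`, chosen at `x₀`, into the span of every
  -- adapted frame.
  refine ⟨U, hx, e, ⟨hB.pp, ne_zero N.σ₂τ₂, fun y hy => h₁ y hy ▸ hB.mem₃, fun y hy => h₂ y hy ▸ hq,
    fun y hy => hB.ne_zero_of_null ?_ (e.gram y hy).σ₁σ₁ (ne_zero (e.gram y hy).σ₁τ₁)⟩, h₁, h₂⟩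
  rw [h₁ y hy]
  exact Submodule.subset_span (by simp)
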